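/- Let $k\ge 4$, let $\Gamma=\langle\gamma\rangle$ be a cyclic group of order $k$, and let $2\le j\le k-2$. \emph{Gain graphs.} A (finite) $\Gamma$-gain graph $(G,\psi)$ is a finite directed multigraph $G$ with a map $\psi:E(G)\to\Gamma$ and a partition $V(G)=V_0(G)\,\dot\cup\,\overline{V(G)}$ into fixed and free vertices with $|V_0(G)|\le 1$, such that: parallel edges $e\neq f$ with the same direction have $\psi(e)\ne\psi(f)$ and parallel edges $e\neq f$ with opposite directions have $\psi(e)\neq\psi(f)^{-1}$ (two loops at a vertex are subject to both conditions); the fixed vertex is incident to no loop and to no parallel edges; loops have gain $\neq\mathrm{id}$. The gain of a walk is the product of the $\psi(e)^{\pm1}$ over its steps, with exponent $+1$ if $e$ is traversed along its direction and $-1$ otherwise. For a connected edge set $X$ let $V(X)$ be the set of its end vertices, $V_0(X)$ the set of fixed vertices in $V(X)$, and $\langle X\rangle\le\Gamma$ the group generated by the gains of the closed walks in $X$ that contain no fixed vertex. $X$ is balanced if $\langle X\rangle$ is trivial. $X$ is near-balanced if $V_0(X)=\emptyset$, $X$ is unbalanced, and there are $v\in V(X)$ and $\delta\in\Gamma$ such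 that every closed walk in $X$ starting at $v$ and not having $v$ as an internal vertex has gain $\mathrm{id}$, $\delta$ or $\delta^{-1}$; it is proper near-balanced if moreover $\langle X\rangle\not\simeq\mathbb Z_2,\mathbb Z_3$. For $i\in\{-1,0,1\}$ let $S_i(k,j)$ be the set of integers $n\ge2$ with $n\mid k$, $j\equiv i\pmod n$, and $n\ne2$ if $j$ is odd. \emph{Gain tightness.} For a connected edge set $X$ put $$\alpha_k^j(X)=\begin{cases}0&\text{if }X\text{ is balanced},\\ 1&\text{if }j\text{ is odd and }\langle X\rangle\simeq\mathbb Z_2,\\ 2-|V_0(X)|&\text{if }\langle X\rangle\simeq\mathbb Z_n\text{ for some }n\in S_{-1}(k,j)\cup S_1(k,j),\\ 2-2|V_0(X)|&\text{if }\langle X\rangle\simeq\mathbb Z_n\text{ for some }n\in S_0(k,j)\text{, or if }X\text{ is proper near-balanced},\\ 3-2|V_0(X)|&\text{otherwise},\end{cases}$$ and for an edge set $F$ put $f_k^j(F)=\sum_X\big(2|V(X)|-3+\alpha_k^j(X)\big)$, where $X$ runs over the connected components of $F$. Then $(G,\psi)$ is $\mathbb Z_k^j$-gain tight if $|F|\le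 f_k^j(F)$ for all non-empty $F\subseteq E(G)$ and $|E(G)|=f_k^j(E(G))$. \emph{1-reductions.} Let $v$ be a free vertex of degree $3$ without a loop. A 1-reduction at $v$ chooses two of the three edges at $v$, say (after redirecting them, with inverted gains, if necessary) $e_1=(v,v_1)$ and $e_2=(v,v_2)$, where $v_1=v_2$ is allowed, deletes $v$ with its three edges, and adds a new edge $(v_1,v_2)$ of gain $\psi(e_1)^{-1}\psi(e_2)$, provided that the result is again a $\Gamma$-gain graph. It is admissible if the result is $\mathbb Z_k^j$-gain tight. \textbf{Theorem.} Let $(G,\psi)$ be a $\mathbb Z_k^j$-gain tight $\Gamma$-gain graph with a free vertex $v$ of degree $3$ without a loop. If there is no admissible 1-reduction at $v$, then $k$ is even, $j$ is odd, $v$ has exactly two neighbours, exactly one of which, say $v_1$, is free, and the $2$-cycle $v,v_1,v$ formed by the two edges between $v$ and $v_1$ has gain $\gamma^{k/2}$. -/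

import Mathlib

/-- A finite `Γ`-gain graph with vertex set `V` and edge set `E`: a directed multigraph with a
gain on every edge and a set `fixed` of at most one vertex. The vertices outside `fixed` are the
free vertices. -/
structure GainGraph (V E Γ : Type*) [Group Γ] where
  /-- the tail of an edge -/
  src : E → V
  /-- the head of an edge -/
  tgt : E → V
  /-- the gain function -/
  gain : E → Γ
  /-- the set of fixed vertices -/
  fixed : Set V
  fixed_subsingleton : fixed.Subsingleton
  /-- parallel edges with the same direction have different gains -/
  gain_ne_of_parallel : ∀ e f, e ≠ f → src e = src f → tgt e = tgt f → gain e ≠ gain f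
  /-- parallel edges with opposite directions do not have inverse gains -/
  gain_ne_of_antiparallel : ∀ e f, e ≠ f → src e = tgt f → tgt e = src f → gain e ≠ (gain f)⁻¹
  /-- a fixed vertex has no loop -/
  fixed_no_loop : ∀ e, src e ∈ fixed → src e ≠ tgt e
  /-- a fixed vertex is not incident to parallel edges -/
  fixed_no_parallel : ∀ e f, (src e ∈ fixed ∨ tgt e ∈ fixed) →
    s(src e, tgt e) = s(src f, tgt f) → e = f
  /-- the gain of a loop is not the identity -/
  loop_gain_ne_one : ∀ e, src e = tgt e → gain e ≠ 1

namespace GainGraph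

section Walks

variable {V E Γ : Type*} [Group Γ] (G : GainGraph V E Γ)

/-- The vertex at which a step starts: the step `(e, true)` traverses `e` along its direction,
the step `(e, false)` against it. -/
def tail : E × Bool → V
  | (e, true) => G.src e
  | (e, false) => G.tgt e

/-- The vertex at which a step ends. -/
def head : E × Bool → V
  | (e, true) => G.tgt e
  | (e, false) => G.src e

/-- The contribution `ψ(e)` or `ψ(e)⁻¹` of a step to the gain of a walk. -/
def stepGain : E × Bool → Γ
  | (e, true) => G.gain e
  | (e, false) => (G.gain e)⁻¹

/-- `G.IsWalk u l w`: the list of steps `l` is a walk from `u` to `w`. -/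
def IsWalk : V → List (E × Bool) → V → Prop
  | u, [], w => u = w
  | u, s :: l, w => G.tail s = u ∧ IsWalk (G.head s) l w

/-- The gain of a walk. -/
def walkGain (l : List (E × Bool)) : Γ := (l.map G.stepGain).prod

/-- The group `⟨F⟩` generated by the gains of the closed walks in the edge set `F` that contain
no fixed vertex. -/
def gainGroup (F : Finset E) : Subgroup Γ :=
  Subgroup.closure {g | ∃ u l, G.IsWalk u l u ∧ (∀ s ∈ l, s.1 ∈ F) ∧
    u ∉ G.fixed ∧ (∀ s ∈ l, G.head s ∉ G.fixed) ∧ G.walkGain l = g}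

/-- The edge set `F` satisfies `⟨F⟩ ≃ ℤ_n`. -/
def HasGroup (F : Finset E) (n : ℕ) : Prop :=
  Nonempty (G.gainGroup F ≃* Multiplicative (ZMod n))

/-- The edge set `F` is balanced. -/
def Balanced (F : Finset E) : Prop := G.gainGroup F = ⊥

/-- `u` and `w` are joined by a walk whose edges lie in `F`. -/
def Reachable (F : Finset E) (u w : V) : Prop :=
  ∃ l, G.IsWalk u l w ∧ ∀ s ∈ l, s.1 ∈ F

open Classical in
/-- The vertices of the subgraph induced by the edge set `F`. -/
noncomputable def verts (F : Finset E) : Finset V := F.image G.src ∪ F.image G.tgt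

open Classical in
/-- The fixed vertices of the subgraph induced by the edge set `F`. -/
noncomputable def fixedVerts (F : Finset E) : Finset V := (G.verts F).filter (· ∈ G.fixed)

open Classical in
/-- The connected components of the edge set `F`, as edge sets. -/
noncomputable def components (F : Finset E) : Finset (Finset E) :=
  F.image fun e => F.filter fun f => G.Reachable F (G.src e) (G.src f)

/-- The edge set `F` (with no fixed vertex) is near-balanced: it is unbalanced and there are a base
vertex `v` and a gain `δ` such that every closed walk in `F` that starts at `v` and does not have
`v` as an internal vertex has gain `1`, `δ` or `δ⁻¹`. -/
def NearBalanced (F : Finset E) : Prop :=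
  G.fixedVerts F = ∅ ∧ ¬ G.Balanced F ∧
    ∃ v ∈ G.verts F, ∃ δ : Γ, ∀ l, G.IsWalk v l v → (∀ s ∈ l, s.1 ∈ F) →
      (∀ s ∈ l.dropLast, G.head s ≠ v) →
      G.walkGain l = 1 ∨ G.walkGain l = δ ∨ G.walkGain l = δ⁻¹

/-- The edge set `F` is proper near-balanced. -/
def ProperNearBalanced (F : Finset E) : Prop :=
  G.NearBalanced F ∧ ¬ G.HasGroup F 2 ∧ ¬ G.HasGroup F 3

end Walks

/-- The set `S_i(k, j)`. -/
def SSet (i : ℤ) (k j : ℕ) : Set ℕ :=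
  {n | 2 ≤ n ∧ n ∣ k ∧ (Odd j → n ≠ 2) ∧ (j : ℤ) ≡ i [ZMOD n]}

section Count

variable {V E Γ : Type*} [Group Γ] (G : GainGraph V E Γ)

/-- The edge set `F` is `S_0(k, j)`. -/
def IsSZero (k j : ℕ) (F : Finset E) : Prop :=
  ∃ n ∈ SSet 0 k j, G.HasGroup F n

/-- The edge set `F` is `S_{±1}(k, j)`. -/
def IsSOne (k j : ℕ) (F : Finset E) : Prop :=
  ∃ n ∈ SSet (-1) k j ∪ SSet 1 k j, G.HasGroup F n

open Classical in
/-- The number `α_k^j(X)` of a connected edge set `X`. -/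
noncomputable def alpha (k j : ℕ) (X : Finset E) : ℤ :=
  if G.Balanced X then 0
  else if Odd j ∧ G.HasGroup X 2 then 1
  else if G.IsSOne k j X then 2 - (G.fixedVerts X).card
  else if G.IsSZero k j X ∨ G.ProperNearBalanced X then 2 - 2 * (G.fixedVerts X).card
  else 3 - 2 * (G.fixedVerts X).card

/-- The function `f_k^j` on edge sets. -/
noncomputable def count (k j : ℕ) (F : Finset E) : ℤ :=
  ∑ X ∈ G.components F, (2 * ((G.verts X).card : ℤ) - 3 + G.alpha k j X)

/-- `ℤ_k^j`-gain sparsity. A subgraph enters the condition only through its edge set. -/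
def GainSparse (k j : ℕ) : Prop :=
  ∀ F : Finset E, F.Nonempty → (F.card : ℤ) ≤ G.count k j F

/-- `ℤ_k^j`-gain tightness. -/
def GainTight [Fintype E] (k j : ℕ) : Prop :=
  G.GainSparse k j ∧ (Fintype.card E : ℤ) = G.count k j Finset.univ

end Count

section Reduction

variable {V E Γ : Type*} [Group Γ] (G : GainGraph V E Γ)

open Classical in
/-- The degree of a vertex; a loop adds 2. -/
noncomputable def degree [Fintype E] (v : V) : ℕ :=
  (Finset.univ.filter fun e => G.src e = v).card + (Finset.univ.filter fun e => G.tgt e = v).card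

/-- The set of neighbours of a vertex. -/
def neighbors (v : V) : Set V := {w | ∃ s, G.tail s = v ∧ G.head s = w}

/-- The edges that are not incident to `v`. -/
abbrev EdgesAway (v : V) : Type _ := {e : E // G.src e ≠ v ∧ G.tgt e ≠ v}

/-- `G.IsOneReduction v G'`: the gain graph `G'` arises from `G` by a 1-reduction at the free
vertex `v`, which has degree 3 and no loop. It chooses two different edges at `v`, traversed from
`v` by the steps `s` to `v₁` and `t` to `v₂`, deletes `v` and its edges, and adds one new edge
(the edge `none` of `G'`) from `v₁` to `v₂` with gain `ψ(s)⁻¹ ψ(t)`. That `G'` is a gain graph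
is part of its type. -/
def IsOneReduction [Fintype E] (v : V)
    (G' : GainGraph {w : V // w ≠ v} (Option (G.EdgesAway v)) Γ) : Prop :=
  v ∉ G.fixed ∧ G.degree v = 3 ∧ (∀ e, ¬ (G.src e = v ∧ G.tgt e = v)) ∧
  (∀ w, w ∈ G'.fixed ↔ (w : V) ∈ G.fixed) ∧
  (∀ e : G.EdgesAway v, (G'.src (some e) : V) = G.src e ∧ (G'.tgt (some e) : V) = G.tgt e ∧
    G'.gain (some e) = G.gain e) ∧
  ∃ s t : E × Bool, s.1 ≠ t.1 ∧ G.tail s = v ∧ G.tail t = v ∧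
    (G'.src none : V) = G.head s ∧ (G'.tgt none : V) = G.head t ∧
    G'.gain none = (G.stepGain s)⁻¹ * G.stepGain t

open Classical in
/-- There is an admissible 1-reduction at `v`: one whose result is again `ℤ_k^j`-gain tight. -/
def HasAdmissibleOneReduction [Fintype E] (k j : ℕ) (v : V) : Prop :=
  ∃ G' : GainGraph {w : V // w ≠ v} (Option (G.EdgesAway v)) Γ,
    G.IsOneReduction v G' ∧ G'.GainTight k j

end Reduction

end GainGraph

/-!
Call an edge set sparse if the gain count holds for it and its subsets. For connected `F` the count
is `2 |V| - defect F`, where `V` are the free end vertices and the defect is the number of rigid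
motions of symmetry type `j` that `F` allows, or `1` if there are none although `F` avoids the fixed
vertex and can be balanced by splitting one vertex into two. The function
`f = 2 |V| - defect` satisfies `f (X ∪ Y) + |X ∩ Y| ≤ f X + f Y` if `X ∩ Y` is nonempty and sparse.
Hence circuits can be eliminated, and the sparse sets are the independent sets of a matroid.

Add to `G` the three edges that the possible 1-reductions at `v` add. If none of these is
admissible, then the matroid closure of the edges away from `v` contains all three. So these edges
may be exchanged for any independent set `K` of new edges, and `K` stays independent together with
the three edges at `v`. All these edges lie in the wheel formed by the star at `v` and the triangle
of new edges, hence `|K| + 3 + defect ≤ 2 |V|` for the wheel. Both the defect of the wheel and the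
possible `K` depend only on which neighbours of `v` coincide or are fixed, and on the gains of the
resulting 2-cycles, so only few cases have to be compared.
-/

/-- A labelled directed multigraph with a set of fixed vertices, without the restrictions on
parallel edges and loops of a gain graph. The gain group is written additively; it will be the
additive form of the cyclic group `Γ`. -/
structure PreGainGraph (V U Γ : Type*) where
  src : U → V
  tgt : U → V
  gain : U → Γ
  fixed : Set V

namespace PreGainGraph

section Ends

variable {V U Γ : Type*} (P : PreGainGraph V U Γ) {F X Y : Finset U}

open Classical in
/-- The free end vertices of the edge set `F`. -/
noncomputable def freeVerts (F : Finset U) : Finset V :=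
  (F.image P.src ∪ F.image P.tgt).filter (· ∉ P.fixed)

/-- Some edge of `F` has a fixed end vertex. -/
def Pinned (F : Finset U) : Prop := ∃ e ∈ F, P.src e ∈ P.fixed ∨ P.tgt e ∈ P.fixed

variable {P}

theorem mem_freeVerts {x : V} :
    x ∈ P.freeVerts F ↔ (∃ e ∈ F, P.src e = x ∨ P.tgt e = x) ∧ x ∉ P.fixed := by
  simp only [freeVerts, Finset.mem_filter, Finset.mem_union, Finset.mem_image, and_or_left,
    exists_or]

theorem src_mem_freeVerts {e : U} (he : e ∈ F) (h : P.src e ∉ P.fixed) :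
    P.src e ∈ P.freeVerts F := mem_freeVerts.2 ⟨⟨e, he, Or.inl rfl⟩, h⟩

theorem tgt_mem_freeVerts {e : U} (he : e ∈ F) (h : P.tgt e ∉ P.fixed) :
    P.tgt e ∈ P.freeVerts F := mem_freeVerts.2 ⟨⟨e, he, Or.inr rfl⟩, h⟩

theorem notMem_fixed_of_mem_freeVerts {x : V} (h : x ∈ P.freeVerts F) : x ∉ P.fixed :=
  (mem_freeVerts.1 h).2

theorem freeVerts_subset_iff {A : Finset V} : P.freeVerts F ⊆ A ↔
    ∀ e ∈ F, (P.src e ∉ P.fixed → P.src e ∈ A) ∧ (P.tgt e ∉ P.fixed → P.tgt e ∈ A) := by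
  constructor
  · exact fun h e he => ⟨fun hfree => h (src_mem_freeVerts he hfree),
      fun hfree => h (tgt_mem_freeVerts he hfree)⟩
  · intro h x hx
    obtain ⟨⟨e, he, rfl | rfl⟩, hfree⟩ := mem_freeVerts.1 hx
    exacts [(h e he).1 hfree, (h e he).2 hfree]

theorem freeVerts_mono (h : X ⊆ Y) : P.freeVerts X ⊆ P.freeVerts Y :=
  freeVerts_subset_iff.2 fun _ he => ⟨src_mem_freeVerts (h he), tgt_mem_freeVerts (h he)⟩

theorem freeVerts_union [DecidableEq V] [DecidableEq U] :
    P.freeVerts (X ∪ Y) = P.freeVerts X ∪ P.freeVerts Y := by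
  ext x
  simp only [mem_freeVerts, Finset.mem_union, or_and_right, exists_or]

theorem freeVerts_inter_subset [DecidableEq V] [DecidableEq U] :
    P.freeVerts (X ∩ Y) ⊆ P.freeVerts X ∩ P.freeVerts Y :=
  Finset.subset_inter (freeVerts_mono Finset.inter_subset_left)
    (freeVerts_mono Finset.inter_subset_right)

theorem Pinned.mono (h : X ⊆ Y) (hX : P.Pinned X) : P.Pinned Y := by
  obtain ⟨e, he, hfixed⟩ := hX
  exact ⟨e, h he, hfixed⟩

theorem src_free (h : ¬ P.Pinned F) {e : U} (he : e ∈ F) : P.src e ∉ P.fixed :=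
  fun hfixed => h ⟨e, he, Or.inl hfixed⟩

theorem tgt_free (h : ¬ P.Pinned F) {e : U} (he : e ∈ F) : P.tgt e ∉ P.fixed :=
  fun hfixed => h ⟨e, he, Or.inr hfixed⟩

theorem pinned_union [DecidableEq U] : P.Pinned (X ∪ Y) ↔ P.Pinned X ∨ P.Pinned Y := by
  simp only [Pinned, Finset.mem_union, or_and_right, exists_or]

end Ends

section Balance

variable {V U Γ : Type*} [AddCommGroup Γ] (P : PreGainGraph V U Γ) {m : ℤ} {F X Y : Finset U}
  {p q r : V → Γ} {b : V}

/-- The `m`-fold multiples of the gains on `F` come from a potential on the free vertices. This is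
the case exactly if `m` annihilates the gain group of each component of `F`. -/
def MulBalanced (m : ℤ) (F : Finset U) : Prop :=
  ∃ p : V → Γ, ∀ e ∈ F, P.src e ∉ P.fixed → P.tgt e ∉ P.fixed →
    m • P.gain e = p (P.tgt e) - p (P.src e)

/-- The gain of every edge of `F` is the difference of the values of `r` at its ends. In contrast
to `MulBalanced 1`, this includes the edges at a fixed vertex. -/
def IsPotential (r : V → Γ) (F : Finset U) : Prop :=
  ∀ e ∈ F, P.gain e = r (P.tgt e) - r (P.src e)

/-- The gain of `e` is the difference of the values at its ends, where at each end a value of `p`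
or of `q` may be used. -/
def Explains (p q : V → Γ) (e : U) : Prop :=
  ∃ x y, (x = p (P.src e) ∨ x = q (P.src e)) ∧ (y = p (P.tgt e) ∨ y = q (P.tgt e)) ∧
    P.gain e = y - x

/-- A potential of `F` after the vertex `b` has been split into two, with values `p b` and `q b` at
the two copies of `b`. -/
def IsSplitPotential (p q : V → Γ) (b : V) (F : Finset U) : Prop :=
  (∀ x, x ≠ b → p x = q x) ∧ ∀ e ∈ F, P.Explains p q e

/-- The edge set `F` becomes balanced after splitting one vertex into two. Proper near-balanced edge
sets have this property, and a connected edge set without fixed vertices that has it is balanced or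
near-balanced. -/
def SplitBalanced (F : Finset U) : Prop := ∃ p q b, P.IsSplitPotential p q b F

variable {P}

theorem MulBalanced.mono (h : X ⊆ Y) (hY : P.MulBalanced m Y) : P.MulBalanced m X := by
  obtain ⟨p, hp⟩ := hY
  exact ⟨p, fun e he => hp e (h he)⟩

theorem MulBalanced.add {n : ℤ} (hm : P.MulBalanced m F) (hn : P.MulBalanced n F) :
    P.MulBalanced (m + n) F := by
  obtain ⟨p, hp⟩ := hm
  obtain ⟨q, hq⟩ := hn
  refine ⟨p + q, fun e he hs ht => ?_⟩
  rw [add_smul, hp e he hs ht, hq e he hs ht, Pi.add_apply, Pi.add_apply]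
  abel

theorem MulBalanced.mul_left (n : ℤ) (h : P.MulBalanced m F) : P.MulBalanced (n * m) F := by
  obtain ⟨p, hp⟩ := h
  refine ⟨n • p, fun e he hs ht => ?_⟩
  rw [mul_smul, hp e he hs ht, smul_sub, Pi.smul_apply, Pi.smul_apply]

theorem MulBalanced.of_one (h : P.MulBalanced 1 F) (m : ℤ) : P.MulBalanced m F :=
  mul_one m ▸ h.mul_left m

theorem MulBalanced.exists_isPotential (hpin : ¬ P.Pinned F) (h : P.MulBalanced 1 F) :
    ∃ r, P.IsPotential r F := by
  obtain ⟨r, hr⟩ := h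
  exact ⟨r, fun e he => by simpa using hr e he (src_free hpin he) (tgt_free hpin he)⟩

theorem IsPotential.mulBalanced (h : P.IsPotential r F) (m : ℤ) : P.MulBalanced m F :=
  .of_one ⟨r, fun e he _ _ => by simpa using h e he⟩ m

theorem IsPotential.mono (h : X ⊆ Y) (hY : P.IsPotential r Y) : P.IsPotential r X :=
  fun e he => hY e (h he)

theorem IsPotential.isSplitPotential (h : P.IsPotential r F) (b : V) :
    P.IsSplitPotential r r b F :=
  ⟨fun _ _ => rfl, fun e he => ⟨_, _, .inl rfl, .inl rfl, h e he⟩⟩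

theorem IsSplitPotential.mono (h : X ⊆ Y) (hY : P.IsSplitPotential p q b Y) :
    P.IsSplitPotential p q b X :=
  ⟨hY.1, fun e he => hY.2 e (h he)⟩

theorem IsSplitPotential.swap (h : P.IsSplitPotential p q b F) : P.IsSplitPotential q p b F := by
  refine ⟨fun x hx => (h.1 x hx).symm, fun e he => ?_⟩
  obtain ⟨x, y, hx, hy, hg⟩ := h.2 e he
  exact ⟨x, y, hx.symm, hy.symm, hg⟩

theorem IsSplitPotential.gain_eq (h : P.IsSplitPotential p q b F) {e : U} (he : e ∈ F)
    (hsrc : P.src e ≠ b) (htgt : P.tgt e ≠ b) : P.gain e = p (P.tgt e) - p (P.src e) := by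
  obtain ⟨x, y, hx, hy, hg⟩ := h.2 e he
  rw [← h.1 _ hsrc, or_self] at hx
  rw [← h.1 _ htgt, or_self] at hy
  rw [hg, hx, hy]

theorem SplitBalanced.mono (h : X ⊆ Y) (hY : P.SplitBalanced Y) : P.SplitBalanced X := by
  obtain ⟨p, q, b, hp⟩ := hY
  exact ⟨p, q, b, hp.mono h⟩

end Balance

section Defect

variable {V U Γ : Type*} [AddCommGroup Γ] (P : PreGainGraph V U Γ) {j : ℤ} {F X Y I : Finset U}

open Classical in
/-- The types of the infinitesimal motions of symmetry type `j` that `F` allows as a rigid body: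
`0` stands for the rotation and `±1` for the two translations, which move the fixed vertices. -/
noncomputable def rigidTypes (j : ℤ) (F : Finset U) : Finset ℤ :=
  ({-1, 0, 1} : Finset ℤ).filter fun i =>
    P.MulBalanced (j + i) F ∧ (i = 0 ∨ ¬ P.Pinned F)

open Classical in
/-- The number by which the sparsity count of `F` falls short of twice the number of its free
vertices. For connected `F` it is `3 - α(F)` minus `2` if there is a fixed vertex. -/
noncomputable def defect (j : ℤ) (F : Finset U) : ℕ :=
  if ¬ P.Pinned F ∧ P.SplitBalanced F then max (P.rigidTypes j F).card 1
  else (P.rigidTypes j F).card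

/-- The sparsity condition in terms of the defect, which makes no reference to connected
components. -/
def Indep (j : ℤ) (I : Finset U) : Prop :=
  ∀ F ⊆ I, F.Nonempty → F.card + P.defect j F ≤ 2 * (P.freeVerts F).card

variable {P}

theorem mem_rigidTypes {i : ℤ} : i ∈ P.rigidTypes j F ↔
    i ∈ ({-1, 0, 1} : Finset ℤ) ∧ P.MulBalanced (j + i) F ∧ (i = 0 ∨ ¬ P.Pinned F) := by
  classical exact Finset.mem_filter

theorem rigidTypes_subset : P.rigidTypes j F ⊆ {-1, 0, 1} :=
  fun _ hi => (mem_rigidTypes.1 hi).1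

theorem rigidTypes_anti (h : X ⊆ Y) : P.rigidTypes j Y ⊆ P.rigidTypes j X := fun i hi => by
  obtain ⟨hmem, hbal, hpin⟩ := mem_rigidTypes.1 hi
  exact mem_rigidTypes.2 ⟨hmem, hbal.mono h, hpin.imp_right fun hY hX => hY (hX.mono h)⟩

theorem card_rigidTypes_le_defect : (P.rigidTypes j F).card ≤ P.defect j F := by
  unfold defect
  split_ifs
  exacts [le_max_left _ _, le_rfl]

theorem defect_of_not_splitBalanced (h : ¬ (¬ P.Pinned F ∧ P.SplitBalanced F)) :
    P.defect j F = (P.rigidTypes j F).card :=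
  if_neg h

open Classical in
theorem defect_of_pinned (hpin : P.Pinned F) :
    P.defect j F = if P.MulBalanced j F then 1 else 0 := by
  rw [defect_of_not_splitBalanced fun h => h.1 hpin]
  have htypes : P.rigidTypes j F =
      if P.MulBalanced j F then {0} else ∅ := by
    ext i
    simp only [mem_rigidTypes, hpin, not_true_eq_false, or_false]
    split_ifs with hbal
    · rw [Finset.mem_singleton]
      exact ⟨fun h => h.2.2, by rintro rfl; simpa using hbal⟩
    · refine iff_of_false ?_ (Finset.notMem_empty i)
      rintro ⟨-, h, rfl⟩
      exact hbal (by simpa using h)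
  rw [htypes]
  split_ifs <;> rfl

theorem one_le_defect_of_splitBalanced (hpin : ¬ P.Pinned F) (h : P.SplitBalanced F) :
    1 ≤ P.defect j F := by
  rw [defect, if_pos ⟨hpin, h⟩]
  exact le_max_right _ _

theorem one_le_defect_of_mulBalanced (h : P.MulBalanced j F) : 1 ≤ P.defect j F := by
  refine le_trans ?_ card_rigidTypes_le_defect
  exact Finset.card_pos.2 ⟨0, mem_rigidTypes.2 ⟨by decide, by simpa using h, Or.inl rfl⟩⟩

theorem defect_anti (h : X ⊆ Y) : P.defect j Y ≤ P.defect j X := by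
  have hcard := (Finset.card_le_card (rigidTypes_anti (P := P) (j := j) h)).trans
    card_rigidTypes_le_defect
  by_cases hY : ¬ P.Pinned Y ∧ P.SplitBalanced Y
  · rw [defect, if_pos hY]
    exact max_le hcard (one_le_defect_of_splitBalanced (fun hX => hY.1 (hX.mono h)) (hY.2.mono h))
  · rwa [defect_of_not_splitBalanced hY]

theorem defect_le_three : P.defect j F ≤ 3 := by
  have hcard : (P.rigidTypes j F).card ≤ 3 := Finset.card_le_card rigidTypes_subset
  unfold defect
  split_ifs
  exacts [max_le hcard (by norm_num), hcard]

theorem card_rigidTypes_le_one_of_dvd {d : ℕ} (hdvd : ∀ m : ℤ, P.MulBalanced m F → (d : ℤ) ∣ m)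
    (hone : d ≠ 1) (htwo : ¬ (Odd j ∧ d = 2)) : (P.rigidTypes j F).card ≤ 1 := by
  refine Finset.card_le_one.2 fun i hi i' hi' => ?_
  simp only [mem_rigidTypes, Finset.mem_insert, Finset.mem_singleton] at hi hi'
  obtain ⟨hi, hbal, -⟩ := hi
  obtain ⟨hi', hbal', -⟩ := hi'
  by_contra hne
  have hsub : (d : ℤ) ∣ i - i' := by simpa using dvd_sub (hdvd _ hbal) (hdvd _ hbal')
  have hle : d ∣ 2 := by
    refine Int.natCast_dvd_natCast.1 (hsub.trans ?_)
    rcases hi with rfl | rfl | rfl <;> rcases hi' with rfl | rfl | rfl <;> simp_all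
  obtain rfl : d = 2 := ((Nat.dvd_prime Nat.prime_two).1 hle).resolve_left hone
  have hdvd_two := hdvd _ hbal
  have hdvd_two' := hdvd _ hbal'
  rw [Int.odd_iff] at htwo
  omega

theorem rigidTypes_eq_iff : P.rigidTypes j F = {-1, 0, 1} ↔
    ¬ P.Pinned F ∧ P.MulBalanced 1 F := by
  constructor
  · intro h
    have hone := (mem_rigidTypes (P := P) (F := F) (j := j) (i := 1)).1 (h ▸ by decide)
    have hzero := (mem_rigidTypes (P := P) (F := F) (j := j) (i := 0)).1 (h ▸ by decide)
    refine ⟨hone.2.2.resolve_left one_ne_zero, ?_⟩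
    convert hone.2.1.add (hzero.2.1.mul_left (-1)) using 1
    ring
  · rintro ⟨hpin, hbal⟩
    exact rigidTypes_subset.antisymm fun i hi => mem_rigidTypes.2 ⟨hi, hbal.of_one _, .inr hpin⟩

theorem defect_eq_three_iff : P.defect j F = 3 ↔ ¬ P.Pinned F ∧ P.MulBalanced 1 F := by
  rw [← rigidTypes_eq_iff (j := j)]
  constructor
  · intro h
    refine Finset.eq_of_subset_of_card_le rigidTypes_subset (le_of_eq_of_le (b := 3) rfl ?_)
    unfold defect at h
    split_ifs at h <;> omega
  · exact fun h => defect_le_three.antisymm ((congrArg Finset.card h).ge.trans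
      card_rigidTypes_le_defect)

theorem defect_eq_three (hpin : ¬ P.Pinned F) (hbal : P.MulBalanced 1 F) : P.defect j F = 3 :=
  defect_eq_three_iff.2 ⟨hpin, hbal⟩

theorem Indep.subset (hI : P.Indep j Y) (h : X ⊆ Y) : P.Indep j X :=
  fun F hF => hI F (hF.trans h)

theorem Indep.card_add_le (hI : P.Indep j I) (hF : F ⊆ I) {A : Finset V} {d : ℕ}
    (hA : P.freeVerts F ⊆ A) (hd : F.Nonempty → d ≤ P.defect j F) (hdA : d ≤ 2 * A.card) :
    F.card + d ≤ 2 * A.card := by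
  rcases F.eq_empty_or_nonempty with rfl | hne
  · simpa using hdA
  · have hcount := hI F hF hne
    have hdefect := hd hne
    have hcard := Finset.card_le_card hA
    omega

theorem Indep.card_add_le_of_filter (hI : P.Indep j I) {p : U → Prop} [DecidablePred p]
    {A B : Finset V} {d d' : ℕ}
    (hA : P.freeVerts (I.filter p) ⊆ A) (hB : P.freeVerts (I.filter (¬ p ·)) ⊆ B)
    (hd : (I.filter p).Nonempty → d ≤ P.defect j (I.filter p))
    (hd' : (I.filter (¬ p ·)).Nonempty → d' ≤ P.defect j (I.filter (¬ p ·)))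
    (hdA : d ≤ 2 * A.card) (hdB : d' ≤ 2 * B.card) :
    I.card + d + d' ≤ 2 * A.card + 2 * B.card := by
  have hleft := hI.card_add_le (Finset.filter_subset _ _) hA hd hdA
  have hright := hI.card_add_le (Finset.filter_subset _ _) hB hd' hdB
  have hsplit := Finset.card_filter_add_card_filter_not (s := I) p
  omega

end Defect

section Separation

variable {V U Γ : Type*} (P : PreGainGraph V U Γ) {I : Finset U} {W A : Finset V}

/-- The set `A` is a nonempty proper part of `W`, and no edge of `I` between free vertices leads
from `A` to its complement. -/
def Separates (I : Finset U) (W A : Finset V) : Prop :=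
  A ⊂ W ∧ A.Nonempty ∧
    ∀ e ∈ I, P.src e ∉ P.fixed → P.tgt e ∉ P.fixed → (P.src e ∈ A ↔ P.tgt e ∈ A)

/-- The graph on the vertex set `W` with the edge set `I` is connected (or empty). -/
def Connects (I : Finset U) (W : Finset V) : Prop := ∀ A, ¬ P.Separates I W A

variable {P}

theorem Connects.eq_of_forall_edge {α : Type*} (h : P.Connects I W) (hI : P.freeVerts I ⊆ W)
    {s : V → α}
    (hs : ∀ e ∈ I, P.src e ∉ P.fixed → P.tgt e ∉ P.fixed → s (P.src e) = s (P.tgt e))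
    {x y : V} (hx : x ∈ W) (hy : y ∈ W) : s x = s y := by
  classical
  by_contra hne
  refine h (W.filter (s · = s x)) ⟨Finset.filter_ssubset.2 ⟨y, hy, Ne.symm hne⟩,
    ⟨x, by simp [hx]⟩, fun e he hsrc htgt => ?_⟩
  simp [hI (src_mem_freeVerts he hsrc), hI (tgt_mem_freeVerts he htgt), hs e he hsrc htgt]

theorem Connects.exists_shift [AddCommGroup Γ] {p p' : V → Γ} (h : P.Connects I W)
    (hW : P.freeVerts I ⊆ W)
    (hs : ∀ e ∈ I, P.src e ∉ P.fixed → P.tgt e ∉ P.fixed →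
      p (P.tgt e) - p (P.src e) = p' (P.tgt e) - p' (P.src e)) :
    ∃ s, ∀ x ∈ W, p' x = s + p x := by
  rcases W.eq_empty_or_nonempty with rfl | ⟨x₀, hx₀⟩
  · exact ⟨0, by simp⟩
  · refine ⟨p' x₀ - p x₀, fun x hx => sub_eq_iff_eq_add.1 ?_⟩
    refine h.eq_of_forall_edge hW (s := fun x => p' x - p x) (fun e he hsrc htgt => ?_) hx hx₀
    have := hs e he hsrc htgt
    grind

theorem Separates.freeVerts_filter_subset [DecidableEq V] (hfree : ∀ x ∈ W, x ∉ P.fixed)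
    (h : P.Separates I W A) :
    P.freeVerts (I.filter fun e => P.src e ∈ A ∨ P.tgt e ∈ A) ⊆ A := by
  refine freeVerts_subset_iff.2 fun e he => ?_
  obtain ⟨he, hmem⟩ := Finset.mem_filter.1 he
  have hclosed := h.2.2 e he
  have hsrc : P.src e ∈ A → P.src e ∉ P.fixed := fun hA => hfree _ (h.1.subset hA)
  have htgt : P.tgt e ∈ A → P.tgt e ∉ P.fixed := fun hA => hfree _ (h.1.subset hA)
  tauto

theorem freeVerts_filter_not_subset [DecidableEq V] (hW : P.freeVerts I ⊆ W) :
    P.freeVerts (I.filter fun e => ¬ (P.src e ∈ A ∨ P.tgt e ∈ A)) ⊆ W \ A := by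
  refine freeVerts_subset_iff.2 fun e he => ?_
  obtain ⟨he, hmem⟩ := Finset.mem_filter.1 he
  have hsub := freeVerts_subset_iff.1 hW e he
  simp only [Finset.mem_sdiff]
  tauto

variable [AddCommGroup Γ] {j : ℤ}

theorem Separates.exists_subset_erase_or_card_add_le [DecidableEq V] (h : P.Separates I W A)
    (hI : P.Indep j I) (hW : P.freeVerts I ⊆ W) (hfree : ∀ x ∈ W, x ∉ P.fixed) :
    (∃ w ∈ W, P.freeVerts I ⊆ W.erase w) ∨ I.card + 2 * P.defect j I ≤ 2 * W.card := by
  have hA := h.freeVerts_filter_subset hfree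
  have hB := freeVerts_filter_not_subset (A := A) hW
  obtain ⟨w, hwW, hwA⟩ := Finset.exists_of_ssubset h.1
  rcases (I.filter fun e => P.src e ∈ A ∨ P.tgt e ∈ A).eq_empty_or_nonempty with hnil | hne
  · obtain ⟨a, ha⟩ := h.2.1
    rw [Finset.filter_true_of_mem fun e he => Finset.filter_eq_empty_iff.1 hnil he] at hB
    exact .inl ⟨a, h.1.subset ha, hB.trans fun x hx => Finset.mem_erase.2
      ⟨fun hxa => (Finset.mem_sdiff.1 hx).2 (hxa ▸ ha), (Finset.mem_sdiff.1 hx).1⟩⟩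
  rcases (I.filter fun e => ¬ (P.src e ∈ A ∨ P.tgt e ∈ A)).eq_empty_or_nonempty with hnil' | hne'
  · rw [Finset.filter_true_of_mem fun e he =>
      not_not.1 (Finset.filter_eq_empty_iff.1 hnil' he)] at hA
    exact .inl ⟨w, hwW, hA.trans fun x hx => Finset.mem_erase.2
      ⟨fun hxw => hwA (hxw ▸ hx), h.1.subset hx⟩⟩
  · right
    have hleft := hI _ (Finset.filter_subset _ I) hne
    have hright := hI _ (Finset.filter_subset _ I) hne'
    have hdl := defect_anti (P := P) (j := j)
      (Finset.filter_subset (fun e => P.src e ∈ A ∨ P.tgt e ∈ A) I)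
    have hdr := defect_anti (P := P) (j := j)
      (Finset.filter_subset (fun e => ¬ (P.src e ∈ A ∨ P.tgt e ∈ A)) I)
    have hsum := Finset.card_filter_add_card_filter_not (s := I)
      (fun e => P.src e ∈ A ∨ P.tgt e ∈ A)
    have hcard := Finset.card_sdiff_add_card_eq_card h.1.subset
    have hcA := Finset.card_le_card hA
    have hcB := Finset.card_le_card hB
    omega

theorem Separates.card_add_le (h : P.Separates I W A) (hI : P.Indep j I) (hne : I.Nonempty)
    (hW : P.freeVerts I ⊆ W) (hfree : ∀ x ∈ W, x ∉ P.fixed) :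
    I.card + P.defect j I + min 2 (P.defect j I) ≤ 2 * W.card := by
  classical
  rcases h.exists_subset_erase_or_card_add_le hI hW hfree with ⟨w, hw, hsub⟩ | hcard
  · have hcount := hI I subset_rfl hne
    have hle := Finset.card_le_card hsub
    have herase := Finset.card_erase_add_one hw
    omega
  · omega

end Separation

section Gluing

variable {V U Γ : Type*} [DecidableEq V] [DecidableEq U] [AddCommGroup Γ]
  {P : PreGainGraph V U Γ} {j m : ℤ} {X Y : Finset U}
  {p q p' q' : V → Γ} {b : V}

theorem MulBalanced.union (h : P.Connects (X ∩ Y) (P.freeVerts X ∩ P.freeVerts Y))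
    (hX : P.MulBalanced m X) (hY : P.MulBalanced m Y) : P.MulBalanced m (X ∪ Y) := by
  obtain ⟨p, hp⟩ := hX
  obtain ⟨r, hr⟩ := hY
  obtain ⟨s, hs⟩ := h.exists_shift (p := p) (p' := r) freeVerts_inter_subset
    fun e he hsrc htgt => by
      rw [← hp e (Finset.mem_inter.1 he).1 hsrc htgt, ← hr e (Finset.mem_inter.1 he).2 hsrc htgt]
  have hglue : ∀ x ∈ P.freeVerts Y,
      (P.freeVerts X).piecewise p (fun x => r x - s) x = r x - s := by
    intro x hx
    by_cases hxX : x ∈ P.freeVerts X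
    · rw [Finset.piecewise_eq_of_mem _ _ _ hxX, hs x (Finset.mem_inter.2 ⟨hxX, hx⟩),
        add_sub_cancel_left]
    · rw [Finset.piecewise_eq_of_notMem _ _ _ hxX]
  refine ⟨(P.freeVerts X).piecewise p (fun x => r x - s), fun e he hsrc htgt => ?_⟩
  rcases Finset.mem_union.1 he with he | he
  · rw [Finset.piecewise_eq_of_mem _ _ _ (src_mem_freeVerts he hsrc),
      Finset.piecewise_eq_of_mem _ _ _ (tgt_mem_freeVerts he htgt), hp e he hsrc htgt]
  · rw [hglue _ (src_mem_freeVerts he hsrc), hglue _ (tgt_mem_freeVerts he htgt),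
      hr e he hsrc htgt, sub_sub_sub_cancel_right]

theorem card_rigidTypes_supermodular
    (h : P.Connects (X ∩ Y) (P.freeVerts X ∩ P.freeVerts Y)) :
    (P.rigidTypes j X).card + (P.rigidTypes j Y).card ≤
      (P.rigidTypes j (X ∩ Y)).card + (P.rigidTypes j (X ∪ Y)).card := by
  have hunion : P.rigidTypes j X ∪ P.rigidTypes j Y ⊆ P.rigidTypes j (X ∩ Y) :=
    Finset.union_subset (rigidTypes_anti Finset.inter_subset_left)
      (rigidTypes_anti Finset.inter_subset_right)
  have hinter : P.rigidTypes j X ∩ P.rigidTypes j Y ⊆ P.rigidTypes j (X ∪ Y) := by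
    intro i hi
    obtain ⟨hX, hY⟩ := Finset.mem_inter.1 hi
    obtain ⟨hmem, hbalX, hpinX⟩ := mem_rigidTypes.1 hX
    obtain ⟨-, hbalY, hpinY⟩ := mem_rigidTypes.1 hY
    rw [mem_rigidTypes, pinned_union]
    exact ⟨hmem, hbalX.union h hbalY, by tauto⟩
  have hcard := Finset.card_union_add_card_inter (P.rigidTypes j X) (P.rigidTypes j Y)
  have hle := Finset.card_le_card hunion
  have hle' := Finset.card_le_card hinter
  omega

theorem IsSplitPotential.union (hX : ¬ P.Pinned X) (hY : ¬ P.Pinned Y)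
    (hpX : P.IsSplitPotential p q b X) (hpY : P.IsSplitPotential p' q' b Y) (s : Γ)
    (hs : ∀ x ∈ P.freeVerts X ∩ P.freeVerts Y, x ≠ b → p' x = s + p x)
    (hsb : b ∈ P.freeVerts X ∩ P.freeVerts Y → (p' b = s + p b ∨ p' b = s + q b) ∧
      (q' b = s + p b ∨ q' b = s + q b)) :
    P.IsSplitPotential ((P.freeVerts X).piecewise p (fun x => p' x - s))
      ((P.freeVerts X).piecewise q (fun x => q' x - s)) b (X ∪ Y) := by
  set p₁ := (P.freeVerts X).piecewise p (fun x => p' x - s) with hp₁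
  set q₁ := (P.freeVerts X).piecewise q (fun x => q' x - s) with hq₁
  have hglue : ∀ x ∈ P.freeVerts Y, (p' x - s = p₁ x ∨ p' x - s = q₁ x) ∧
      (q' x - s = p₁ x ∨ q' x - s = q₁ x) := by
    intro x hx
    by_cases hxX : x ∈ P.freeVerts X
    · simp only [hp₁, hq₁, Finset.piecewise_eq_of_mem _ _ _ hxX, sub_eq_iff_eq_add, add_comm _ s]
      by_cases hxb : x = b
      · subst hxb
        exact hsb (Finset.mem_inter.2 ⟨hxX, hx⟩)
      · rw [← hpY.1 x hxb, ← hpX.1 x hxb]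
        exact ⟨.inl (hs x (Finset.mem_inter.2 ⟨hxX, hx⟩) hxb),
          .inl (hs x (Finset.mem_inter.2 ⟨hxX, hx⟩) hxb)⟩
    · simp [hp₁, hq₁, Finset.piecewise_eq_of_notMem _ _ _ hxX]
  refine ⟨fun x hx => ?_, fun e he => ?_⟩
  · simp only [hp₁, hq₁, Finset.piecewise, hpX.1 x hx, hpY.1 x hx]
  rcases Finset.mem_union.1 he with he | he
  · have hsrc := src_mem_freeVerts he (src_free hX he)
    have htgt := tgt_mem_freeVerts he (tgt_free hX he)
    obtain ⟨x, y, hx, hy, hg⟩ := hpX.2 e he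
    exact ⟨x, y, by simpa [hp₁, hq₁, hsrc] using hx, by simpa [hp₁, hq₁, htgt] using hy, hg⟩
  · obtain ⟨hps, hqs⟩ := hglue _ (src_mem_freeVerts he (src_free hY he))
    obtain ⟨hpt, hqt⟩ := hglue _ (tgt_mem_freeVerts he (tgt_free hY he))
    obtain ⟨x, y, hx, hy, hg⟩ := hpY.2 e he
    refine ⟨x - s, y - s, ?_, ?_, by rw [hg, sub_sub_sub_cancel_right]⟩
    · rcases hx with rfl | rfl
      exacts [hps, hqs]
    · rcases hy with rfl | rfl
      exacts [hpt, hqt]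

end Gluing

section ShiftClass

variable {V U Γ : Type*} [DecidableEq V] [DecidableEq Γ] [AddCommGroup Γ]

/-- The vertices of `W` other than `b` at which `p'` exceeds `p` by `s`. -/
def shiftClass (p p' : V → Γ) (b : V) (s : Γ) (W : Finset V) : Finset V :=
  W.filter fun x => x ≠ b ∧ p' x - p x = s

variable {P : PreGainGraph V U Γ} {j : ℤ} {I : Finset U} {W : Finset V}
  {p q p' q' r : V → Γ} {b : V} {s : Γ} {d d' : ℕ}

theorem mem_shiftClass {x : V} :
    x ∈ shiftClass p p' b s W ↔ x ∈ W ∧ x ≠ b ∧ p' x - p x = s :=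
  Finset.mem_filter

theorem shiftClass_subset : shiftClass p p' b s W ⊆ W := Finset.filter_subset _ _

theorem notMem_shiftClass : b ∉ shiftClass p p' b s W := fun h => (mem_shiftClass.1 h).2.1 rfl

theorem freeVerts_filter_shiftClass_subset (hpin : ¬ P.Pinned I) (hW : P.freeVerts I ⊆ W)
    (hp : P.IsSplitPotential p q b I) (hp' : P.IsSplitPotential p' q' b I) :
    P.freeVerts (I.filter fun e =>
      P.src e ∈ shiftClass p p' b s W ∨ P.tgt e ∈ shiftClass p p' b s W) ⊆
      insert b (shiftClass p p' b s W) := by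
  refine freeVerts_subset_iff.2 fun e he => ?_
  obtain ⟨he, hmem⟩ := Finset.mem_filter.1 he
  have hsrc := (freeVerts_subset_iff.1 hW e he).1 (src_free hpin he)
  have htgt := (freeVerts_subset_iff.1 hW e he).2 (tgt_free hpin he)
  have hgain := hp.gain_eq he
  have hgain' := hp'.gain_eq he
  simp only [Finset.mem_insert, mem_shiftClass] at hmem ⊢
  grind

theorem Indep.card_add_le_of_shiftClass (hI : P.Indep j I) (hpin : ¬ P.Pinned I)
    (hW : P.freeVerts I ⊆ W) (hp : P.IsSplitPotential p q b I) (hp' : P.IsSplitPotential p' q' b I)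
    (hd : d ≤ P.defect j (I.filter fun e =>
      P.src e ∈ shiftClass p p' b s W ∨ P.tgt e ∈ shiftClass p p' b s W))
    (hd' : d' ≤ P.defect j I) (hcard : d ≤ 2 * ((shiftClass p p' b s W).card + 1))
    (hcard' : d' ≤ 2 * (W \ shiftClass p p' b s W).card) :
    I.card + d + d' ≤ 2 * W.card + 2 := by
  have hinsert : (insert b (shiftClass p p' b s W)).card = (shiftClass p p' b s W).card + 1 :=
    Finset.card_insert_of_notMem notMem_shiftClass
  have hcompl := Finset.card_sdiff_add_card_eq_card (shiftClass_subset (p := p) (p' := p')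
    (b := b) (s := s) (W := W))
  have hsplit := hI.card_add_le_of_filter (freeVerts_filter_shiftClass_subset hpin hW hp hp')
    (freeVerts_filter_not_subset hW) (fun _ => hd)
    (fun _ => hd'.trans (defect_anti (Finset.filter_subset _ _))) (hcard.trans_eq (by rw [hinsert]))
    hcard'
  omega

end ShiftClass

section SplitBalancedUnion

variable {V U Γ : Type*} [AddCommGroup Γ] {P : PreGainGraph V U Γ} {j : ℤ}
  {I : Finset U} {W : Finset V} {p q p' q' r : V → Γ} {b b' : V} {s : Γ}

theorem Indep.card_add_four_le_of_shift_ne (hI : P.Indep j I) (hpin : ¬ P.Pinned I)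
    (hW : P.freeVerts I ⊆ W) (hbW : b ∈ W) (hp : P.IsSplitPotential p q b I)
    (hr : P.IsPotential r I) {x₀ x₁ : V} (hx₀ : x₀ ∈ W) (hx₁ : x₁ ∈ W) (hx₀b : x₀ ≠ b)
    (hx₁b : x₁ ≠ b) (hne : r x₀ - p x₀ ≠ r x₁ - p x₁) : I.card + 4 ≤ 2 * W.card := by
  classical
  have hdefect : ∀ F ⊆ I, 3 ≤ P.defect j F := fun F hF =>
    (defect_eq_three (fun h => hpin (h.mono hF)) ((hr.mono hF).mulBalanced 1)).ge
  have hpos : 0 < (shiftClass p r b (r x₀ - p x₀) W).card :=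
    Finset.card_pos.2 ⟨x₀, mem_shiftClass.2 ⟨hx₀, hx₀b, rfl⟩⟩
  have htwo : 1 < (W \ shiftClass p r b (r x₀ - p x₀) W).card :=
    Finset.one_lt_card.2 ⟨b, Finset.mem_sdiff.2 ⟨hbW, notMem_shiftClass⟩, x₁,
      Finset.mem_sdiff.2 ⟨hx₁, fun h => hne (mem_shiftClass.1 h).2.2.symm⟩, hx₁b.symm⟩
  have hcard := hI.card_add_le_of_shiftClass (s := r x₀ - p x₀) hpin hW hp (hr.isSplitPotential b)
    (hdefect _ (Finset.filter_subset _ _)) (hdefect I subset_rfl) (by omega) (by omega)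
  omega

theorem IsSplitPotential.exists_shift (hp : P.IsSplitPotential p q b I)
    (hr : P.IsPotential r I) (h : P.Connects I W) (hW : P.freeVerts I ⊆ W)
    (hshift : ∀ x₀ ∈ W, ∀ x₁ ∈ W, x₀ ≠ b → x₁ ≠ b → r x₀ - p x₀ = r x₁ - p x₁) :
    ∃ s, (∀ x ∈ W, x ≠ b → r x = s + p x) ∧ (b ∈ W → r b = s + p b ∨ r b = s + q b) := by
  by_cases hx₀ : ∃ x₀ ∈ W, x₀ ≠ b
  · obtain ⟨x₀, hx₀, hx₀b⟩ := hx₀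
    refine ⟨r x₀ - p x₀, fun x hx hxb => ?_, fun hbW => ?_⟩
    · rw [← hshift x hx x₀ hx₀ hxb hx₀b, sub_add_cancel]
    by_contra hne
    refine h {b} ⟨⟨by simpa using hbW, fun hsub => hx₀b (by simpa using hsub hx₀)⟩, by simp,
      fun e he hsrc htgt => ?_⟩
    have hsrcW := hW (src_mem_freeVerts he hsrc)
    have htgtW := hW (tgt_mem_freeVerts he htgt)
    obtain ⟨x, y, hx, hy, hgain⟩ := hp.2 e he
    have hrgain := hr e he
    have hshift_src := hshift _ hsrcW x₀ hx₀
    have hshift_tgt := hshift _ htgtW x₀ hx₀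
    have hpq_src := hp.1 (P.src e)
    have hpq_tgt := hp.1 (P.tgt e)
    simp only [Finset.mem_singleton]
    push Not at hne
    constructor <;> intro hend <;> by_contra hend' <;> grind
  · push Not at hx₀
    exact ⟨r b - p b, fun x hx hxb => absurd (hx₀ x hx) hxb, fun _ => by simp⟩

theorem IsSplitPotential.add_eq_of_gain_ne (hp : P.IsSplitPotential p q b I)
    (hp' : P.IsSplitPotential p' q' b I) {e : U} (he : e ∈ I)
    (hs : P.src e ≠ b ∧ p' (P.src e) - p (P.src e) = s ∨
      P.tgt e ≠ b ∧ p' (P.tgt e) - p (P.tgt e) = s)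
    (hgain : P.gain e ≠ p (P.tgt e) - p (P.src e)) :
    s + q b = p' b ∨ s + q b = q' b := by
  obtain ⟨x, y, hx, hy, hxy⟩ := hp.2 e he
  obtain ⟨x', y', hx', hy', hxy'⟩ := hp'.2 e he
  have hpq_src := hp.1 (P.src e)
  have hpq_tgt := hp.1 (P.tgt e)
  have hpq_src' := hp'.1 (P.src e)
  have hpq_tgt' := hp'.1 (P.tgt e)
  by_cases hsrc : P.src e = b <;> by_cases htgt : P.tgt e = b <;> grind

theorem IsSplitPotential.exists_shift_of_singleton (hp : P.IsSplitPotential p q b I)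
    (hp' : P.IsSplitPotential p' q' b I) (hpin : ¬ P.Pinned I) (hW : P.freeVerts I ⊆ {b})
    (hI : ¬ P.MulBalanced 1 I) :
    ∃ s, (p' b = s + p b ∨ p' b = s + q b) ∧ (q' b = s + p b ∨ q' b = s + q b) := by
  obtain ⟨e, he, hgain⟩ : ∃ e ∈ I, P.gain e ≠ p (P.tgt e) - p (P.src e) := by
    by_contra! hno
    exact hI (IsPotential.mulBalanced (r := p) hno 1)
  have hsrc := (freeVerts_subset_iff.1 hW e he).1 (src_free hpin he)
  have htgt := (freeVerts_subset_iff.1 hW e he).2 (tgt_free hpin he)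
  rw [Finset.mem_singleton] at hsrc htgt
  obtain ⟨x, y, hx, hy, hxy⟩ := hp.2 e he
  obtain ⟨x', y', hx', hy', hxy'⟩ := hp'.2 e he
  rw [hsrc] at hx hx' hgain
  rw [htgt] at hy hy' hgain
  by_cases hdiff : q b - p b = q' b - p' b
  · exact ⟨p' b - p b, by grind⟩
  · exact ⟨p' b - q b, by grind⟩

theorem IsSplitPotential.exists_shift_of_forall_add_eq (hp : P.IsSplitPotential p q b I)
    (hp' : P.IsSplitPotential p' q' b I) (hpin : ¬ P.Pinned I) (hW : P.freeVerts I ⊆ W)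
    (hI : ¬ P.MulBalanced 1 I) (hpq : (2 : ℤ) • p b ≠ (2 : ℤ) • q b)
    (hadd : ∀ x ∈ W, x ≠ b →
      p' x - p x + p b = p' b ∧ p' x - p x + q b = q' b ∨
      p' x - p x + p b = q' b ∧ p' x - p x + q b = p' b) :
    ∃ s, (∀ x ∈ W, x ≠ b → p' x = s + p x) ∧
      (p' b = s + p b ∨ p' b = s + q b) ∧ (q' b = s + p b ∨ q' b = s + q b) := by
  by_cases hx₀ : ∃ x₀ ∈ W, x₀ ≠ b
  · obtain ⟨x₀, hx₀, hx₀b⟩ := hx₀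
    have hx₀add := hadd x₀ hx₀ hx₀b
    refine ⟨p' x₀ - p x₀, fun x hx hxb => ?_, by grind⟩
    have hxadd := hadd x hx hxb
    rw [two_smul, two_smul] at hpq
    grind
  · push Not at hx₀
    obtain ⟨s, hs⟩ := hp.exists_shift_of_singleton hp' hpin
      (hW.trans fun x hx => Finset.mem_singleton.2 (hx₀ x hx)) hI
    exact ⟨s, fun x hx hxb => absurd (hx₀ x hx) hxb, hs⟩

theorem IsSplitPotential.mem_of_not_mulBalanced (hp : P.IsSplitPotential p q b I)
    (hpin : ¬ P.Pinned I) (hW : P.freeVerts I ⊆ W) (hI : ¬ P.MulBalanced 1 I) : b ∈ W := by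
  by_contra hbW
  refine hI (IsPotential.mulBalanced (r := p) (fun e he => hp.gain_eq he ?_ ?_) 1)
  · rintro rfl
    exact hbW ((freeVerts_subset_iff.1 hW e he).1 (src_free hpin he))
  · rintro rfl
    exact hbW ((freeVerts_subset_iff.1 hW e he).2 (tgt_free hpin he))

theorem IsSplitPotential.shift_eq_of_ne (hp : P.IsSplitPotential p q b I)
    (hp' : P.IsSplitPotential p' q' b' I) (hbb : b ≠ b') {e : U} (he : e ∈ I)
    (h : (P.src e ≠ b ∧ P.src e ≠ b' ∧ p' (P.src e) - p (P.src e) = p' b - q b) ∨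
      (P.tgt e ≠ b ∧ P.tgt e ≠ b' ∧ p' (P.tgt e) - p (P.tgt e) = p' b - q b) ∨
      P.gain e ≠ p (P.tgt e) - p (P.src e)) :
    P.gain e = q (P.tgt e) - q (P.src e) ∧
      (P.src e ≠ b → P.src e ≠ b' → p' (P.src e) - p (P.src e) = p' b - q b) ∧
      (P.tgt e ≠ b → P.tgt e ≠ b' → p' (P.tgt e) - p (P.tgt e) = p' b - q b) := by
  obtain ⟨x, y, hx, hy, hxy⟩ := hp.2 e he
  obtain ⟨x', y', hx', hy', hxy'⟩ := hp'.2 e he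
  have hpq_src := hp.1 (P.src e)
  have hpq_tgt := hp.1 (P.tgt e)
  have hpq_src' := hp'.1 (P.src e)
  have hpq_tgt' := hp'.1 (P.tgt e)
  by_cases hsrc : P.src e = b <;> by_cases htgt : P.tgt e = b <;> by_cases hsrc' : P.src e = b' <;>
    by_cases htgt' : P.tgt e = b' <;> grind

theorem Indep.card_add_two_le_of_ne (hI : P.Indep j I) (hpin : ¬ P.Pinned I)
    (hW : P.freeVerts I ⊆ W) (hp : P.IsSplitPotential p q b I)
    (hp' : P.IsSplitPotential p' q' b' I) (hbW : b ∈ W) (hbW' : b' ∈ W) (hbb : b ≠ b') :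
    I.card + 2 ≤ 2 * W.card := by
  classical
  set A := W.filter fun x => x ≠ b ∧ x ≠ b' ∧ p' x - p x = p' b - q b with hA
  have hbA : b ∉ A := by simp [hA]
  have hbA' : b' ∉ A := by simp [hA]
  have hinsert : (insert b (insert b' A)).card = A.card + 2 := by
    rw [Finset.card_insert_of_notMem (by simp [hbb, hbA]), Finset.card_insert_of_notMem hbA']
  have hcompl : (W \ A).card + A.card = W.card :=
    Finset.card_sdiff_add_card_eq_card (Finset.filter_subset _ W)
  have htwo : 1 < (W \ A).card :=
    Finset.one_lt_card.2 ⟨b, by simp [hbW, hbA], b', by simp [hbW', hbA'], hbb⟩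
  -- The first part is balanced by `q`, the second one by `p`.
  have hcard := hI.card_add_le_of_filter (A := insert b (insert b' A)) (B := W \ A) (d := 3)
    (d' := 3) (p := fun e => (P.src e ∈ A ∨ P.tgt e ∈ A) ∨ P.gain e ≠ p (P.tgt e) - p (P.src e))
    ?_ ?_ (fun _ => (defect_eq_three (fun hF => hpin (hF.mono (Finset.filter_subset _ _)))
      (IsPotential.mulBalanced (r := q) (fun e he => ?_) 1)).ge)
    (fun _ => (defect_eq_three (fun hF => hpin (hF.mono (Finset.filter_subset _ _)))
      (IsPotential.mulBalanced (r := p) (fun e he => ?_) 1)).ge) (by omega) (by omega)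
  · omega
  · refine freeVerts_subset_iff.2 fun e he => ?_
    obtain ⟨he, hmem⟩ := Finset.mem_filter.1 he
    have hends := freeVerts_subset_iff.1 hW e he
    simp only [hA, Finset.mem_insert, Finset.mem_filter] at hmem ⊢
    have hshift := hp.shift_eq_of_ne hp' hbb he (by tauto)
    exact ⟨fun hfree => by tauto, fun hfree => by tauto⟩
  · exact (freeVerts_mono (Finset.monotone_filter_right I fun e _ he hA => he (.inl hA))).trans
      (freeVerts_filter_not_subset (A := A) hW)
  · obtain ⟨he, hmem⟩ := Finset.mem_filter.1 he
    simp only [hA, Finset.mem_filter] at hmem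
    exact (hp.shift_eq_of_ne hp' hbb he (by tauto)).1
  · exact not_not.1 fun hgain => (Finset.mem_filter.1 he).2 (.inr hgain)

variable [DecidableEq V]

theorem IsSplitPotential.add_eq_of_not_mulBalanced [DecidableEq Γ]
    (hp : P.IsSplitPotential p q b I) (hp' : P.IsSplitPotential p' q' b I) (hpq : p b ≠ q b)
    (h : ¬ P.MulBalanced 1 (I.filter fun e =>
      P.src e ∈ shiftClass p p' b s W ∨ P.tgt e ∈ shiftClass p p' b s W)) :
    s + p b = p' b ∧ s + q b = q' b ∨ s + p b = q' b ∧ s + q b = p' b := by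
  have hex : ∀ r : V → Γ, ∃ e ∈ I, (P.src e ∈ shiftClass p p' b s W ∨
      P.tgt e ∈ shiftClass p p' b s W) ∧ P.gain e ≠ r (P.tgt e) - r (P.src e) := by
    intro r
    by_contra! hno
    refine h (IsPotential.mulBalanced (r := r) (fun e he => ?_) 1)
    exact hno e (Finset.mem_filter.1 he).1 (Finset.mem_filter.1 he).2
  obtain ⟨e, he, hmem, hgain⟩ := hex p
  obtain ⟨f, hf, hmem', hgain'⟩ := hex q
  simp only [mem_shiftClass] at hmem hmem'
  have hq := hp.add_eq_of_gain_ne hp' he (by tauto) hgain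
  have hp_ := hp.swap.add_eq_of_gain_ne (s := s) hp' hf (by
    refine hmem'.imp (fun hm => ⟨hm.2.1, ?_⟩) (fun hm => ⟨hm.2.1, ?_⟩) <;>
      rw [← hp.1 _ hm.2.1, hm.2.2]) hgain'
  grind

theorem Indep.card_add_two_le_of_mulBalanced_shiftClass [DecidableEq Γ] (hI : P.Indep j I)
    (hpin : ¬ P.Pinned I) (hW : P.freeVerts I ⊆ W) (hbW : b ∈ W)
    (hp : P.IsSplitPotential p q b I) (hp' : P.IsSplitPotential p' q' b I)
    (hne : (shiftClass p p' b s W).Nonempty)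
    (h : P.MulBalanced 1 (I.filter fun e =>
      P.src e ∈ shiftClass p p' b s W ∨ P.tgt e ∈ shiftClass p p' b s W)) :
    I.card + 2 ≤ 2 * W.card := by
  have hpos := hne.card_pos
  have hone : 0 < (W \ shiftClass p p' b s W).card :=
    Finset.card_pos.2 ⟨b, Finset.mem_sdiff.2 ⟨hbW, notMem_shiftClass⟩⟩
  have hcard := hI.card_add_le_of_shiftClass (d := 3) hpin hW hp hp'
    (defect_eq_three (fun hF => hpin (hF.mono (Finset.filter_subset _ _))) h).ge
    (one_le_defect_of_splitBalanced hpin ⟨p, q, b, hp⟩) (by omega) (by omega)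
  omega

variable [DecidableEq U] {X Y : Finset U}

theorem splitBalanced_union_or_of_mulBalanced (hX : ¬ P.Pinned X) (hY : ¬ P.Pinned Y)
    (hXbal : P.MulBalanced 1 X) (hYbal : P.MulBalanced 1 Y) (hI : P.Indep j (X ∩ Y))
    (hne : (X ∩ Y).Nonempty)
    (h : ¬ P.Connects (X ∩ Y) (P.freeVerts X ∩ P.freeVerts Y)) :
    P.SplitBalanced (X ∪ Y) ∨
      (X ∩ Y).card + 6 ≤ 2 * (P.freeVerts X ∩ P.freeVerts Y).card := by
  have hfree : ∀ x ∈ P.freeVerts X ∩ P.freeVerts Y, x ∉ P.fixed :=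
    fun x hx => notMem_fixed_of_mem_freeVerts (Finset.mem_inter.1 hx).1
  have hdefect : P.defect j (X ∩ Y) = 3 := defect_eq_three
    (fun h => hX (h.mono Finset.inter_subset_left)) (hXbal.mono Finset.inter_subset_left)
  simp only [Connects, not_forall, not_not] at h
  obtain ⟨A, hA⟩ := h
  rcases hA.exists_subset_erase_or_card_add_le hI freeVerts_inter_subset hfree with
    ⟨w, hw, hsub⟩ | hcard
  swap
  · exact .inr (by omega)
  by_cases hconn : P.Connects (X ∩ Y) ((P.freeVerts X ∩ P.freeVerts Y).erase w)
  · left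
    obtain ⟨p, hp⟩ := hXbal.exists_isPotential hX
    obtain ⟨r, hr⟩ := hYbal.exists_isPotential hY
    obtain ⟨s, hs⟩ := hconn.exists_shift (p := p) (p' := r) hsub fun e he _ _ => by
      rw [← hp e (Finset.mem_inter.1 he).1, ← hr e (Finset.mem_inter.1 he).2]
    have hsplit : P.IsSplitPotential p (Function.update p w (r w - s)) w X :=
      ⟨fun x hx => by simp [hx], fun e he => ⟨_, _, .inl rfl, .inl rfl, hp e he⟩⟩
    exact ⟨_, _, w, hsplit.union hX hY (hr.isSplitPotential w) s
      (fun x hx hxw => hs x (Finset.mem_erase.2 ⟨hxw, hx⟩)) (fun _ => by simp)⟩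
  · simp only [Connects, not_forall, not_not] at hconn
    obtain ⟨B, hB⟩ := hconn
    have hcard := hB.card_add_le hI hne hsub fun x hx => hfree x (Finset.mem_of_mem_erase hx)
    have herase := Finset.card_erase_add_one hw
    exact .inr (by omega)

theorem splitBalanced_union_or_of_splitBalanced_of_mulBalanced (hX : ¬ P.Pinned X)
    (hY : ¬ P.Pinned Y) (hXsplit : P.SplitBalanced X) (hYbal : P.MulBalanced 1 Y)
    (hI : P.Indep j (X ∩ Y)) (h : P.Connects (X ∩ Y) (P.freeVerts X ∩ P.freeVerts Y)) :
    P.SplitBalanced (X ∪ Y) ∨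
      (X ∩ Y).card + 4 ≤ 2 * (P.freeVerts X ∩ P.freeVerts Y).card := by
  obtain ⟨p, q, b, hp⟩ := hXsplit
  obtain ⟨r, hr⟩ := hYbal.exists_isPotential hY
  have hpin : ¬ P.Pinned (X ∩ Y) := fun h => hX (h.mono Finset.inter_subset_left)
  have hpI := hp.mono (Finset.inter_subset_left (s₂ := Y))
  have hrI := hr.mono (Finset.inter_subset_right (s₁ := X))
  by_cases hshift : ∀ x₀ ∈ P.freeVerts X ∩ P.freeVerts Y, ∀ x₁ ∈ P.freeVerts X ∩ P.freeVerts Y,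
      x₀ ≠ b → x₁ ≠ b → r x₀ - p x₀ = r x₁ - p x₁
  · obtain ⟨s, hs, hsb⟩ := hpI.exists_shift hrI h freeVerts_inter_subset hshift
    exact .inl ⟨_, _, b, hp.union hX hY (hr.isSplitPotential b) s hs
      fun hb => ⟨hsb hb, hsb hb⟩⟩
  push Not at hshift
  obtain ⟨x₀, hx₀, x₁, hx₁, hx₀b, hx₁b, hne⟩ := hshift
  by_cases hbW : b ∈ P.freeVerts X ∩ P.freeVerts Y
  · exact .inr (hI.card_add_four_le_of_shift_ne hpin freeVerts_inter_subset hbW hpI hrI hx₀ hx₁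
      hx₀b hx₁b hne)
  · obtain ⟨s, hs⟩ := h.exists_shift (p := p) (p' := r) freeVerts_inter_subset
      fun e he hsrc htgt => by
        rw [← hrI e he, ← hpI.gain_eq he]
        · rintro rfl
          exact hbW (freeVerts_inter_subset (src_mem_freeVerts he hsrc))
        · rintro rfl
          exact hbW (freeVerts_inter_subset (tgt_mem_freeVerts he htgt))
    exact absurd (by rw [hs x₀ hx₀, hs x₁ hx₁, add_sub_cancel_right, add_sub_cancel_right]) hne

theorem splitBalanced_union_or_of_splitBalanced (hX : ¬ P.Pinned X) (hY : ¬ P.Pinned Y)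
    (hp : P.IsSplitPotential p q b X) (hpq : (2 : ℤ) • p b ≠ (2 : ℤ) • q b)
    (hYsplit : P.SplitBalanced Y) (hI : P.Indep j (X ∩ Y)) (hIbal : ¬ P.MulBalanced 1 (X ∩ Y)) :
    P.SplitBalanced (X ∪ Y) ∨
      (X ∩ Y).card + 2 ≤ 2 * (P.freeVerts X ∩ P.freeVerts Y).card := by
  classical
  obtain ⟨p', q', b', hp'⟩ := hYsplit
  have hpin : ¬ P.Pinned (X ∩ Y) := fun h => hX (h.mono Finset.inter_subset_left)
  have hpI := hp.mono (Finset.inter_subset_left (s₂ := Y))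
  have hpI' := hp'.mono (Finset.inter_subset_right (s₁ := X))
  have hbW := hpI.mem_of_not_mulBalanced hpin freeVerts_inter_subset hIbal
  have hbW' := hpI'.mem_of_not_mulBalanced hpin freeVerts_inter_subset hIbal
  by_cases hbb : b = b'
  swap
  · exact .inr (hI.card_add_two_le_of_ne hpin freeVerts_inter_subset hpI hpI' hbW hbW' hbb)
  subst hbb
  by_cases hadd : ∀ x ∈ P.freeVerts X ∩ P.freeVerts Y, x ≠ b →
      p' x - p x + p b = p' b ∧ p' x - p x + q b = q' b ∨
      p' x - p x + p b = q' b ∧ p' x - p x + q b = p' b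
  · obtain ⟨s, hs, hsb⟩ := hpI.exists_shift_of_forall_add_eq hpI' hpin freeVerts_inter_subset
      hIbal hpq hadd
    exact .inl ⟨_, _, b, hp.union hX hY hp' s hs fun _ => hsb⟩
  · push Not at hadd
    obtain ⟨x, hx, hxb, hno⟩ := hadd
    refine .inr (hI.card_add_two_le_of_mulBalanced_shiftClass hpin freeVerts_inter_subset hbW hpI
      hpI' ⟨x, mem_shiftClass.2 ⟨hx, hxb, rfl⟩⟩ ?_)
    by_contra hbal
    have := hpI.add_eq_of_not_mulBalanced hpI' (fun h => hpq (by rw [h])) hbal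
    tauto

end SplitBalancedUnion

section Submodular

variable {V U Γ : Type*} [AddCommGroup Γ] {P : PreGainGraph V U Γ} {j m : ℤ} {F X Y : Finset U}
  {p q : V → Γ} {b : V}

theorem IsSplitPotential.mulBalanced_of_smul_eq (hp : P.IsSplitPotential p q b F)
    (h : m • p b = m • q b) : P.MulBalanced m F := by
  have hpq : ∀ x, m • q x = m • p x := fun x => by
    by_cases hx : x = b
    · rw [hx, h]
    · rw [hp.1 x hx]
  refine ⟨fun x => m • p x, fun e he _ _ => ?_⟩
  obtain ⟨x, y, hx | hx, hy | hy, hgain⟩ := hp.2 e he <;> simp [hgain, hx, hy, smul_sub, hpq]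

theorem IsSplitPotential.smul_eq_of_mulBalanced (hp : P.IsSplitPotential p q b F)
    (hpin : ¬ P.Pinned F) (hm : P.MulBalanced m F) (hone : ¬ P.MulBalanced 1 F) :
    m • p b = m • q b := by
  classical
  by_contra hne
  obtain ⟨r, hr⟩ := hm
  obtain ⟨f, hf⟩ : ∃ f : Γ → Γ, ∀ x, m • x = f x := ⟨_, fun _ => rfl⟩
  simp only [hf] at hne
  -- If `m • p b ≠ m • q b`, then `r` tells apart the two copies of `b`: comparing `r` with `m • p`
  -- shows which part of `F` hangs at the second copy, and shifting `p` on that part undoes the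
  -- splitting.
  refine hone (IsPotential.mulBalanced (r := fun x =>
    if x = b ∨ r x - f (p x) = r b - f (p b) then p x else p x + p b - q b) (fun e he => ?_) 1)
  have hgain_smul := hr e he (src_free hpin he) (tgt_free hpin he)
  obtain ⟨x, y, hx, hy, hgain⟩ := hp.2 e he
  rw [hgain, smul_sub, hf, hf] at hgain_smul
  have hpq_src := hp.1 (P.src e)
  have hpq_tgt := hp.1 (P.tgt e)
  clear hr hone hp hpin
  by_cases hsrc : P.src e = b <;> by_cases htgt : P.tgt e = b <;> grind

theorem IsSplitPotential.two_smul_ne (hp : P.IsSplitPotential p q b F) (hpin : ¬ P.Pinned F)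
    (h : P.rigidTypes j F = ∅) : (2 : ℤ) • p b ≠ (2 : ℤ) • q b := by
  intro htwo
  have hbal := hp.mulBalanced_of_smul_eq htwo
  -- One of `j` and `j - 1` is even.
  rcases Int.even_or_odd' j with ⟨c, hc | hc⟩
  · have hmem : (0 : ℤ) ∈ P.rigidTypes j F := mem_rigidTypes.2
      ⟨by decide, by rw [add_zero, hc, mul_comm]; exact hbal.mul_left c, .inl rfl⟩
    simp [h] at hmem
  · have hmem : (-1 : ℤ) ∈ P.rigidTypes j F := mem_rigidTypes.2
      ⟨by decide, by rw [hc, add_neg_cancel_right, mul_comm]; exact hbal.mul_left c, .inr hpin⟩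
    simp [h] at hmem

theorem defect_eq_card_or : P.defect j F = (P.rigidTypes j F).card ∨
    P.rigidTypes j F = ∅ ∧ P.defect j F = 1 ∧ ¬ P.Pinned F ∧ P.SplitBalanced F := by
  by_cases h : ¬ P.Pinned F ∧ P.SplitBalanced F
  · rw [defect, if_pos h]
    rcases (P.rigidTypes j F).eq_empty_or_nonempty with hnil | hne
    · exact .inr ⟨hnil, by simp [hnil], h⟩
    · exact .inl (max_eq_left hne.card_pos)
  · exact .inl (defect_of_not_splitBalanced h)

variable [DecidableEq U]

theorem one_le_defect_union (hX : ¬ P.Pinned X) (hY : ¬ P.Pinned Y)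
    (h : P.SplitBalanced (X ∪ Y)) : 1 ≤ P.defect j (X ∪ Y) :=
  one_le_defect_of_splitBalanced (by simp [pinned_union, hX, hY]) h

theorem IsSplitPotential.rigidTypes_eq_empty (hp : P.IsSplitPotential p q b X)
    (hX : ¬ P.Pinned X) (h : P.rigidTypes j X = ∅) (hbal : ¬ P.MulBalanced 1 (X ∩ Y)) :
    P.rigidTypes j Y = ∅ := by
  refine Finset.eq_empty_iff_forall_notMem.2 fun i hi => ?_
  obtain ⟨hmem, hbalY, -⟩ := mem_rigidTypes.1 hi
  have hsmul := (hp.mono (Finset.inter_subset_left (s₂ := Y))).smul_eq_of_mulBalanced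
    (fun hpin => hX (hpin.mono Finset.inter_subset_left)) (hbalY.mono Finset.inter_subset_right)
    hbal
  exact Finset.notMem_empty i
    (h ▸ mem_rigidTypes.2 ⟨hmem, hp.mulBalanced_of_smul_eq hsmul, .inr hX⟩)

variable [DecidableEq V]

theorem Indep.card_inter_add_defect_inter_le (hI : P.Indep j (X ∩ Y)) (hne : (X ∩ Y).Nonempty) :
    (X ∩ Y).card + P.defect j (X ∩ Y) ≤ 2 * (P.freeVerts X ∩ P.freeVerts Y).card :=
  hI.card_add_le subset_rfl freeVerts_inter_subset (fun _ => le_rfl) <|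
    (Nat.le_add_left _ _).trans <| (hI _ subset_rfl hne).trans <|
      Nat.mul_le_mul_left 2 (Finset.card_le_card freeVerts_inter_subset)

theorem Indep.card_inter_add_le_of_rigidTypes_eq_empty (hI : P.Indep j (X ∩ Y))
    (hne : (X ∩ Y).Nonempty) (h : P.Connects (X ∩ Y) (P.freeVerts X ∩ P.freeVerts Y))
    (hnil : P.rigidTypes j X = ∅) (hone : P.defect j X = 1) (hX : ¬ P.Pinned X)
    (hsplit : P.SplitBalanced X) :
    (X ∩ Y).card + P.defect j X + P.defect j Y ≤
      2 * (P.freeVerts X ∩ P.freeVerts Y).card + P.defect j (X ∪ Y) := by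
  have hbase := hI.card_inter_add_defect_inter_le hne
  have hdX := defect_anti (P := P) (j := j) (Finset.inter_subset_left (s₁ := X) (s₂ := Y))
  have hdY := defect_anti (P := P) (j := j) (Finset.inter_subset_right (s₁ := X) (s₂ := Y))
  have hY_le := defect_le_three (P := P) (j := j) (F := Y)
  by_cases hbal : P.MulBalanced 1 (X ∩ Y)
  · have hI_three : P.defect j (X ∩ Y) = 3 :=
      defect_eq_three (fun hpin => hX (hpin.mono Finset.inter_subset_left)) hbal
    by_cases hY_three : P.defect j Y = 3
    · obtain ⟨hY, hYbal⟩ := defect_eq_three_iff.1 hY_three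
      rcases splitBalanced_union_or_of_splitBalanced_of_mulBalanced hX hY hsplit hYbal hI h
        with hunion | hcard
      · have := one_le_defect_union (j := j) hX hY hunion
        omega
      · omega
    · omega
  · obtain ⟨p, q, b, hp⟩ := id hsplit
    have hnilY := hp.rigidTypes_eq_empty hX hnil hbal
    rcases defect_eq_card_or (P := P) (j := j) (F := Y) with hY_card | ⟨-, hY_one, hY, hYsplit⟩
    · rw [hnilY, Finset.card_empty] at hY_card
      omega
    · rcases splitBalanced_union_or_of_splitBalanced hX hY hp (hp.two_smul_ne hX hnil) hYsplit hI
        hbal with hunion | hcard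
      · have := one_le_defect_union (j := j) hX hY hunion
        omega
      · omega

theorem Indep.card_inter_add_le_of_not_connects (hI : P.Indep j (X ∩ Y)) (hne : (X ∩ Y).Nonempty)
    (h : ¬ P.Connects (X ∩ Y) (P.freeVerts X ∩ P.freeVerts Y)) :
    (X ∩ Y).card + P.defect j X + P.defect j Y ≤
      2 * (P.freeVerts X ∩ P.freeVerts Y).card + P.defect j (X ∪ Y) := by
  have hdX := defect_anti (P := P) (j := j) (Finset.inter_subset_left (s₁ := X) (s₂ := Y))
  have hdY := defect_anti (P := P) (j := j) (Finset.inter_subset_right (s₁ := X) (s₂ := Y))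
  have hX_le := defect_le_three (P := P) (j := j) (F := X)
  have hY_le := defect_le_three (P := P) (j := j) (F := Y)
  obtain ⟨A, hA⟩ := not_forall_not.1 h
  have hcount := hA.card_add_le hI hne freeVerts_inter_subset
    (fun x hx => notMem_fixed_of_mem_freeVerts (Finset.mem_inter.1 hx).1)
  by_cases hthree : P.defect j X = 3 ∧ P.defect j Y = 3
  · obtain ⟨hX, hXbal⟩ := defect_eq_three_iff.1 hthree.1
    obtain ⟨hY, hYbal⟩ := defect_eq_three_iff.1 hthree.2
    rcases splitBalanced_union_or_of_mulBalanced hX hY hXbal hYbal hI hne h with hunion | hcard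
    · have := one_le_defect_union (j := j) hX hY hunion
      omega
    · omega
  · omega

/-- Submodularity of `2 |V(F)| - defect F`, with the value at `X ∩ Y` weakened to its lower bound
`|X ∩ Y|`. -/
theorem Indep.card_inter_add_defect_le (hI : P.Indep j (X ∩ Y)) (hne : (X ∩ Y).Nonempty) :
    (X ∩ Y).card + P.defect j X + P.defect j Y ≤
      2 * (P.freeVerts X ∩ P.freeVerts Y).card + P.defect j (X ∪ Y) := by
  by_cases h : P.Connects (X ∩ Y) (P.freeVerts X ∩ P.freeVerts Y)
  swap
  · exact hI.card_inter_add_le_of_not_connects hne h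
  rcases defect_eq_card_or (P := P) (j := j) (F := X) with hX | ⟨hnil, hone, hX, hsplit⟩
  swap
  · exact hI.card_inter_add_le_of_rigidTypes_eq_empty hne h hnil hone hX hsplit
  rcases defect_eq_card_or (P := P) (j := j) (F := Y) with hY | ⟨hnil, hone, hY, hsplit⟩
  · have := card_rigidTypes_supermodular (j := j) h
    have := card_rigidTypes_le_defect (P := P) (j := j) (F := X ∩ Y)
    have := card_rigidTypes_le_defect (P := P) (j := j) (F := X ∪ Y)
    have := hI.card_inter_add_defect_inter_le hne
    omega
  · rw [Finset.inter_comm X Y] at hI hne h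
    rw [Finset.inter_comm (P.freeVerts X)] at h
    have := hI.card_inter_add_le_of_rigidTypes_eq_empty hne h hnil hone hY hsplit
    rw [Finset.inter_comm X Y, Finset.inter_comm (P.freeVerts X), Finset.union_comm X Y]
    omega

end Submodular

end PreGainGraph

section CircuitElimination

variable {α : Type*} [DecidableEq α] {Ind : Finset α → Prop} {C C' I J K : Finset α} {e : α}

theorem eq_of_minimal_of_subset_insert
    (helim : ∀ ⦃C C'⦄, Minimal (¬ Ind ·) C → Minimal (¬ Ind ·) C' → C ≠ C' →
      ∀ e ∈ C ∩ C', ¬ Ind ((C ∪ C').erase e))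
    (hmono : ∀ ⦃I J⦄, Ind J → I ⊆ J → Ind I) (hK : Ind K)
    (hC : Minimal (¬ Ind ·) C) (hC' : Minimal (¬ Ind ·) C') (hsub : C ⊆ insert e K)
    (hsub' : C' ⊆ insert e K) : C = C' := by
  have hmem : ∀ D ⊆ insert e K, ¬ Ind D → e ∈ D := fun D hD hdep => by
    by_contra he
    exact hdep (hmono hK ((Finset.subset_insert_iff_of_notMem he).1 hD))
  by_contra hne
  exact helim hC hC' hne e (Finset.mem_inter.2 ⟨hmem C hsub hC.1, hmem C' hsub' hC'.1⟩)
    (hmono hK (Finset.subset_insert_iff.1 (Finset.union_subset hsub hsub')))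

theorem exists_mem_notMem_of_forall_exchange
    (helim : ∀ ⦃C C'⦄, Minimal (¬ Ind ·) C → Minimal (¬ Ind ·) C' → C ≠ C' →
      ∀ e ∈ C ∩ C', ¬ Ind ((C ∪ C').erase e))
    (hmono : ∀ ⦃I J⦄, Ind J → I ⊆ J → Ind I) (hI : Ind I) (hK : Ind K) (hKI : ¬ K ⊆ I)
    (heI : e ∈ I) : ∃ f ∈ K, f ∉ I ∧ Ind ((insert e K).erase f) := by
  by_contra! hdep
  have hcircuit : ∀ f ∈ K, f ∉ I → ∃ C ⊆ (insert e K).erase f, Minimal (¬ Ind ·) C :=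
    fun f hfK hfI => exists_minimal_le_of_wellFoundedLT (¬ Ind ·) _ (hdep f hfK hfI)
  obtain ⟨f, hfK, hfI⟩ := Finset.not_subset.1 hKI
  obtain ⟨C, hCsub, hC⟩ := hcircuit f hfK hfI
  obtain ⟨g, hgC, hgI⟩ := Finset.not_subset.1 fun hCI => hC.1 (hmono hI hCI)
  have hgK : g ∈ K := (Finset.mem_insert.1 (Finset.mem_of_mem_erase (hCsub hgC))).resolve_left
    fun hge => hgI (hge ▸ heI)
  obtain ⟨C', hCsub', hC'⟩ := hcircuit g hgK hgI
  obtain rfl := eq_of_minimal_of_subset_insert helim hmono hK hC hC'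
    (hCsub.trans (Finset.erase_subset _ _)) (hCsub'.trans (Finset.erase_subset _ _))
  exact Finset.notMem_erase g _ (hCsub' hgC)

theorem exists_insert_of_circuit_elimination
    (helim : ∀ ⦃C C'⦄, Minimal (¬ Ind ·) C → Minimal (¬ Ind ·) C' → C ≠ C' →
      ∀ e ∈ C ∩ C', ¬ Ind ((C ∪ C').erase e))
    (hmono : ∀ ⦃I J⦄, Ind J → I ⊆ J → Ind I) (hI : Ind I) (hJ : Ind J)
    (hlt : I.card < J.card) : ∃ e ∈ J, e ∉ I ∧ Ind (insert e I) := by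
  classical
  -- Among the independent sets in `I ∪ J` larger than `I`, one that misses the fewest elements
  -- of `I` misses none.
  obtain ⟨K, hK, hmin⟩ := Finset.exists_min_image
    ((I ∪ J).powerset.filter fun K => Ind K ∧ I.card < K.card) (fun K => (I \ K).card)
    ⟨J, Finset.mem_filter.2 ⟨Finset.mem_powerset.2 Finset.subset_union_right, hJ, hlt⟩⟩
  simp only [Finset.mem_filter, Finset.mem_powerset] at hK hmin
  obtain ⟨hKsub, hKind, hKcard⟩ := hK
  have hKI : ¬ K ⊆ I := fun hKI => hKcard.not_ge (Finset.card_le_card hKI)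
  have hIK : I ⊆ K := by
    intro e heI
    by_contra heK
    obtain ⟨f, hfK, hfI, hind⟩ := exists_mem_notMem_of_forall_exchange helim hmono hI hKind hKI heI
    have hef : e ≠ f := fun hef => hfI (hef ▸ heI)
    have hcard : ((insert e K).erase f).card = K.card := by
      rw [Finset.card_erase_of_mem (Finset.mem_insert_of_mem hfK),
        Finset.card_insert_of_notMem heK, Nat.add_sub_cancel]
    refine (hmin ((insert e K).erase f) ⟨(Finset.erase_subset _ _).trans
      (Finset.insert_subset (Finset.mem_union_left _ heI) hKsub), hind, by omega⟩).not_gt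
      (Finset.card_lt_card ((Finset.ssubset_iff_of_subset ?_).2 ⟨e, by simp [heI, heK], by
        simp [hef]⟩))
    intro x hx
    grind
  obtain ⟨g, hgK, hgI⟩ := Finset.not_subset.1 hKI
  exact ⟨g, (Finset.mem_union.1 (hKsub hgK)).resolve_left hgI, hgI,
    hmono hKind (Finset.insert_subset hgK hIK)⟩

end CircuitElimination

theorem indep_union_of_subset_closure {α : Type*} {M : Matroid α} {E J S : Set α}
    (hES : M.Indep (E ∪ S)) (hdisj : Disjoint E S) (hJ : M.Indep J) (hJE : J ⊆ M.closure E) :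
    M.Indep (J ∪ S) := by
  refine (hJ.union_indep_iff_forall_notMem_closure_right
    (hES.subset Set.subset_union_right)).2 fun e he hecl => ?_
  have heE : e ∉ E := fun heE => hdisj.notMem_of_mem_left heE he.1
  refine hES.notMem_closure_sdiff_of_mem (Or.inr he.1) ?_
  rw [Set.union_sdiff_distrib, Set.sdiff_singleton_eq_self heE]
  exact M.closure_subset_closure_of_subset_closure (Set.union_subset
    (hJE.trans (M.closure_subset_closure Set.subset_union_left))
    (M.subset_closure_of_subset' Set.subset_union_right
      (Set.sdiff_subset.trans (Set.subset_union_right.trans hES.subset_ground)))) hecl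

namespace PreGainGraph

section Matroid

variable {V U Γ : Type*} [AddCommGroup Γ] {P : PreGainGraph V U Γ} {j : ℤ} {C C' E J S : Finset U}

theorem card_lt_of_minimal_not_indep (h : Minimal (¬ P.Indep j ·) C) :
    2 * (P.freeVerts C).card < C.card + P.defect j C := by
  have hdep : ∃ F ⊆ C, F.Nonempty ∧ 2 * (P.freeVerts F).card < F.card + P.defect j F := by
    simpa [Indep] using h.1
  obtain ⟨F, hF, hne, hlt⟩ := hdep
  rcases hF.eq_or_ssubset with rfl | hss
  · exact hlt
  · exact absurd (not_not.1 (h.not_prop_of_lt hss) F subset_rfl hne) hlt.not_ge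

theorem indep_empty : P.Indep j ∅ :=
  fun _ hF hne => absurd (Finset.subset_empty.1 hF) hne.ne_empty

variable [DecidableEq U]

theorem not_indep_erase_of_minimal (hC : Minimal (¬ P.Indep j ·) C)
    (hC' : Minimal (¬ P.Indep j ·) C') (hne : C ≠ C') {e : U} (he : e ∈ C ∩ C') :
    ¬ P.Indep j ((C ∪ C').erase e) := by
  classical
  intro hI
  have heC := Finset.mem_of_mem_inter_left he
  have hss : C ∩ C' ⊂ C := Finset.inter_subset_left.ssubset_of_ne fun h =>
    hne (hC'.eq_of_le hC.1 (Finset.inter_eq_left.1 h))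
  have hinter := not_not.1 (hC.not_prop_of_lt hss)
  have hsubmod := hinter.card_inter_add_defect_le ⟨e, he⟩
  have hcard := card_lt_of_minimal_not_indep hC
  have hcard' := card_lt_of_minimal_not_indep hC'
  have hedges := Finset.card_union_add_card_inter C C'
  have hverts := Finset.card_union_add_card_inter (P.freeVerts C) (P.freeVerts C')
  have herase := Finset.card_erase_add_one (Finset.mem_union_left C' heC)
  rw [← freeVerts_union] at hverts
  have hroom : P.defect j (C ∪ C') ≤ 2 * (P.freeVerts (C ∪ C')).card :=
    (defect_anti (Finset.inter_subset_left.trans Finset.subset_union_left)).trans <|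
      (Nat.le_add_left _ _).trans <| (hinter _ subset_rfl ⟨e, he⟩).trans <|
        Nat.mul_le_mul_left 2 (Finset.card_le_card (freeVerts_mono
          (Finset.inter_subset_left.trans Finset.subset_union_left)))
  have hcount := hI.card_add_le subset_rfl (freeVerts_mono (Finset.erase_subset e _))
    (fun _ => defect_anti (Finset.erase_subset e _)) hroom
  omega

theorem Indep.augment (hI : P.Indep j S) (hJ : P.Indep j J) (hlt : S.card < J.card) :
    ∃ e ∈ J, e ∉ S ∧ P.Indep j (insert e S) :=
  exists_insert_of_circuit_elimination
    (fun _ _ hC hC' hne _ => not_indep_erase_of_minimal hC hC' hne) (fun _ _ => Indep.subset)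
    hI hJ hlt

variable (P j) in
/-- The matroid on the edge set whose independent sets are the sparse edge sets. -/
noncomputable def matroid : Matroid U :=
  (IndepMatroid.ofFinset Set.univ (P.Indep j)
    indep_empty (fun _ _ => Indep.subset)
    (fun _ _ => Indep.augment) fun _ _ => Set.subset_univ _).matroid

theorem matroid_indep : (P.matroid j).Indep (J : Set U) ↔ P.Indep j J := by
  rw [matroid, IndepMatroid.matroid_Indep, IndepMatroid.ofFinset_indep]

theorem mem_closure_matroid (hE : P.Indep j E) {e : U} (he : ¬ P.Indep j (insert e E)) :
    e ∈ (P.matroid j).closure E := by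
  by_contra hecl
  refine he (matroid_indep.1 ?_)
  rw [Finset.coe_insert]
  exact ((matroid_indep.2 hE).insert_indep_iff.2 (.inl ⟨Set.mem_univ e, hecl⟩))

theorem Indep.union_of_spanned (hES : P.Indep j (E ∪ S)) (hdisj : Disjoint E S)
    (hJ : P.Indep j J) (hspan : ∀ e ∈ J, ¬ P.Indep j (insert e E)) : P.Indep j (J ∪ S) := by
  rw [← matroid_indep, Finset.coe_union] at hES ⊢
  exact indep_union_of_subset_closure hES (Finset.disjoint_coe.2 hdisj) (matroid_indep.2 hJ)
    fun e he => mem_closure_matroid (matroid_indep.1 (hES.subset Set.subset_union_left))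
      (hspan e he)

end Matroid

end PreGainGraph

namespace GainGraph

section Joined

variable {V E Γ : Type*} [Group Γ] {G : GainGraph V E Γ} {F : Finset E} {B : Set V}
  {u v w : V} {g h : Γ}

theorem isWalk_append {l l' : List (E × Bool)} :
    G.IsWalk u (l ++ l') w ↔ ∃ x, G.IsWalk u l x ∧ G.IsWalk x l' w := by
  induction l generalizing u with
  | nil => simp [IsWalk]
  | cons s l ih => simp [IsWalk, ih, and_assoc]

theorem walkGain_append {l l' : List (E × Bool)} :
    G.walkGain (l ++ l') = G.walkGain l * G.walkGain l' := by
  simp [walkGain]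

variable (G) in
/-- There is a walk in `F` of gain `g` from `u` to `w` that does not meet `B` after its start. -/
def Joined (F : Finset E) (B : Set V) (u : V) (g : Γ) (w : V) : Prop :=
  ∃ l, G.IsWalk u l w ∧ (∀ s ∈ l, s.1 ∈ F) ∧ (∀ s ∈ l, G.head s ∉ B) ∧ G.walkGain l = g

theorem Joined.refl : G.Joined F B u 1 u := ⟨[], rfl, by simp, by simp, by simp [walkGain]⟩

theorem Joined.trans (hg : G.Joined F B u g v) (hh : G.Joined F B v h w) :
    G.Joined F B u (g * h) w := by
  obtain ⟨l, hl, hlF, hlB, rfl⟩ := hg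
  obtain ⟨l', hl', hlF', hlB', rfl⟩ := hh
  exact ⟨l ++ l', isWalk_append.2 ⟨v, hl, hl'⟩, List.forall_mem_append.2 ⟨hlF, hlF'⟩,
    List.forall_mem_append.2 ⟨hlB, hlB'⟩, walkGain_append⟩

theorem joined_step {s : E × Bool} (hs : s.1 ∈ F) (hB : G.head s ∉ B) :
    G.Joined F B (G.tail s) (G.stepGain s) (G.head s) :=
  ⟨[s], ⟨rfl, rfl⟩, by simpa using hs, by simpa using hB, by simp [walkGain]⟩

@[elab_as_elim]
theorem Joined.induction {motive : Γ → V → Prop} (hj : G.Joined F B u g w) (refl : motive 1 u)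
    (step : ∀ g s, G.Joined F B u g (G.tail s) → motive g (G.tail s) → s.1 ∈ F → G.head s ∉ B →
      motive (g * G.stepGain s) (G.head s)) : motive g w := by
  obtain ⟨l, hl, hlF, hlB, rfl⟩ := hj
  induction l using List.reverseRecOn generalizing w with
  | nil => simpa [walkGain, ← show u = w from hl] using refl
  | append_singleton l s ih =>
    obtain ⟨x, hx, rfl, rfl⟩ := isWalk_append.1 hl
    rw [List.forall_mem_append, List.forall_mem_singleton] at hlF hlB
    simpa [walkGain] using step (G.walkGain l) s ⟨l, hx, hlF.1, hlB.1, rfl⟩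
      (ih hx hlF.1 hlB.1) hlF.2 hlB.2

/-- The step against the direction of `s`. -/
def revStep (s : E × Bool) : E × Bool := (s.1, !s.2)

theorem tail_revStep (s : E × Bool) : G.tail (revStep s) = G.head s := by
  obtain ⟨e, _ | _⟩ := s <;> rfl

theorem head_revStep (s : E × Bool) : G.head (revStep s) = G.tail s := by
  obtain ⟨e, _ | _⟩ := s <;> rfl

theorem stepGain_revStep (s : E × Bool) : G.stepGain (revStep s) = (G.stepGain s)⁻¹ := by
  obtain ⟨e, _ | _⟩ := s <;> simp [revStep, stepGain]

theorem Joined.notMem (hj : G.Joined F B u g w) (hu : u ∉ B) : w ∉ B :=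
  hj.induction hu fun _ _ _ _ _ => id

theorem Joined.symm (hj : G.Joined F B u g w) (hu : u ∉ B) : G.Joined F B w g⁻¹ u := by
  refine hj.induction (by simpa using Joined.refl) fun g s hj ih hs _ => ?_
  have hrev := joined_step (G := G) (B := B) (s := revStep s) hs
    (by rw [head_revStep]; exact hj.notMem hu)
  rw [tail_revStep, head_revStep, stepGain_revStep] at hrev
  simpa using hrev.trans ih

theorem reachable_iff : G.Reachable F u w ↔ ∃ g, G.Joined F ∅ u g w := by
  simp [Reachable, Joined]

theorem Reachable.refl : G.Reachable F u u := reachable_iff.2 ⟨1, .refl⟩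

theorem Reachable.trans (huv : G.Reachable F u v) (hvw : G.Reachable F v w) :
    G.Reachable F u w := by
  obtain ⟨g, hg⟩ := reachable_iff.1 huv
  obtain ⟨h, hh⟩ := reachable_iff.1 hvw
  exact reachable_iff.2 ⟨_, hg.trans hh⟩

theorem Reachable.symm (huv : G.Reachable F u v) : G.Reachable F v u := by
  obtain ⟨g, hg⟩ := reachable_iff.1 huv
  exact reachable_iff.2 ⟨_, hg.symm (Set.notMem_empty u)⟩

theorem reachable_step {s : E × Bool} (hs : s.1 ∈ F) : G.Reachable F (G.tail s) (G.head s) :=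
  reachable_iff.2 ⟨_, joined_step hs (Set.notMem_empty _)⟩

theorem reachable_edge {e : E} (he : e ∈ F) : G.Reachable F (G.src e) (G.tgt e) :=
  reachable_step (s := (e, true)) he

theorem gainGroup_eq_closure : G.gainGroup F =
    Subgroup.closure {g | ∃ u ∉ G.fixed, G.Joined F G.fixed u g u} := by
  unfold gainGroup Joined
  congr! 5 with g u
  constructor
  · rintro ⟨l, hl, hlF, hu, hlB, hg⟩
    exact ⟨hu, l, hl, hlF, hlB, hg⟩
  · rintro ⟨hu, l, hl, hlF, hlB, hg⟩
    exact ⟨l, hl, hlF, hu, hlB, hg⟩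

theorem Joined.mem_gainGroup (hj : G.Joined F G.fixed u g u) (hu : u ∉ G.fixed) :
    g ∈ G.gainGroup F :=
  gainGroup_eq_closure (G := G) ▸ Subgroup.subset_closure ⟨u, hu, hj⟩

theorem exists_mul_gain_mul_inv_mem_gainGroup (G : GainGraph V E Γ) (F : Finset E) :
    ∃ a : V → Γ, ∀ e ∈ F, G.src e ∉ G.fixed → G.tgt e ∉ G.fixed →
      a (G.src e) * G.gain e * (a (G.tgt e))⁻¹ ∈ G.gainGroup F := by
  classical
  let S : Setoid {x : V // x ∉ G.fixed} :=
    { r := fun x y => ∃ g, G.Joined F G.fixed x g y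
      iseqv := ⟨fun _ => ⟨1, .refl⟩, fun {x _} ⟨_, hg⟩ => ⟨_, hg.symm x.2⟩,
        fun ⟨_, hg⟩ ⟨_, hg'⟩ => ⟨_, hg.trans hg'⟩⟩ }
  -- `a x` is the gain of a walk to `x` from the representative of its class.
  have hroot (x : {x : V // x ∉ G.fixed}) :
      ∃ g, G.Joined F G.fixed (Quotient.mk S x).out g x := Quotient.mk_out (s := S) x
  choose a ha using hroot
  refine ⟨fun x => if hx : x ∉ G.fixed then a ⟨x, hx⟩ else 1, fun e he hsrc htgt => ?_⟩
  have hedge : G.Joined F G.fixed (G.src e) (G.gain e) (G.tgt e) :=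
    joined_step (s := (e, true)) he htgt
  have hclass : Quotient.mk S ⟨G.src e, hsrc⟩ = Quotient.mk S ⟨G.tgt e, htgt⟩ :=
    Quotient.sound ⟨_, hedge⟩
  have hfree := (Quotient.mk S ⟨G.src e, hsrc⟩).out.2
  have htgt_walk := ha ⟨G.tgt e, htgt⟩
  rw [← hclass] at htgt_walk
  simpa only [dif_pos hsrc, dif_pos htgt] using
    (((ha ⟨G.src e, hsrc⟩).trans hedge).trans (htgt_walk.symm hfree)).mem_gainGroup hfree

end Joined

section ToPreGainGraph

variable {V E Γ : Type*} [CommGroup Γ] (G : GainGraph V E Γ)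

/-- The labelled multigraph underlying a gain graph, with its gains in additive notation. -/
def toPreGainGraph : PreGainGraph V E (Additive Γ) where
  src := G.src
  tgt := G.tgt
  gain e := Additive.ofMul (G.gain e)
  fixed := G.fixed

variable {G} {F : Finset E} {m : ℤ} {u w : V} {g : Γ}

theorem Joined.smul_ofMul {B : Set V} {p : V → Additive Γ}
    (hp : ∀ e ∈ F, G.src e ∉ B → G.tgt e ∉ B →
      m • Additive.ofMul (G.gain e) = p (G.tgt e) - p (G.src e))
    (hj : G.Joined F B u g w) (hu : u ∉ B) : m • Additive.ofMul g = p w - p u := by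
  refine hj.induction (by simp) fun g s hj ih hs hhead => ?_
  have htail := hj.notMem hu
  rw [ofMul_mul, smul_add, ih]
  obtain ⟨e, _ | _⟩ := s
  · simp only [tail, head, stepGain, ofMul_inv, smul_neg] at *
    rw [hp e hs hhead htail]
    abel
  · simp only [tail, head, stepGain] at *
    rw [hp e hs htail hhead]
    abel

theorem mulBalanced_toPreGainGraph_iff :
    G.toPreGainGraph.MulBalanced m F ↔ ∀ g ∈ G.gainGroup F, g ^ m = 1 := by
  constructor
  · rintro ⟨p, hp⟩ g hg
    suffices h : G.gainGroup F ≤ (zpowGroupHom m).ker from h hg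
    rw [gainGroup_eq_closure, Subgroup.closure_le]
    rintro x ⟨u, hu, hj⟩
    have hsmul := hj.smul_ofMul hp hu
    rwa [sub_self, ← ofMul_zpow, ofMul_eq_zero] at hsmul
  · intro h
    obtain ⟨a, ha⟩ := exists_mul_gain_mul_inv_mem_gainGroup G F
    refine ⟨fun x => m • Additive.ofMul (a x), fun e he hsrc htgt => ?_⟩
    have hgain := congrArg Additive.ofMul (h _ (ha e he hsrc htgt))
    rw [ofMul_zpow, ofMul_mul, ofMul_mul, ofMul_inv, ofMul_one, smul_add, smul_add, smul_neg,
      ← sub_eq_add_neg, sub_eq_zero, add_comm] at hgain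
    exact eq_sub_of_add_eq hgain

end ToPreGainGraph

section Verts

variable {V E Γ : Type*} [CommGroup Γ] {G : GainGraph V E Γ} {F : Finset E}

theorem mem_verts {x : V} : x ∈ G.verts F ↔ ∃ e ∈ F, G.src e = x ∨ G.tgt e = x := by
  classical simp only [verts, Finset.mem_union, Finset.mem_image, and_or_left, exists_or]

theorem src_mem_verts {e : E} (he : e ∈ F) : G.src e ∈ G.verts F := mem_verts.2 ⟨e, he, .inl rfl⟩

theorem tgt_mem_verts {e : E} (he : e ∈ F) : G.tgt e ∈ G.verts F := mem_verts.2 ⟨e, he, .inr rfl⟩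

theorem mem_fixedVerts {x : V} : x ∈ G.fixedVerts F ↔ x ∈ G.verts F ∧ x ∈ G.fixed := by
  classical exact Finset.mem_filter

theorem pinned_iff : G.toPreGainGraph.Pinned F ↔ (G.fixedVerts F).Nonempty := by
  constructor
  · rintro ⟨e, he, h | h⟩
    exacts [⟨_, mem_fixedVerts.2 ⟨src_mem_verts he, h⟩⟩,
      ⟨_, mem_fixedVerts.2 ⟨tgt_mem_verts he, h⟩⟩]
  · rintro ⟨x, hx⟩
    obtain ⟨hx, hfix⟩ := mem_fixedVerts.1 hx
    obtain ⟨e, he, rfl | rfl⟩ := mem_verts.1 hx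
    exacts [⟨e, he, .inl hfix⟩, ⟨e, he, .inr hfix⟩]

theorem not_pinned_iff : ¬ G.toPreGainGraph.Pinned F ↔ G.fixedVerts F = ∅ := by
  rw [pinned_iff, Finset.not_nonempty_iff_eq_empty]

theorem card_fixedVerts_le_one : (G.fixedVerts F).card ≤ 1 :=
  Finset.card_le_one.2 fun _ ha _ hb =>
    G.fixed_subsingleton (mem_fixedVerts.1 ha).2 (mem_fixedVerts.1 hb).2

theorem card_fixedVerts_of_pinned (h : G.toPreGainGraph.Pinned F) :
    (G.fixedVerts F).card = 1 :=
  card_fixedVerts_le_one.antisymm (pinned_iff.1 h).card_pos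

theorem card_fixedVerts_of_not_pinned (h : ¬ G.toPreGainGraph.Pinned F) :
    (G.fixedVerts F).card = 0 :=
  Finset.card_eq_zero.2 (not_pinned_iff.1 h)

theorem card_verts :
    (G.verts F).card = (G.toPreGainGraph.freeVerts F).card + (G.fixedVerts F).card := by
  classical
  rw [← Finset.card_filter_add_card_filter_not (s := G.verts F) (· ∉ G.fixed)]
  congr 2
  ext x
  simp [mem_fixedVerts]

end Verts

section NearBalanced

variable {V E Γ : Type*} [CommGroup Γ] {G : GainGraph V E Γ} {F : Finset E} {v x : V}
  {δ : Additive Γ} {p q : V → Additive Γ} {b : V} {j m : ℤ}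

theorem explains_iff_step {s : E × Bool} : G.toPreGainGraph.Explains p q s.1 ↔
    ∃ x y, (x = p (G.tail s) ∨ x = q (G.tail s)) ∧ (y = p (G.head s) ∨ y = q (G.head s)) ∧
      Additive.ofMul (G.stepGain s) = y - x := by
  obtain ⟨e, _ | _⟩ := s
  · have hinv (x y : Additive Γ) : Additive.ofMul (G.gain e)⁻¹ = y - x ↔
        Additive.ofMul (G.gain e) = x - y := by rw [ofMul_inv, neg_eq_iff_eq_neg, neg_sub]
    constructor
    · rintro ⟨x, y, hx, hy, hgain⟩
      exact ⟨y, x, hy, hx, (hinv _ _).2 hgain⟩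
    · rintro ⟨x, y, hx, hy, hgain⟩
      exact ⟨y, x, hy, hx, (hinv _ _).1 hgain⟩
  · exact Iff.rfl

theorem joined_of_isWalk_of_dropLast {l : List (E × Bool)} (hl : G.IsWalk v l v)
    (hlF : ∀ s ∈ l, s.1 ∈ F) (hv : ∀ s ∈ l.dropLast, G.head s ≠ v) :
    G.walkGain l = 1 ∨ ∃ g s, G.Joined F {v} v g (G.tail s) ∧ s.1 ∈ F ∧ G.head s = v ∧
      G.walkGain l = g * G.stepGain s := by
  obtain rfl | ⟨l, s, rfl⟩ := l.eq_nil_or_concat'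
  · simp [walkGain]
  · obtain ⟨_, hl, rfl, hhead⟩ := isWalk_append.1 hl
    rw [List.forall_mem_append, List.forall_mem_singleton] at hlF
    rw [List.dropLast_concat] at hv
    exact .inr ⟨G.walkGain l, s, ⟨l, hl, hlF.1, hv, rfl⟩, hlF.2, hhead, by simp [walkGain]⟩

theorem Joined.ofMul_eq_of_isSplitPotential {g : Γ} {w : V} (hj : G.Joined F {b} b g w)
    (hp : G.toPreGainGraph.IsSplitPotential p q b F) :
    (g = 1 ∧ w = b) ∨ (w ≠ b ∧ ∃ x, (x = p b ∨ x = q b) ∧ Additive.ofMul g = p w - x) := by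
  refine hj.induction (.inl ⟨rfl, rfl⟩) fun g s _ ih hs hhead => .inr ⟨hhead, ?_⟩
  obtain ⟨x, y, hx, hy, hstep⟩ := explains_iff_step.1 (hp.2 s.1 hs)
  have hpq_head := hp.1 _ hhead
  rcases ih with ⟨rfl, htail⟩ | ⟨htail, z, hz, hg⟩
  · rw [htail] at hx
    exact ⟨x, hx, by rw [one_mul, hstep]; grind⟩
  · have hpq_tail := hp.1 _ htail
    refine ⟨z, hz, ?_⟩
    rw [ofMul_mul, hg, hstep]
    grind

theorem balanced_iff : G.Balanced F ↔ G.toPreGainGraph.MulBalanced 1 F := by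
  simp only [Balanced, mulBalanced_toPreGainGraph_iff, zpow_one, Subgroup.eq_bot_iff_forall]

theorem balanced_of_isSplitPotential (hp : G.toPreGainGraph.IsSplitPotential p q b F)
    (hb : b ∉ G.verts F) : G.Balanced F :=
  balanced_iff.2 <| PreGainGraph.IsPotential.mulBalanced (r := p) (fun _ he => hp.gain_eq he
    (ne_of_mem_of_not_mem (src_mem_verts he) hb) (ne_of_mem_of_not_mem (tgt_mem_verts he) hb)) 1

theorem nearBalanced_of_splitBalanced (hpin : ¬ G.toPreGainGraph.Pinned F)
    (hsplit : G.toPreGainGraph.SplitBalanced F) (hbal : ¬ G.Balanced F) : G.NearBalanced F := by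
  obtain ⟨p, q, b, hp⟩ := hsplit
  have hb : b ∈ G.verts F := by
    by_contra hb
    exact hbal (balanced_of_isSplitPotential hp hb)
  refine ⟨not_pinned_iff.1 hpin, hbal, b, hb, (q b - p b).toMul, fun l hl hlF hlb => ?_⟩
  rcases joined_of_isWalk_of_dropLast hl hlF hlb with hone | ⟨g, s, hj, hs, hhead, hgain⟩
  · exact .inl hone
  obtain ⟨x, y, hx, hy, hstep⟩ := explains_iff_step.1 (hp.2 s.1 hs)
  rw [hhead] at hy
  have hdiff : Additive.ofMul (G.walkGain l) = 0 ∨ Additive.ofMul (G.walkGain l) = q b - p b ∨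
      Additive.ofMul (G.walkGain l) = -(q b - p b) := by
    rw [hgain, ofMul_mul, hstep]
    rcases hj.ofMul_eq_of_isSplitPotential hp with ⟨rfl, htail⟩ | ⟨htail, z, hz, hg⟩
    · rw [htail] at hx
      rw [ofMul_one]
      grind
    · have hpq_tail := hp.1 _ htail
      rw [hg]
      grind
  exact hdiff.imp ofMul_eq_zero.1 (.imp id id)

variable (G) in
/-- The gains of the walks in `F` from `v` to `x` that do not return to `v`. -/
def gainsFrom (F : Finset E) (v x : V) : Set (Additive Γ) := {a | G.Joined F {v} v a.toMul x}

variable (G) in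
/-- Every closed walk in `F` that starts at `v` and is at `v` only at its ends has gain `0`, `δ` or
`-δ`. The last step of such a walk is `s`. -/
def HasReturnGain (F : Finset E) (v : V) (δ : Additive Γ) : Prop :=
  ∀ s : E × Bool, s.1 ∈ F → G.head s = v → ∀ a ∈ G.gainsFrom F v (G.tail s),
    a + Additive.ofMul (G.stepGain s) ∈ ({0, δ, -δ} : Set (Additive Γ))

theorem NearBalanced.exists_hasReturnGain (h : G.NearBalanced F) :
    ∃ v ∈ G.verts F, ∃ δ, G.HasReturnGain F v δ := by
  obtain ⟨-, -, v, hv, δ, hδ⟩ := h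
  refine ⟨v, hv, Additive.ofMul δ, ?_⟩
  rintro s hs hhead a ⟨l, hl, hlF, hlv, hgain⟩
  have hgain' : a + Additive.ofMul (G.stepGain s) = Additive.ofMul (G.walkGain (l ++ [s])) := by
    rw [walkGain_append, ofMul_mul, hgain, ofMul_toMul]
    simp [walkGain]
  rw [hgain']
  rcases hδ (l ++ [s]) (isWalk_append.2 ⟨_, hl, rfl, hhead⟩)
    (List.forall_mem_append.2 ⟨hlF, by simpa using hs⟩) (by simpa using hlv) with
    hclosed | hclosed | hclosed <;> simp [hclosed]

theorem Joined.eq_one_or_exists_step {g : Γ} (h : G.Joined F {v} v g x) :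
    (g = 1 ∧ x = v) ∨ ∃ s g', s.1 ∈ F ∧ G.tail s = v ∧ G.head s ≠ v ∧
      G.Joined F {v} (G.head s) g' x ∧ g = G.stepGain s * g' := by
  obtain ⟨_ | ⟨s, l⟩, hl, hlF, hlv, rfl⟩ := h
  · exact .inl ⟨by simp [walkGain], (show v = x from hl).symm⟩
  · rw [List.forall_mem_cons] at hlF hlv
    exact .inr ⟨s, G.walkGain l, hlF.1, hl.1, hlv.1, ⟨l, hl.2, hlF.2, hlv.2, rfl⟩,
      by simp [walkGain]⟩

theorem gainsFrom_self : G.gainsFrom F v v = {0} := by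
  ext a
  constructor
  · intro ha
    rcases ha.eq_one_or_exists_step with ⟨hone, -⟩ | ⟨s, g, -, -, hs, hj, -⟩
    exacts [hone, absurd rfl (hj.notMem hs)]
  · rintro rfl
    exact .refl

theorem add_mem_gainsFrom {s : E × Bool} (hs : s.1 ∈ F) (hhead : G.head s ≠ v)
    {a : Additive Γ} (ha : a ∈ G.gainsFrom F v (G.tail s)) :
    a + Additive.ofMul (G.stepGain s) ∈ G.gainsFrom F v (G.head s) :=
  Joined.trans ha (joined_step hs hhead)

theorem gainsFrom_nonempty (h : G.Reachable F v x) : (G.gainsFrom F v x).Nonempty := by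
  obtain ⟨g, hj⟩ := reachable_iff.1 h
  refine hj.induction (motive := fun _ x => (G.gainsFrom F v x).Nonempty)
    (by simp [gainsFrom_self]) ?_
  rintro _ s _ ⟨a, ha⟩ hs -
  by_cases hv : G.head s = v
  · simp [hv, gainsFrom_self]
  · exact ⟨_, add_mem_gainsFrom hs hv ha⟩

theorem HasReturnGain.sub_mem (h : G.HasReturnGain F v δ) {a c : Additive Γ}
    (ha : a ∈ G.gainsFrom F v x) (hc : c ∈ G.gainsFrom F v x) :
    a - c ∈ ({0, δ, -δ} : Set (Additive Γ)) := by
  rcases Joined.eq_one_or_exists_step hc with ⟨-, rfl⟩ | ⟨s, g, hs, htail, hhead, hj, hcg⟩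
  · rw [gainsFrom_self, Set.mem_singleton_iff] at ha hc
    simp [ha, hc]
  · have hback : a + -Additive.ofMul g ∈ G.gainsFrom F v (G.tail (revStep s)) := by
      rw [tail_revStep]
      exact Joined.trans ha (hj.symm hhead)
    have hret := h (revStep s) hs (by rw [head_revStep, htail]) _ hback
    rwa [stepGain_revStep, ofMul_inv, add_assoc, ← neg_add_rev, ← ofMul_mul, ← hcg, ofMul_toMul,
      ← sub_eq_add_neg] at hret

theorem HasReturnGain.add_gain_sub_mem (h : G.HasReturnGain F v δ) {e : E} (he : e ∈ F)
    {a c : Additive Γ} (ha : a ∈ G.gainsFrom F v (G.src e)) (hc : c ∈ G.gainsFrom F v (G.tgt e)) :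
    a + Additive.ofMul (G.gain e) - c ∈ ({0, δ, -δ} : Set (Additive Γ)) := by
  by_cases htgt : G.tgt e = v
  · rw [htgt, gainsFrom_self, Set.mem_singleton_iff] at hc
    rw [hc, sub_zero]
    exact h (e, true) he htgt a ha
  · exact h.sub_mem (add_mem_gainsFrom (s := (e, true)) he htgt ha) hc

theorem HasReturnGain.mulBalanced (h : G.HasReturnGain F v δ)
    (hconn : ∀ x ∈ G.verts F, G.Reachable F v x) (hm : m • δ = 0) :
    G.toPreGainGraph.MulBalanced m F := by
  have hne (x : V) : ∃ a, x ∈ G.verts F → a ∈ G.gainsFrom F v x := by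
    by_cases hx : x ∈ G.verts F
    · exact (gainsFrom_nonempty (hconn x hx)).imp fun _ ha _ => ha
    · exact ⟨0, fun hmem => absurd hmem hx⟩
  choose p hp using hne
  refine ⟨fun x => m • p x, fun e he _ _ => ?_⟩
  have hzero : m • (p (G.src e) + Additive.ofMul (G.gain e) - p (G.tgt e)) = 0 := by
    rcases h.add_gain_sub_mem he (hp _ (src_mem_verts he)) (hp _ (tgt_mem_verts he)) with
      hdiff | hdiff | hdiff <;> rw [hdiff]
    · exact smul_zero m
    · exact hm
    · rw [smul_neg, hm, neg_zero]
  rw [smul_sub, smul_add, sub_eq_zero] at hzero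
  exact eq_sub_of_add_eq' hzero

theorem exists_subset_pair_of_sub_mem {A : Type*} [AddCommGroup A] {R : Set A} {δ : A}
    (hne : R.Nonempty) (hR : ∀ a ∈ R, ∀ c ∈ R, a - c ∈ ({0, δ, -δ} : Set A))
    (htwo : (2 : ℤ) • δ ≠ 0) (hthree : (3 : ℤ) • δ ≠ 0) : ∃ c ∈ R, R ⊆ {c, c + δ} := by
  simp only [Set.mem_insert_iff, Set.mem_singleton_iff] at hR
  obtain ⟨a, ha⟩ := hne
  by_cases h : a - δ ∈ R
  · refine ⟨a - δ, h, fun r hr => ?_⟩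
    have hsub := hR r hr a ha
    have hsub' := hR r hr _ h
    simp only [Set.mem_insert_iff, Set.mem_singleton_iff]
    grind
  · refine ⟨a, ha, fun r hr => ?_⟩
    have hsub := hR r hr a ha
    have hne : r ≠ a - δ := fun h' => h (h' ▸ hr)
    simp only [Set.mem_insert_iff, Set.mem_singleton_iff]
    grind

theorem explains_update_of_gainsFrom_subset [DecidableEq V] (htwo : (2 : ℤ) • δ ≠ 0)
    (hp : ∀ x ∈ G.verts F, p x ∈ G.gainsFrom F v x ∧ G.gainsFrom F v x ⊆ {p x, p x + δ})
    {s : E × Bool} (hs : s.1 ∈ F) (hhead : G.head s ≠ v) :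
    G.toPreGainGraph.Explains p (Function.update p v (p v - δ)) s.1 := by
  have hends : G.tail s ∈ G.verts F ∧ G.head s ∈ G.verts F := by
    obtain ⟨e, _ | _⟩ := s
    exacts [⟨tgt_mem_verts hs, src_mem_verts hs⟩, ⟨src_mem_verts hs, tgt_mem_verts hs⟩]
  obtain ⟨htail_mem, htail_sub⟩ := hp _ hends.1
  obtain ⟨hhead_mem, hhead_sub⟩ := hp _ hends.2
  have hfwd := hhead_sub (add_mem_gainsFrom hs hhead htail_mem)
  rw [explains_iff_step]
  rcases hfwd with hgain | hgain
  · exact ⟨_, _, .inl rfl, .inl rfl, eq_sub_of_add_eq' hgain⟩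
  by_cases htail : G.tail s = v
  · refine ⟨p v - δ, p (G.head s), .inr ?_, .inl rfl, ?_⟩
    · rw [htail, Function.update_self]
    · rw [htail] at hgain
      grind
  · have hbwd := htail_sub (head_revStep (G := G) s ▸ add_mem_gainsFrom (s := revStep s) hs
      ((head_revStep s).trans_ne htail) ((tail_revStep (G := G) s).symm ▸ hhead_mem))
    rw [stepGain_revStep, tail_revStep, ofMul_inv, Set.mem_insert_iff,
      Set.mem_singleton_iff] at hbwd
    rw [Set.mem_singleton_iff] at hgain
    exact ⟨_, _, .inl rfl, .inl rfl, by grind⟩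

theorem HasReturnGain.splitBalanced (h : G.HasReturnGain F v δ) (hv : v ∈ G.verts F)
    (hconn : ∀ x ∈ G.verts F, G.Reachable F v x) (htwo : (2 : ℤ) • δ ≠ 0)
    (hthree : (3 : ℤ) • δ ≠ 0) : G.toPreGainGraph.SplitBalanced F := by
  classical
  have hpair (x : V) : ∃ c, x ∈ G.verts F →
      c ∈ G.gainsFrom F v x ∧ G.gainsFrom F v x ⊆ {c, c + δ} := by
    by_cases hx : x ∈ G.verts F
    · exact (exists_subset_pair_of_sub_mem (gainsFrom_nonempty (hconn x hx))
        (fun a ha c hc => h.sub_mem ha hc) htwo hthree).imp fun _ hc _ => hc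
    · exact ⟨0, fun hmem => absurd hmem hx⟩
  choose p hp using hpair
  have hpv : p v = 0 := by simpa [gainsFrom_self] using (hp v hv).1
  refine ⟨p, Function.update p v (p v - δ), v, fun x hx => by simp [hx], fun e he => ?_⟩
  by_cases htgt : G.tgt e = v
  · by_cases hsrc : G.src e = v
    · have hloop := h.add_gain_sub_mem he (a := p v) (c := p v) (hsrc ▸ (hp v hv).1)
        (htgt ▸ (hp v hv).1)
      simp only [PreGainGraph.Explains, toPreGainGraph, hsrc, htgt, Function.update_self]
      rw [hpv, zero_add, sub_zero] at hloop
      rcases hloop with hgain | hgain | hgain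
      · exact ⟨p v, p v, .inl rfl, .inl rfl, by rw [hgain, sub_self]⟩
      · exact ⟨p v - δ, p v, .inr rfl, .inl rfl, by rw [hgain, sub_sub_cancel]⟩
      · exact ⟨p v, p v - δ, .inl rfl, .inr rfl, by rw [hgain, sub_sub_cancel_left]⟩
    · exact explains_update_of_gainsFrom_subset htwo hp (s := (e, false)) he hsrc
  · exact explains_update_of_gainsFrom_subset htwo hp (s := (e, true)) he htgt

theorem exists_add_smul_eq_zero {A : Type*} [AddCommGroup A] {a : A} (j : ℤ)
    (h : (2 : ℤ) • a = 0 ∨ (3 : ℤ) • a = 0) :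
    ∃ i ∈ ({-1, 0, 1} : Finset ℤ), (j + i) • a = 0 := by
  have hmul {n c : ℤ} (hn : n • a = 0) (hc : ∃ i ∈ ({-1, 0, 1} : Finset ℤ), j + i = c * n) :
      ∃ i ∈ ({-1, 0, 1} : Finset ℤ), (j + i) • a = 0 :=
    hc.imp fun i hi => ⟨hi.1, by rw [hi.2, mul_smul, hn, smul_zero]⟩
  simp only [Finset.mem_insert, Finset.mem_singleton] at hmul ⊢
  rcases h with h | h
  · exact hmul (c := j / 2) h ⟨-(j % 2), by omega, by omega⟩
  · exact hmul (c := (j + 1) / 3) h ⟨1 - (j + 1) % 3, by omega, by omega⟩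

theorem NearBalanced.one_le_defect
    (hconn : ∀ x ∈ G.verts F, ∀ y ∈ G.verts F, G.Reachable F x y) (h : G.NearBalanced F) :
    1 ≤ G.toPreGainGraph.defect j F := by
  have hpin : ¬ G.toPreGainGraph.Pinned F := not_pinned_iff.2 h.1
  obtain ⟨v, hv, δ, hδ⟩ := h.exists_hasReturnGain
  by_cases hsmall : (2 : ℤ) • δ = 0 ∨ (3 : ℤ) • δ = 0
  · obtain ⟨i, hi, hzero⟩ := exists_add_smul_eq_zero j hsmall
    refine le_trans (Finset.card_pos.2 ⟨i, ?_⟩) PreGainGraph.card_rigidTypes_le_defect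
    exact PreGainGraph.mem_rigidTypes.2 ⟨hi, hδ.mulBalanced (hconn v hv) hzero, .inr hpin⟩
  · rw [not_or] at hsmall
    exact PreGainGraph.one_le_defect_of_splitBalanced hpin
      (hδ.splitBalanced hv (hconn v hv) hsmall.1 hsmall.2)

end NearBalanced

section Alpha

variable {V E Γ : Type*} [CommGroup Γ] {G : GainGraph V E Γ} {F : Finset E} {j k : ℕ}

theorem alpha_add_le_three : G.alpha k j F + 2 * (G.fixedVerts F).card ≤ 3 := by
  have hfix := card_fixedVerts_le_one (G := G) (F := F)
  unfold alpha
  split_ifs <;> omega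

variable [IsCyclic Γ]

theorem hasGroup_iff {n : ℕ} : G.HasGroup F n ↔ Nat.card (G.gainGroup F) = n := by
  constructor
  · rintro ⟨φ⟩
    rw [Nat.card_congr φ.toEquiv, Nat.card_congr Multiplicative.toAdd, Nat.card_zmod]
  · rintro rfl
    exact ⟨(zmodCyclicMulEquiv inferInstance).symm⟩

theorem mulBalanced_iff_card_gainGroup_dvd {m : ℤ} :
    G.toPreGainGraph.MulBalanced m F ↔ (Nat.card (G.gainGroup F) : ℤ) ∣ m := by
  rw [mulBalanced_toPreGainGraph_iff, Int.natCast_dvd, ← IsCyclic.exponent_eq_card,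
    Monoid.exponent_dvd_iff_forall_pow_eq_one]
  simp only [Subtype.forall, pow_natAbs_eq_one, Subtype.ext_iff, SubgroupClass.coe_zpow,
    OneMemClass.coe_one]

theorem card_rigidTypes_le_one (hbal : ¬ G.Balanced F) (htwo : ¬ (Odd j ∧ G.HasGroup F 2)) :
    (G.toPreGainGraph.rigidTypes j F).card ≤ 1 := by
  rw [Balanced, ← Subgroup.card_eq_one] at hbal
  rw [hasGroup_iff, ← Int.odd_coe_nat] at htwo
  exact PreGainGraph.card_rigidTypes_le_one_of_dvd
    (fun _ => mulBalanced_iff_card_gainGroup_dvd.1) hbal htwo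

theorem defect_eq_two_of_odd (hpin : ¬ G.toPreGainGraph.Pinned F) (hodd : Odd j)
    (htwo : G.HasGroup F 2) : G.toPreGainGraph.defect j F = 2 := by
  rw [hasGroup_iff] at htwo
  have htypes : G.toPreGainGraph.rigidTypes j F = {-1, 1} := by
    ext i
    simp only [PreGainGraph.mem_rigidTypes, mulBalanced_iff_card_gainGroup_dvd, htwo,
      Finset.mem_insert, Finset.mem_singleton, hpin, not_false_eq_true, or_true, and_true]
    rw [Nat.odd_iff] at hodd
    omega
  unfold PreGainGraph.defect
  rw [htypes]
  split_ifs <;> rfl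

theorem defect_eq_one_of_mem_rigidTypes (hbal : ¬ G.Balanced F)
    (htwo : ¬ (Odd j ∧ G.HasGroup F 2)) {i : ℤ} (hi : i ∈ G.toPreGainGraph.rigidTypes j F) :
    G.toPreGainGraph.defect j F = 1 := by
  have hle := card_rigidTypes_le_one hbal htwo
  have hpos := Finset.card_pos.2 ⟨i, hi⟩
  unfold PreGainGraph.defect
  split_ifs <;> omega

theorem exists_mem_rigidTypes_of_hasGroup (hpin : ¬ G.toPreGainGraph.Pinned F)
    (h : G.HasGroup F 2 ∨ G.HasGroup F 3) : ∃ i, i ∈ G.toPreGainGraph.rigidTypes j F := by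
  suffices hdvd : ∃ i ∈ ({-1, 0, 1} : Finset ℤ), (Nat.card (G.gainGroup F) : ℤ) ∣ j + i by
    obtain ⟨i, hi, hdvd⟩ := hdvd
    exact ⟨i, PreGainGraph.mem_rigidTypes.2
      ⟨hi, mulBalanced_iff_card_gainGroup_dvd.2 hdvd, .inr hpin⟩⟩
  simp only [Finset.mem_insert, Finset.mem_singleton]
  rcases h with h | h <;> rw [hasGroup_iff.1 h]
  · exact ⟨-(j % 2), by omega, by omega⟩
  · exact ⟨1 - (j + 1) % 3, by omega, by omega⟩

variable [Finite Γ]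

theorem isSZero_iff (hk : Nat.card Γ = k) (hbal : ¬ G.Balanced F) :
    G.IsSZero k j F ↔ G.toPreGainGraph.MulBalanced j F := by
  rw [Balanced, ← Subgroup.card_eq_one] at hbal
  have hpos : 0 < Nat.card (G.gainGroup F) := Nat.card_pos
  simp only [IsSZero, hasGroup_iff, SSet, Set.mem_ofPred_eq, exists_eq_right',
    mulBalanced_iff_card_gainGroup_dvd, Int.modEq_zero_iff_dvd, Nat.odd_iff]
  refine ⟨fun h => h.2.2.2, fun h => ⟨by omega, hk ▸ Subgroup.card_subgroup_dvd_card _, ?_, h⟩⟩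
  intro hodd htwo
  rw [htwo] at h
  omega

theorem isSOne_iff (hk : Nat.card Γ = k) (hbal : ¬ G.Balanced F)
    (htwo : ¬ (Odd j ∧ G.HasGroup F 2)) :
    G.IsSOne k j F ↔ G.toPreGainGraph.MulBalanced (j + -1) F ∨
      G.toPreGainGraph.MulBalanced (j + 1) F := by
  rw [Balanced, ← Subgroup.card_eq_one] at hbal
  rw [hasGroup_iff, not_and] at htwo
  have hpos : 0 < Nat.card (G.gainGroup F) := Nat.card_pos
  have hdvd : Nat.card (G.gainGroup F) ∣ k := hk ▸ Subgroup.card_subgroup_dvd_card _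
  have hge : 2 ≤ Nat.card (G.gainGroup F) := by omega
  simp only [IsSOne, hasGroup_iff, SSet, Set.mem_union, Set.mem_ofPred_eq, exists_eq_right',
    mulBalanced_iff_card_gainGroup_dvd, Int.modEq_comm (a := (j : ℤ)), Int.modEq_iff_dvd,
    sub_eq_add_neg, neg_neg]
  tauto

theorem defect_add_alpha_of_not_pinned (hk : Nat.card Γ = k)
    (hpin : ¬ G.toPreGainGraph.Pinned F)
    (hnear : G.NearBalanced F → 1 ≤ G.toPreGainGraph.defect j F) :
    (G.toPreGainGraph.defect j F : ℤ) + G.alpha k j F = 3 := by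
  have hmem {i : ℤ} (hi : i ∈ ({-1, 0, 1} : Finset ℤ))
      (hbal : G.toPreGainGraph.MulBalanced (j + i) F) :
      i ∈ G.toPreGainGraph.rigidTypes j F := PreGainGraph.mem_rigidTypes.2 ⟨hi, hbal, .inr hpin⟩
  unfold alpha
  rw [card_fixedVerts_of_not_pinned hpin]
  split_ifs with hbal htwo hone hzero
  · rw [PreGainGraph.defect_eq_three hpin (balanced_iff.1 hbal)]
    norm_num
  · rw [defect_eq_two_of_odd hpin htwo.1 htwo.2]
    norm_num
  · obtain ⟨i, hi⟩ : ∃ i, i ∈ G.toPreGainGraph.rigidTypes j F :=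
      ((isSOne_iff hk hbal htwo).1 hone).elim (fun h => ⟨_, hmem (by decide) h⟩)
        fun h => ⟨_, hmem (by decide) h⟩
    rw [defect_eq_one_of_mem_rigidTypes hbal htwo hi]
    norm_num
  · rw [isSZero_iff hk hbal] at hzero
    suffices h : G.toPreGainGraph.defect j F = 1 by rw [h]; norm_num
    rcases hzero with hzero | hproper
    · exact defect_eq_one_of_mem_rigidTypes hbal htwo (hmem (i := 0) (by decide) (by simpa))
    · have hle := card_rigidTypes_le_one (j := j) hbal htwo
      have hge := hnear hproper.1
      unfold PreGainGraph.defect at hge ⊢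
      split_ifs at hge ⊢ <;> omega
  · rw [not_or, isSZero_iff hk hbal] at hzero
    rw [isSOne_iff hk hbal htwo, not_or] at hone
    have hempty (i : ℤ) : i ∉ G.toPreGainGraph.rigidTypes j F := by
      intro hi
      obtain ⟨hi, hdvd, -⟩ := PreGainGraph.mem_rigidTypes.1 hi
      simp only [Finset.mem_insert, Finset.mem_singleton] at hi
      rcases hi with rfl | rfl | rfl
      exacts [hone.1 hdvd, hzero.1 (by simpa using hdvd), hone.2 hdvd]
    have hsplit : ¬ G.toPreGainGraph.SplitBalanced F := fun h =>
      hzero.2 ⟨nearBalanced_of_splitBalanced hpin h hbal, not_or.1 fun hgroup =>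
        (exists_mem_rigidTypes_of_hasGroup hpin hgroup).elim hempty⟩
    rw [PreGainGraph.defect_of_not_splitBalanced (not_and_of_not_right _ hsplit),
      Finset.eq_empty_of_forall_notMem hempty]
    norm_num

theorem defect_add_alpha_of_pinned (hk : Nat.card Γ = k) (hpin : G.toPreGainGraph.Pinned F) :
    (G.toPreGainGraph.defect j F : ℤ) + G.alpha k j F = 1 := by
  have hnear : ¬ G.ProperNearBalanced F := fun h => not_pinned_iff.2 h.1.1 hpin
  rw [PreGainGraph.defect_of_pinned hpin]
  unfold alpha
  rw [card_fixedVerts_of_pinned hpin]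
  by_cases hbal : G.Balanced F
  · simp [hbal, (balanced_iff.1 hbal).of_one]
  by_cases hzero : G.toPreGainGraph.MulBalanced j F
  · have htwo : ¬ (Odd j ∧ G.HasGroup F 2) := by
      rw [hasGroup_iff, Nat.odd_iff]
      rintro ⟨hodd, hcard⟩
      rw [mulBalanced_iff_card_gainGroup_dvd, hcard] at hzero
      omega
    have hone : ¬ G.IsSOne k j F := by
      rw [isSOne_iff hk hbal htwo]
      simp only [balanced_iff, mulBalanced_iff_card_gainGroup_dvd] at hbal hzero ⊢
      rw [dvd_add_right hzero, dvd_add_right hzero, dvd_neg, or_self]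
      exact hbal
    simp [hbal, htwo, hone, hzero, isSZero_iff hk hbal]
  · simp only [hbal, hzero, isSZero_iff hk hbal, hnear, or_self, if_false]
    split_ifs <;> norm_num

theorem defect_add_alpha_eq (hk : Nat.card Γ = k)
    (hnear : G.NearBalanced F → 1 ≤ G.toPreGainGraph.defect j F) :
    (G.toPreGainGraph.defect j F : ℤ) + G.alpha k j F + 2 * (G.fixedVerts F).card = 3 := by
  by_cases hpin : G.toPreGainGraph.Pinned F
  · rw [defect_add_alpha_of_pinned hk hpin, card_fixedVerts_of_pinned hpin]
    norm_num
  · rw [defect_add_alpha_of_not_pinned hk hpin hnear, card_fixedVerts_of_not_pinned hpin]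
    norm_num

theorem defect_add_alpha_le (hk : Nat.card Γ = k) :
    (G.toPreGainGraph.defect j F : ℤ) + G.alpha k j F + 2 * (G.fixedVerts F).card ≤ 3 := by
  by_cases hnear : G.NearBalanced F → 1 ≤ G.toPreGainGraph.defect j F
  · exact (defect_add_alpha_eq hk hnear).le
  · have hzero : G.toPreGainGraph.defect j F = 0 :=
      Nat.eq_zero_of_not_pos fun hpos => hnear fun _ => hpos
    simpa [hzero] using alpha_add_le_three

end Alpha

section Components

variable {V E Γ : Type*} [CommGroup Γ] {G : GainGraph V E Γ} {F X : Finset E} {e f : E} {x y : V}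

variable (G) in
open Classical in
/-- The connected component of the edge `e` in the edge set `F`, as an edge set. -/
noncomputable def component (F : Finset E) (e : E) : Finset E :=
  F.filter fun f => G.Reachable F (G.src e) (G.src f)

theorem mem_component : f ∈ G.component F e ↔ f ∈ F ∧ G.Reachable F (G.src e) (G.src f) := by
  classical exact Finset.mem_filter

theorem component_subset : G.component F e ⊆ F := fun _ hf => (mem_component.1 hf).1

theorem self_mem_component (he : e ∈ F) : e ∈ G.component F e :=
  mem_component.2 ⟨he, .refl⟩

theorem mem_components : X ∈ G.components F ↔ ∃ e ∈ F, G.component F e = X := by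
  simp only [components, Finset.mem_image, component]

theorem component_mem_components (he : e ∈ F) : G.component F e ∈ G.components F :=
  mem_components.2 ⟨e, he, rfl⟩

theorem component_eq_of_reachable (h : G.Reachable F (G.src e) (G.src f)) :
    G.component F e = G.component F f := by
  ext x
  simp only [mem_component, and_congr_right_iff]
  exact fun _ => ⟨h.symm.trans, h.trans⟩

theorem components_eq_singleton (he : e ∈ F) (hF : G.component F e = F) :
    G.components F = {F} := by
  ext X
  rw [mem_components, Finset.mem_singleton]
  constructor
  · rintro ⟨f, hf, rfl⟩
    rw [← component_eq_of_reachable (mem_component.1 (hF.symm ▸ hf)).2, hF]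
  · rintro rfl
    exact ⟨e, he, hF⟩

theorem reachable_of_mem_verts (hx : x ∈ G.verts (G.component F e)) :
    G.Reachable F (G.src e) x := by
  obtain ⟨f, hf, rfl | rfl⟩ := mem_verts.1 hx
  · exact (mem_component.1 hf).2
  · exact (mem_component.1 hf).2.trans (reachable_edge (mem_component.1 hf).1)

theorem mem_component_of_step {s : E × Bool} (hs : s.1 ∈ F)
    (h : G.Reachable F (G.src e) (G.tail s)) : s.1 ∈ G.component F e := by
  refine mem_component.2 ⟨hs, ?_⟩
  obtain ⟨f, _ | _⟩ := s
  · exact h.trans (reachable_step (s := (f, false)) hs)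
  · exact h

theorem reachable_component (h : G.Reachable F (G.src e) x) :
    G.Reachable (G.component F e) (G.src e) x := by
  obtain ⟨g, hg⟩ := reachable_iff.1 h
  refine hg.induction (motive := fun _ x => G.Reachable (G.component F e) (G.src e) x) .refl ?_
  intro g s hjoin hreach hs _
  exact hreach.trans (reachable_step (mem_component_of_step hs (reachable_iff.2 ⟨_, hjoin⟩)))

theorem reachable_of_mem_components (hX : X ∈ G.components F) (hx : x ∈ G.verts X)
    (hy : y ∈ G.verts X) : G.Reachable X x y := by
  obtain ⟨e, -, rfl⟩ := mem_components.1 hX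
  exact (reachable_component (reachable_of_mem_verts hx)).symm.trans
    (reachable_component (reachable_of_mem_verts hy))

theorem mem_verts_of_mem_freeVerts (hx : x ∈ G.toPreGainGraph.freeVerts F) : x ∈ G.verts F := by
  obtain ⟨⟨e, he, hinc⟩, -⟩ := PreGainGraph.mem_freeVerts.1 hx
  exact mem_verts.2 ⟨e, he, hinc⟩

theorem disjoint_freeVerts_component [DecidableEq E] :
    Disjoint (G.toPreGainGraph.freeVerts (G.component F e))
      (G.toPreGainGraph.freeVerts (F \ G.component F e)) := by
  rw [Finset.disjoint_left]
  intro x hx hx'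
  have hreach := reachable_of_mem_verts (mem_verts_of_mem_freeVerts hx)
  obtain ⟨f, hf, hinc⟩ := mem_verts.1 (mem_verts_of_mem_freeVerts hx')
  obtain ⟨hf, hnotMem⟩ := Finset.mem_sdiff.1 hf
  rcases hinc with rfl | rfl
  · exact hnotMem (mem_component_of_step (s := (f, true)) hf hreach)
  · exact hnotMem (mem_component_of_step (s := (f, false)) hf hreach)

theorem card_freeVerts_component_add [DecidableEq E] :
    (G.toPreGainGraph.freeVerts (G.component F e)).card +
      (G.toPreGainGraph.freeVerts (F \ G.component F e)).card =
        (G.toPreGainGraph.freeVerts F).card := by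
  classical
  rw [← Finset.card_union_of_disjoint disjoint_freeVerts_component,
    ← PreGainGraph.freeVerts_union, Finset.union_sdiff_of_subset component_subset]

theorem sum_card_freeVerts_components :
    ∑ X ∈ G.components F, (G.toPreGainGraph.freeVerts X).card =
      (G.toPreGainGraph.freeVerts F).card := by
  classical
  have hunion : G.toPreGainGraph.freeVerts F =
      (G.components F).biUnion fun X => G.toPreGainGraph.freeVerts X := by
    ext x
    rw [Finset.mem_biUnion]
    constructor
    · intro hx
      obtain ⟨⟨e, he, hinc⟩, hfree⟩ := PreGainGraph.mem_freeVerts.1 hx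
      exact ⟨_, component_mem_components he,
        PreGainGraph.mem_freeVerts.2 ⟨⟨e, self_mem_component he, hinc⟩, hfree⟩⟩
    · rintro ⟨X, hX, hx⟩
      obtain ⟨e, -, rfl⟩ := mem_components.1 hX
      exact PreGainGraph.freeVerts_mono component_subset hx
  rw [hunion]
  refine (Finset.card_biUnion fun X hX Y hY hne =>
    Finset.disjoint_left.2 fun x hx hx' => hne ?_).symm
  obtain ⟨e, -, rfl⟩ := mem_components.1 hX
  obtain ⟨f, -, rfl⟩ := mem_components.1 hY
  exact component_eq_of_reachable ((reachable_of_mem_verts (mem_verts_of_mem_freeVerts hx)).trans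
    (reachable_of_mem_verts (mem_verts_of_mem_freeVerts hx')).symm)

variable [Finite Γ] [IsCyclic Γ] {j k : ℕ}

theorem count_component_eq (hk : Nat.card Γ = k) (hX : X ∈ G.components F) :
    2 * ((G.verts X).card : ℤ) - 3 + G.alpha k j X =
      2 * (G.toPreGainGraph.freeVerts X).card - G.toPreGainGraph.defect j X := by
  have hdefect := defect_add_alpha_eq (F := X) hk fun hnear =>
    hnear.one_le_defect (j := j) fun _ hx _ hy => reachable_of_mem_components hX hx hy
  rw [card_verts]
  push_cast
  linarith

theorem count_eq (hk : Nat.card Γ = k) :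
    G.count k j F = 2 * (G.toPreGainGraph.freeVerts F).card -
      ∑ X ∈ G.components F, (G.toPreGainGraph.defect j X : ℤ) := by
  rw [count, Finset.sum_congr rfl fun X hX => count_component_eq hk hX, Finset.sum_sub_distrib,
    ← Finset.mul_sum, ← sum_card_freeVerts_components]
  push_cast
  rfl

/-- Splitting off a connected component only adds up free vertices, so it is enough to count on
connected sets. -/
theorem indep_of_gainSparse (hk : Nat.card Γ = k) (h : G.GainSparse k j) :
    G.toPreGainGraph.Indep j F := by
  classical
  suffices ∀ F : Finset E, F.Nonempty →
      F.card + G.toPreGainGraph.defect j F ≤ 2 * (G.toPreGainGraph.freeVerts F).card from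
    fun F _ => this F
  intro F
  induction F using Finset.strongInduction with
  | H F ih =>
    rintro ⟨e, he⟩
    by_cases hF : G.component F e = F
    · have hcard := h F ⟨e, he⟩
      rw [count, components_eq_singleton he hF, Finset.sum_singleton, card_verts] at hcard
      have hdefect := defect_add_alpha_le (G := G) (F := F) (j := j) hk
      push_cast at hcard
      omega
    · have hself := self_mem_component (G := G) he
      have hcomp := ih _ (component_subset.ssubset_of_ne hF) ⟨e, hself⟩
      have hrest := ih (F \ G.component F e) (Finset.sdiff_ssubset component_subset ⟨e, hself⟩)
        (Finset.sdiff_nonempty.2 fun hle => hF (component_subset.antisymm hle))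
      have hedges := Finset.card_sdiff_add_card_eq_card
        (component_subset (G := G) (F := F) (e := e))
      have hverts := card_freeVerts_component_add (G := G) (F := F) (e := e)
      have hdefect := PreGainGraph.defect_anti (P := G.toPreGainGraph) (j := j)
        (component_subset (G := G) (F := F) (e := e))
      omega

theorem gainSparse_of_indep (hk : Nat.card Γ = k) (h : ∀ F, G.toPreGainGraph.Indep j F) :
    G.GainSparse k j := by
  classical
  intro F _
  have hcover : F ⊆ (G.components F).biUnion id := fun e he =>
    Finset.mem_biUnion.2 ⟨_, component_mem_components he, self_mem_component he⟩
  calc (F.card : ℤ) ≤ ∑ X ∈ G.components F, (X.card : ℤ) := by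
        exact_mod_cast (Finset.card_le_card hcover).trans Finset.card_biUnion_le
    _ ≤ _ := Finset.sum_le_sum fun X hX => by
      rw [count_component_eq hk hX]
      obtain ⟨e, he, rfl⟩ := mem_components.1 hX
      have hindep := h (G.component F e) _ subset_rfl ⟨e, self_mem_component he⟩
      omega

end Components

end GainGraph

namespace PreGainGraph

section Embedding

variable {V U V' U' Γ : Type*} {P : PreGainGraph V U Γ} {P' : PreGainGraph V' U' Γ}
  {ι : U' ↪ U} {κ : V' ↪ V} {F : Finset U'} {j m : ℤ}

variable (P P' ι κ) in
/-- `ι` (on edges) and `κ` (on vertices) embed `P'` into `P`, preserving ends, gains and fixed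
vertices. -/
structure Embeds : Prop where
  src : ∀ e, P.src (ι e) = κ (P'.src e)
  tgt : ∀ e, P.tgt (ι e) = κ (P'.tgt e)
  gain : ∀ e, P.gain (ι e) = P'.gain e
  fixed : ∀ x, κ x ∈ P.fixed ↔ x ∈ P'.fixed

theorem Embeds.freeVerts_map (h : P.Embeds P' ι κ) :
    P.freeVerts (F.map ι) = (P'.freeVerts F).map κ := by
  ext x
  simp only [mem_freeVerts, Finset.mem_map]
  constructor
  · rintro ⟨⟨_, ⟨e, he, rfl⟩, hinc⟩, hfree⟩
    rw [h.src, h.tgt] at hinc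
    rcases hinc with rfl | rfl <;> rw [h.fixed] at hfree
    exacts [⟨_, ⟨⟨e, he, .inl rfl⟩, hfree⟩, rfl⟩, ⟨_, ⟨⟨e, he, .inr rfl⟩, hfree⟩, rfl⟩]
  · rintro ⟨y, ⟨⟨e, he, hinc⟩, hfree⟩, rfl⟩
    rw [h.fixed]
    refine ⟨⟨_, ⟨e, he, rfl⟩, ?_⟩, hfree⟩
    rw [h.src, h.tgt]
    exact hinc.imp (congrArg κ) (congrArg κ)

theorem Embeds.pinned_map (h : P.Embeds P' ι κ) :
    P.Pinned (F.map ι) ↔ P'.Pinned F := by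
  simp only [Pinned, Finset.mem_map, exists_exists_and_eq_and, h.src, h.tgt, h.fixed]

variable [AddCommGroup Γ]

theorem Embeds.mulBalanced_map (h : P.Embeds P' ι κ) :
    P.MulBalanced m (F.map ι) ↔ P'.MulBalanced m F := by
  simp only [MulBalanced, Finset.forall_mem_map, h.src, h.tgt, h.gain,
    h.fixed]
  constructor
  · rintro ⟨p, hp⟩
    exact ⟨p ∘ κ, hp⟩
  · rintro ⟨p, hp⟩
    refine ⟨Function.extend κ p 0, ?_⟩
    simpa only [κ.injective.extend_apply] using hp

theorem Embeds.splitBalanced_map (h : P.Embeds P' ι κ) (hF : F.Nonempty) :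
    P.SplitBalanced (F.map ι) ↔ P'.SplitBalanced F := by
  simp only [SplitBalanced, IsSplitPotential, Explains, Finset.forall_mem_map,
    h.src, h.tgt, h.gain]
  constructor
  · rintro ⟨p, q, b, hpq, hexp⟩
    by_cases hb : ∃ b', κ b' = b
    · obtain ⟨b', rfl⟩ := hb
      exact ⟨p ∘ κ, q ∘ κ, b', fun x hx => hpq _ (κ.injective.ne hx), hexp⟩
    · obtain ⟨e, -⟩ := hF
      exact ⟨p ∘ κ, q ∘ κ, P'.src e, fun x _ => hpq _ fun hx => hb ⟨x, hx⟩, hexp⟩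
  · rintro ⟨p, q, b, hpq, hexp⟩
    refine ⟨Function.extend κ p 0, Function.extend κ q 0, κ b, fun x hx => ?_, ?_⟩
    · by_cases hrange : ∃ y, κ y = x
      · obtain ⟨y, rfl⟩ := hrange
        rw [κ.injective.extend_apply, κ.injective.extend_apply]
        exact hpq y fun hy => hx (hy ▸ rfl)
      · rw [Function.extend_apply' _ _ _ hrange, Function.extend_apply' _ _ _ hrange]
    · simpa only [κ.injective.extend_apply] using hexp

theorem Embeds.defect_map (h : P.Embeds P' ι κ) (hF : F.Nonempty) :
    P.defect j (F.map ι) = P'.defect j F := by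
  classical simp only [defect, rigidTypes, h.pinned_map, h.mulBalanced_map, h.splitBalanced_map hF]

theorem Embeds.indep_map (h : P.Embeds P' ι κ) :
    P.Indep j (F.map ι) ↔ P'.Indep j F := by
  constructor
  · intro hI X hX hne
    have hcard := hI _ (Finset.map_subset_map.2 hX) (hne.map)
    rwa [h.defect_map hne, h.freeVerts_map, Finset.card_map, Finset.card_map] at hcard
  · intro hI Y hY hne
    obtain ⟨X, hX, rfl⟩ := Finset.subset_map_iff.1 hY
    rw [h.defect_map (Finset.map_nonempty.1 hne), h.freeVerts_map, Finset.card_map,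
      Finset.card_map]
    exact hI X hX (Finset.map_nonempty.1 hne)

end Embedding

section Parallel

variable {V U Γ : Type*} [AddCommGroup Γ] {P : PreGainGraph V U Γ} {j : ℤ} {e f : U}

theorem mulBalanced_of_forall_fixed {F : Finset U} {m : ℤ}
    (h : ∀ e ∈ F, P.src e ∈ P.fixed ∨ P.tgt e ∈ P.fixed) : P.MulBalanced m F :=
  ⟨0, fun e he hsrc htgt => absurd (h e he) (not_or.2 ⟨hsrc, htgt⟩)⟩

theorem Indep.src_ne_tgt_of_fixed (h : P.Indep j {e}) (he : P.src e ∈ P.fixed) :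
    P.src e ≠ P.tgt e := by
  intro hloop
  have hcard := h {e} subset_rfl (Finset.singleton_nonempty e)
  have hverts : P.freeVerts {e} ⊆ ∅ := freeVerts_subset_iff.2 fun f hf => by
    rw [Finset.mem_singleton.1 hf, ← hloop]
    exact ⟨absurd he, absurd he⟩
  rw [Finset.subset_empty.1 hverts] at hcard
  simp at hcard

theorem Indep.loop_gain_ne_zero (h : P.Indep j {e}) (hloop : P.src e = P.tgt e) :
    P.gain e ≠ 0 := by
  intro hzero
  by_cases hfix : P.src e ∈ P.fixed
  · exact h.src_ne_tgt_of_fixed hfix hloop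
  have hpin : ¬ P.Pinned {e} := by
    rintro ⟨f, hf, hfixed⟩
    rw [Finset.mem_singleton.1 hf, ← hloop, or_self] at hfixed
    exact hfix hfixed
  have hpot : P.IsPotential 0 {e} := fun f hf => by
    rw [Finset.mem_singleton.1 hf, hzero]
    simp
  have hcard := h {e} subset_rfl (Finset.singleton_nonempty e)
  rw [defect_eq_three hpin (hpot.mulBalanced 1), Finset.card_singleton] at hcard
  have hverts : P.freeVerts {e} ⊆ {P.src e} := freeVerts_subset_iff.2 fun f hf => by
    rw [Finset.mem_singleton.1 hf, ← hloop]
    simp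
  have hle := Finset.card_le_card hverts
  rw [Finset.card_singleton] at hle
  omega

/-- `e` and `f` are parallel edges with the same gain, after reversing one of them if they have
opposite directions. -/
def SameArc (P : PreGainGraph V U Γ) (e f : U) : Prop :=
  (P.src e = P.src f ∧ P.tgt e = P.tgt f ∧ P.gain e = P.gain f) ∨
    (P.src e = P.tgt f ∧ P.tgt e = P.src f ∧ P.gain e = -P.gain f)

theorem SameArc.sym2_eq (h : P.SameArc e f) :
    s(P.src e, P.tgt e) = s(P.src f, P.tgt f) := by
  rcases h with ⟨hs, ht, -⟩ | ⟨hs, ht, -⟩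
  · rw [hs, ht]
  · rw [hs, ht, Sym2.eq_swap]

variable [DecidableEq U]

theorem SameArc.isPotential [DecidableEq V] (h : P.SameArc e f) (he : P.src e ≠ P.tgt e) :
    P.IsPotential (Pi.single (P.tgt e) (P.gain e)) {e, f} := by
  simp only [IsPotential, Finset.mem_insert, Finset.mem_singleton]
  rintro _ (rfl | rfl)
  · simp [he]
  · rcases h with ⟨hs, ht, hgain⟩ | ⟨hs, ht, hgain⟩ <;> rw [← hs, ← ht] <;> simp [he, hgain]

theorem SameArc.splitBalanced (h : P.SameArc e f) (hloop : P.src e = P.tgt e) :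
    P.SplitBalanced {e, f} := by
  classical
  refine ⟨0, Pi.single (P.tgt e) (P.gain e), P.tgt e, fun x hx => by simp [hx], ?_⟩
  simp only [Finset.mem_insert, Finset.mem_singleton]
  rintro _ (rfl | rfl)
  · exact ⟨0, _, .inl rfl, .inr rfl, by simp⟩
  · rcases h with ⟨-, ht, hgain⟩ | ⟨-, ht, hgain⟩
    · exact ⟨0, _, .inl rfl, .inr rfl, by simp [ht, hgain]⟩
    · exact ⟨_, 0, .inr rfl, .inl rfl, by simp [ht, hgain]⟩

theorem Indep.eq_of_fixed (h : P.Indep j {e, f}) (he : P.src e ∈ P.fixed ∨ P.tgt e ∈ P.fixed)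
    (hef : s(P.src e, P.tgt e) = s(P.src f, P.tgt f)) : e = f := by
  by_contra hne
  have hcard := h {e, f} subset_rfl (Finset.insert_nonempty e _)
  have hf : P.src f ∈ P.fixed ∨ P.tgt f ∈ P.fixed := by
    rcases Sym2.eq_iff.1 hef with ⟨hs, ht⟩ | ⟨hs, ht⟩ <;> rw [hs, ht] at he
    exacts [he, he.symm]
  have hbal : P.MulBalanced j {e, f} := mulBalanced_of_forall_fixed (by
    simp only [Finset.mem_insert, Finset.mem_singleton]
    rintro _ (rfl | rfl)
    exacts [he, hf])
  have hverts : ∃ x, P.freeVerts {e, f} ⊆ {x} := by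
    simp only [freeVerts_subset_iff, Finset.mem_insert, Finset.mem_singleton]
    rcases he with he | he
    · exact ⟨P.tgt e, by grind⟩
    · exact ⟨P.src e, by grind⟩
  obtain ⟨x, hx⟩ := hverts
  have hle := Finset.card_le_card hx
  rw [Finset.card_pair hne] at hcard
  rw [Finset.card_singleton] at hle
  have hdefect := one_le_defect_of_mulBalanced hbal
  omega

theorem Indep.eq_of_sameArc (h : P.Indep j {e, f}) (hef : P.SameArc e f) : e = f := by
  classical
  by_cases hfix : P.src e ∈ P.fixed ∨ P.tgt e ∈ P.fixed
  · exact h.eq_of_fixed hfix hef.sym2_eq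
  by_contra hne
  have hends := Sym2.eq_iff.1 hef.sym2_eq
  have hcard := h {e, f} subset_rfl (Finset.insert_nonempty e _)
  rw [Finset.card_pair hne] at hcard
  have hpin : ¬ P.Pinned {e, f} := by
    rintro ⟨d, hd, hfixed⟩
    simp only [Finset.mem_insert, Finset.mem_singleton] at hd
    grind
  have hverts : P.freeVerts {e, f} ⊆ {P.src e, P.tgt e} := by
    simp only [freeVerts_subset_iff, Finset.mem_insert, Finset.mem_singleton]
    grind
  have hle := Finset.card_le_card hverts
  by_cases hloop : P.src e = P.tgt e
  · have hdefect := one_le_defect_of_splitBalanced (j := j) hpin (hef.splitBalanced hloop)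
    rw [← hloop, Finset.pair_eq_singleton, Finset.card_singleton] at hle
    omega
  · rw [defect_eq_three hpin ((hef.isPotential hloop).mulBalanced 1)] at hcard
    rw [Finset.card_pair hloop] at hle
    omega

/-- An independent pre-gain graph, with at most one fixed vertex, is a gain graph. -/
def toGainGraph {V U Γ : Type*} [CommGroup Γ] {j : ℤ} (P : PreGainGraph V U (Additive Γ))
    (hfix : P.fixed.Subsingleton) (h : ∀ F, P.Indep j F) : GainGraph V U Γ where
  src := P.src
  tgt := P.tgt
  gain e := (P.gain e).toMul
  fixed := P.fixed
  fixed_subsingleton := hfix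
  gain_ne_of_parallel _ _ hne hs ht hgain := by
    classical exact hne ((h _).eq_of_sameArc (.inl ⟨hs, ht, hgain⟩))
  gain_ne_of_antiparallel _ _ hne hs ht hgain := by
    classical exact hne ((h _).eq_of_sameArc (.inr ⟨hs, ht, hgain⟩))
  fixed_no_loop _ := (h _).src_ne_tgt_of_fixed
  fixed_no_parallel _ _ he hef := by classical exact (h _).eq_of_fixed he hef
  loop_gain_ne_one _ := (h _).loop_gain_ne_zero

end Parallel

end PreGainGraph

namespace GainGraph

section Star

variable {V E Γ : Type*} [Group Γ] {G : GainGraph V E Γ} {v : V} {s : Fin 3 → E × Bool}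

variable (G v s) in
/-- `s` lists the three edges at `v`, none of which is a loop, as steps that start at `v`. -/
structure IsStar : Prop where
  tail : ∀ i, G.tail (s i) = v
  head : ∀ i, G.head (s i) ≠ v
  inj : Function.Injective fun i => (s i).1
  complete : ∀ e, G.src e = v ∨ G.tgt e = v → ∃ i, (s i).1 = e

theorem exists_isStar [Fintype E] (hdeg : G.degree v = 3)
    (hloop : ∀ e, ¬ (G.src e = v ∧ G.tgt e = v)) : ∃ s, G.IsStar v s := by
  classical
  have hcard : (Finset.univ.filter fun e => G.src e = v ∨ G.tgt e = v).card = 3 := by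
    rw [Finset.filter_or, Finset.card_union_of_disjoint]
    · exact hdeg
    · exact Finset.disjoint_filter.2 fun e _ hsrc htgt => hloop e ⟨hsrc, htgt⟩
  let φ := (Finset.equivFinOfCardEq hcard).symm
  have hφ (i : Fin 3) : G.src (φ i) = v ∨ G.tgt (φ i) = v := (Finset.mem_filter.1 (φ i).2).2
  have hstep (e : E) (he : G.src e = v ∨ G.tgt e = v) :
      G.tail (e, decide (G.src e = v)) = v ∧ G.head (e, decide (G.src e = v)) ≠ v := by
    by_cases hsrc : G.src e = v
    · simp only [hsrc, decide_true]
      exact ⟨hsrc, fun htgt => hloop e ⟨hsrc, htgt⟩⟩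
    · simp only [hsrc, decide_false]
      exact ⟨he.resolve_left hsrc, hsrc⟩
  refine ⟨fun i => (φ i, decide (G.src (φ i) = v)), fun i => (hstep _ (hφ i)).1,
    fun i => (hstep _ (hφ i)).2, fun i i' h => φ.injective (Subtype.ext h), fun e he => ?_⟩
  exact ⟨φ.symm ⟨e, by simpa using he⟩, by simp⟩

theorem IsStar.incident (h : G.IsStar v s) (i : Fin 3) :
    G.src (s i).1 = v ∨ G.tgt (s i).1 = v := by
  have htail := h.tail i
  rcases hs : s i with ⟨e, _ | _⟩ <;> rw [hs] at htail
  exacts [.inr htail, .inl htail]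

/-- The three edges of a star. -/
def IsStar.edges (h : G.IsStar v s) : Finset E := Finset.univ.map ⟨_, h.inj⟩

theorem IsStar.mem_edges (h : G.IsStar v s) {e : E} :
    e ∈ h.edges ↔ G.src e = v ∨ G.tgt e = v := by
  simp only [edges, Finset.mem_map, Finset.mem_univ, true_and, Function.Embedding.coeFn_mk]
  constructor
  · rintro ⟨i, rfl⟩
    exact h.incident i
  · exact h.complete e

theorem IsStar.card_edges (h : G.IsStar v s) : h.edges.card = 3 := by
  rw [edges, Finset.card_map, Finset.card_univ, Fintype.card_fin]

theorem IsStar.reachable_head [Fintype E] (h : G.IsStar v s) (i : Fin 3) :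
    G.Reachable Finset.univ v (G.head (s i)) := by
  have hstep := reachable_step (G := G) (Finset.mem_univ (s i).1)
  rwa [h.tail] at hstep

end Star

section Reduction

variable {V E Γ : Type*} [CommGroup Γ] (G : GainGraph V E Γ) {v : V} {s : Fin 3 → E × Bool}

/-- The gain graph `G` together with the three edges that the possible 1-reductions at the star `s`
add: the `i`-th one joins the leaves `i + 1` and `i + 2`. -/
def withTriangle (s : Fin 3 → E × Bool) : PreGainGraph V (E ⊕ Fin 3) (Additive Γ) where
  src := Sum.elim G.src fun i => G.head (s (i + 1))
  tgt := Sum.elim G.tgt fun i => G.head (s (i + 2))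
  gain := Sum.elim (fun e => Additive.ofMul (G.gain e)) fun i =>
    Additive.ofMul ((G.stepGain (s (i + 1)))⁻¹ * G.stepGain (s (i + 2)))
  fixed := G.fixed

/-- The result of the 1-reduction at `v` that adds the `i`-th new edge, which need not be a gain
graph. -/
def reduction (h : G.IsStar v s) (i : Fin 3) :
    PreGainGraph {w : V // w ≠ v} (Option (G.EdgesAway v)) (Additive Γ) where
  src
    | some e => ⟨G.src e, e.2.1⟩
    | none => ⟨G.head (s (i + 1)), h.head _⟩
  tgt
    | some e => ⟨G.tgt e, e.2.2⟩
    | none => ⟨G.head (s (i + 2)), h.head _⟩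
  gain
    | some e => Additive.ofMul (G.gain e)
    | none => Additive.ofMul ((G.stepGain (s (i + 1)))⁻¹ * G.stepGain (s (i + 2)))
  fixed := {w | (w : V) ∈ G.fixed}

variable (v) in
/-- The edges of the `i`-th 1-reduction as edges of `G.withTriangle s`. -/
def reductionEdge (i : Fin 3) : Option (G.EdgesAway v) ↪ E ⊕ Fin 3 where
  toFun
    | some e => .inl e
    | none => .inr i
  inj' := by
    rintro (_ | e) (_ | f) hef
    exacts [rfl, absurd hef Sum.inr_ne_inl, absurd hef Sum.inl_ne_inr,
      congrArg some (Subtype.ext (Sum.inl_injective hef))]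

variable {G}

theorem embeds_inl : (G.withTriangle s).Embeds G.toPreGainGraph .inl (.refl V) where
  src _ := rfl
  tgt _ := rfl
  gain _ := rfl
  fixed _ := Iff.rfl

theorem embeds_reduction (h : G.IsStar v s) (i : Fin 3) :
    (G.withTriangle s).Embeds (G.reduction h i) (G.reductionEdge v i) (.subtype _) where
  src e := by cases e <;> rfl
  tgt e := by cases e <;> rfl
  gain e := by cases e <;> rfl
  fixed _ := Iff.rfl

/-- The edge set `X'` of a 1-reduction arises from edges in `X`: the new edge may only be used if
`X` contains the whole star. -/
def ArisesFrom (s : Fin 3 → E × Bool) (X' : Finset (Option (G.EdgesAway v))) (X : Finset E) :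
    Prop :=
  (∀ e, some e ∈ X' → e.1 ∈ X) ∧ (none ∈ X' → ∀ i, (s i).1 ∈ X)

theorem eq_of_arisesFrom {F X Y : Finset E} {X' : Finset (Option (G.EdgesAway v))}
    (hX : X ∈ G.components F) (hY : Y ∈ G.components F) (hne : X'.Nonempty)
    (hXX' : ArisesFrom s X' X) (hYX' : ArisesFrom s X' Y) : X = Y := by
  obtain ⟨f, hfX, hfY⟩ : ∃ f ∈ X, f ∈ Y := by
    obtain ⟨_ | e, he⟩ := hne
    · exact ⟨_, hXX'.2 he 0, hYX'.2 he 0⟩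
    · exact ⟨_, hXX'.1 e he, hYX'.1 e he⟩
  obtain ⟨a, -, rfl⟩ := mem_components.1 hX
  obtain ⟨b, -, rfl⟩ := mem_components.1 hY
  exact component_eq_of_reachable ((mem_component.1 hfX).2.trans (mem_component.1 hfY).2.symm)

end Reduction

section ReductionDefect

variable {V E Γ : Type*} [CommGroup Γ] {G : GainGraph V E Γ} {v : V} {s : Fin 3 → E × Bool}
  {i : Fin 3} {j m : ℤ} {X : Finset E} {X' : Finset (Option (G.EdgesAway v))}

theorem smul_stepGain_eq {p : V → Additive Γ}
    (hp : ∀ e ∈ X, G.src e ∉ G.fixed → G.tgt e ∉ G.fixed →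
      m • Additive.ofMul (G.gain e) = p (G.tgt e) - p (G.src e)) {t : E × Bool} (ht : t.1 ∈ X)
    (htail : G.tail t ∉ G.fixed) (hhead : G.head t ∉ G.fixed) :
    m • Additive.ofMul (G.stepGain t) = p (G.head t) - p (G.tail t) := by
  obtain ⟨e, _ | _⟩ := t
  · simp only [stepGain, head, tail, ofMul_inv, smul_neg, hp e ht hhead htail, neg_sub]
  · exact hp e ht htail hhead

theorem pinned_of_head_mem_fixed {t : E × Bool} (ht : t.1 ∈ X) (hhead : G.head t ∈ G.fixed) :
    G.toPreGainGraph.Pinned X := by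
  obtain ⟨e, _ | _⟩ := t
  exacts [⟨e, ht, .inl hhead⟩, ⟨e, ht, .inr hhead⟩]

theorem pinned_of_reduction (h : G.IsStar v s) (hX : ArisesFrom s X' X)
    (hpin : (G.reduction h i).Pinned X') : G.toPreGainGraph.Pinned X := by
  obtain ⟨_ | e, he, hfixed | hfixed⟩ := hpin
  exacts [pinned_of_head_mem_fixed (hX.2 he _) hfixed, pinned_of_head_mem_fixed (hX.2 he _) hfixed,
    ⟨e, hX.1 e he, .inl hfixed⟩, ⟨e, hX.1 e he, .inr hfixed⟩]

theorem mulBalanced_reduction (h : G.IsStar v s) (hv : v ∉ G.fixed) (hX : ArisesFrom s X' X)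
    (hbal : G.toPreGainGraph.MulBalanced m X) : (G.reduction h i).MulBalanced m X' := by
  obtain ⟨p, hp⟩ := hbal
  refine ⟨fun x => p x, ?_⟩
  rintro (_ | e) he hsrc htgt
  · have hstep₁ := smul_stepGain_eq hp (hX.2 he (i + 1)) (by rwa [h.tail]) hsrc
    have hstep₂ := smul_stepGain_eq hp (hX.2 he (i + 2)) (by rwa [h.tail]) htgt
    rw [h.tail] at hstep₁ hstep₂
    simp only [reduction, ofMul_mul, ofMul_inv, smul_add, smul_neg, hstep₁, hstep₂]
    abel
  · exact hp e (hX.1 e he) hsrc htgt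

theorem splitBalanced_reduction (h : G.IsStar v s) (hX : ArisesFrom s X' X)
    (hsplit : G.toPreGainGraph.SplitBalanced X) : (G.reduction h i).SplitBalanced X' := by
  classical
  obtain ⟨p, q, b, hpq, hexp⟩ := hsplit
  by_cases hb : b = v
  · -- The split vertex disappears, so one end of the new edge has to be split instead.
    subst hb
    refine ⟨fun x => p x, Function.update (fun x => p x) ((G.reduction h i).tgt none)
      (p ((G.reduction h i).src none) + (G.reduction h i).gain none), _,
      fun x hx => by rw [Function.update_of_ne hx], ?_⟩
    rintro (_ | e) he
    · exact ⟨_, _, .inl rfl, .inr rfl, by simp⟩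
    · refine ⟨_, _, .inl rfl, .inl rfl, ?_⟩
      exact PreGainGraph.IsSplitPotential.gain_eq ⟨hpq, hexp⟩ (hX.1 e he) e.2.1 e.2.2
  · refine ⟨fun x => p x, fun x => q x, ⟨b, hb⟩,
      fun x hx => hpq _ fun hxb => hx (Subtype.ext hxb), ?_⟩
    rintro (_ | e) he
    · obtain ⟨x₁, y₁, hx₁, hy₁, hgain₁⟩ := explains_iff_step.1 (hexp _ (hX.2 he (i + 1)))
      obtain ⟨x₂, y₂, hx₂, hy₂, hgain₂⟩ := explains_iff_step.1 (hexp _ (hX.2 he (i + 2)))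
      rw [h.tail, ← hpq v (Ne.symm hb), or_self] at hx₁ hx₂
      refine ⟨y₁, y₂, hy₁, hy₂, ?_⟩
      simp only [reduction, ofMul_mul, ofMul_inv, hgain₁, hgain₂, hx₁, hx₂]
      abel
    · exact hexp e (hX.1 e he)

theorem defect_le_reduction (h : G.IsStar v s) (hv : v ∉ G.fixed) (hX : ArisesFrom s X' X) :
    G.toPreGainGraph.defect j X ≤ (G.reduction h i).defect j X' := by
  have hpin (hX' : ¬ G.toPreGainGraph.Pinned X) : ¬ (G.reduction h i).Pinned X' :=
    mt (pinned_of_reduction h hX) hX'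
  have hcard : (G.toPreGainGraph.rigidTypes j X).card ≤
      ((G.reduction h i).rigidTypes j X').card := Finset.card_le_card fun i' hi' => by
    obtain ⟨hmem, hbal, hfree⟩ := PreGainGraph.mem_rigidTypes.1 hi'
    exact PreGainGraph.mem_rigidTypes.2
      ⟨hmem, mulBalanced_reduction h hv hX hbal, hfree.imp_right hpin⟩
  replace hcard := hcard.trans PreGainGraph.card_rigidTypes_le_defect
  by_cases hsplit : ¬ G.toPreGainGraph.Pinned X ∧ G.toPreGainGraph.SplitBalanced X
  · rw [PreGainGraph.defect, if_pos hsplit]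
    exact max_le hcard (PreGainGraph.one_le_defect_of_splitBalanced (hpin hsplit.1)
      (splitBalanced_reduction h hX hsplit.2))
  · rwa [PreGainGraph.defect_of_not_splitBalanced hsplit]

end ReductionDefect

section ReductionCount

variable {V E Γ : Type*} [CommGroup Γ] {G : GainGraph V E Γ} {v : V} {s : Fin 3 → E × Bool}
  {i : Fin 3} {j : ℤ} [Fintype E] [Fintype (Option (G.EdgesAway v))]
  {G' : GainGraph {w : V // w ≠ v} (Option (G.EdgesAway v)) Γ}

theorem reachable_of_reduction (h : G.IsStar v s) (hG' : G'.toPreGainGraph = G.reduction h i)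
    {x y : {w : V // w ≠ v}} (hxy : G'.Reachable Finset.univ x y) :
    G.Reachable Finset.univ (x : V) y := by
  have hsrc : G'.src = (G.reduction h i).src := congrArg PreGainGraph.src hG'
  have htgt : G'.tgt = (G.reduction h i).tgt := congrArg PreGainGraph.tgt hG'
  have hnew := (h.reachable_head (i + 1)).symm.trans (h.reachable_head (i + 2))
  obtain ⟨g, hg⟩ := reachable_iff.1 hxy
  refine hg.induction (motive := fun _ (y : {w : V // w ≠ v}) => G.Reachable Finset.univ (x : V) y)
    .refl ?_
  rintro g ⟨_ | e, _ | _⟩ - hreach - - <;> refine hreach.trans ?_ <;>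
    simp only [tail, head, hsrc, htgt]
  exacts [hnew.symm, hnew, (reachable_edge (Finset.mem_univ e.1)).symm,
    reachable_edge (Finset.mem_univ e.1)]

theorem arisesFrom_component (h : G.IsStar v s) (hG' : G'.toPreGainGraph = G.reduction h i)
    {e : E} {e' : Option (G.EdgesAway v)}
    (hreach : G.Reachable Finset.univ (G.src e) ((G.reduction h i).src e')) :
    ArisesFrom s (G'.component Finset.univ e') (G.component Finset.univ e) := by
  have hsrc : G'.src = (G.reduction h i).src := congrArg PreGainGraph.src hG'
  have hmem {f : Option (G.EdgesAway v)} (hf : f ∈ G'.component Finset.univ e') :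
      G.Reachable Finset.univ (G.src e) ((G.reduction h i).src f) := by
    have hf' := reachable_of_reduction h hG' (mem_component.1 hf).2
    rw [hsrc] at hf'
    exact hreach.trans hf'
  refine ⟨fun f hf => mem_component.2 ⟨Finset.mem_univ _, hmem hf⟩, fun hnone i' => ?_⟩
  refine mem_component_of_step (Finset.mem_univ _) ?_
  rw [h.tail]
  exact (hmem hnone).trans (h.reachable_head (i + 1)).symm

theorem exists_component_arisesFrom (h : G.IsStar v s)
    (hG' : G'.toPreGainGraph = G.reduction h i) {X : Finset E}
    (hX : X ∈ G.components Finset.univ) :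
    ∃ X' ∈ G'.components Finset.univ, X'.Nonempty ∧ ArisesFrom s X' X := by
  suffices hreach : ∃ e', ∃ e ∈ Finset.univ, G.component Finset.univ e = X ∧
      G.Reachable Finset.univ (G.src e) ((G.reduction h i).src e') by
    obtain ⟨e', e, -, rfl, hreach⟩ := hreach
    exact ⟨_, component_mem_components (Finset.mem_univ e'),
      ⟨e', self_mem_component (Finset.mem_univ _)⟩, arisesFrom_component h hG' hreach⟩
  obtain ⟨e, he, hX⟩ := mem_components.1 hX
  by_cases hv : G.Reachable Finset.univ (G.src e) v
  · exact ⟨none, e, he, hX, hv.trans (h.reachable_head (i + 1))⟩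
  · have hsrc : G.src e ≠ v := fun hsrc => hv (hsrc ▸ .refl)
    have htgt : G.tgt e ≠ v := fun htgt => hv (htgt ▸ reachable_edge he)
    exact ⟨some ⟨e, hsrc, htgt⟩, e, he, hX, .refl⟩

theorem sum_defect_le_reduction (h : G.IsStar v s) (hv : v ∉ G.fixed)
    (hG' : G'.toPreGainGraph = G.reduction h i) :
    ∑ X ∈ G.components Finset.univ, (G.toPreGainGraph.defect j X : ℤ) ≤
      ∑ X ∈ G'.components Finset.univ, (G'.toPreGainGraph.defect j X : ℤ) := by
  classical
  choose! φ hφ hne harises using fun X hX => exists_component_arisesFrom h hG' (X := X) hX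
  have hinj : Set.InjOn φ (G.components Finset.univ) := fun X hX Y hY hXY =>
    eq_of_arisesFrom hX hY (hne X hX) (harises X hX) (hXY ▸ harises Y hY)
  calc _ ≤ ∑ X ∈ G.components Finset.univ, (G'.toPreGainGraph.defect j (φ X) : ℤ) :=
        Finset.sum_le_sum fun X hX => by
          rw [hG']
          exact_mod_cast defect_le_reduction h hv (harises X hX)
    _ = ∑ X' ∈ (G.components Finset.univ).image φ, (G'.toPreGainGraph.defect j X' : ℤ) :=
        (Finset.sum_image (f := fun X' => (G'.toPreGainGraph.defect j X' : ℤ)) hinj).symm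
    _ ≤ _ := Finset.sum_le_sum_of_subset_of_nonneg (Finset.image_subset_iff.2 hφ)
        fun _ _ _ => Int.natCast_nonneg _

theorem card_freeVerts_reduction_lt (h : G.IsStar v s) (hv : v ∉ G.fixed) :
    ((G.reduction h i).freeVerts Finset.univ).card <
      (G.toPreGainGraph.freeVerts Finset.univ).card := by
  classical
  have hmem : v ∈ G.toPreGainGraph.freeVerts Finset.univ :=
    PreGainGraph.mem_freeVerts.2 ⟨⟨_, Finset.mem_univ _, h.incident 0⟩, hv⟩
  have hhead (t : E × Bool) (ht : G.head t ∉ G.fixed) :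
      G.head t ∈ G.toPreGainGraph.freeVerts Finset.univ := by
    obtain ⟨e, _ | _⟩ := t
    exacts [PreGainGraph.src_mem_freeVerts (P := G.toPreGainGraph) (Finset.mem_univ e) ht,
      PreGainGraph.tgt_mem_freeVerts (P := G.toPreGainGraph) (Finset.mem_univ e) ht]
  have hsub : ((G.reduction h i).freeVerts Finset.univ).map (.subtype _) ⊆
      (G.toPreGainGraph.freeVerts Finset.univ).erase v := by
    intro _ hmap
    obtain ⟨x, hx, rfl⟩ := Finset.mem_map.1 hmap
    refine Finset.mem_erase.2 ⟨x.2, ?_⟩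
    obtain ⟨⟨_ | e, -, rfl | rfl⟩, hx⟩ := PreGainGraph.mem_freeVerts.1 hx
    exacts [hhead _ hx, hhead _ hx, hhead (e, false) hx, hhead (e, true) hx]
  have hle := Finset.card_le_card hsub
  rw [Finset.card_map, Finset.card_erase_of_mem hmem] at hle
  have hpos := Finset.card_pos.2 ⟨v, hmem⟩
  omega

theorem card_edges_reduction (h : G.IsStar v s) :
    Fintype.card (Option (G.EdgesAway v)) + 2 = Fintype.card E := by
  classical
  have hstar : (Finset.univ.filter fun e => ¬ (G.src e ≠ v ∧ G.tgt e ≠ v)) = h.edges := by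
    ext e
    simp only [Finset.mem_filter, Finset.mem_univ, true_and, h.mem_edges, not_and_or, not_not]
  have hcard := Finset.card_filter_add_card_filter_not (s := (Finset.univ : Finset E))
    fun e => G.src e ≠ v ∧ G.tgt e ≠ v
  rw [hstar, h.card_edges, ← Fintype.card_subtype, Finset.card_univ] at hcard
  rw [← hcard, ← Nat.card_eq_fintype_card, Finite.card_option, Nat.card_eq_fintype_card]

end ReductionCount

section Admissible

variable {V E Γ : Type*} [CommGroup Γ] {G : GainGraph V E Γ} {v : V} {s : Fin 3 → E × Bool}
  {i : Fin 3} {j k : ℕ} [Fintype E] [Finite Γ] [IsCyclic Γ]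

theorem gainTight_reduction [Fintype (Option (G.EdgesAway v))]
    {G' : GainGraph {w : V // w ≠ v} (Option (G.EdgesAway v)) Γ} (hk : Nat.card Γ = k)
    (hG : G.GainTight k j) (h : G.IsStar v s) (hv : v ∉ G.fixed)
    (hG' : G'.toPreGainGraph = G.reduction h i) (hindep : ∀ F, G'.toPreGainGraph.Indep j F) :
    G'.GainTight k j := by
  have hsparse := gainSparse_of_indep hk hindep
  refine ⟨hsparse, le_antisymm (hsparse Finset.univ ⟨none, Finset.mem_univ _⟩) ?_⟩
  have htight := hG.2
  rw [count_eq hk] at htight ⊢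
  have hdefect := sum_defect_le_reduction (j := j) h hv hG'
  have hverts := card_freeVerts_reduction_lt (i := i) h hv
  have hedges := card_edges_reduction h
  rw [← hG'] at hverts
  omega

theorem hasAdmissibleOneReduction_of_indep (hk : Nat.card Γ = k) (hG : G.GainTight k j)
    (h : G.IsStar v s) (hv : v ∉ G.fixed) (hdeg : G.degree v = 3)
    (hloop : ∀ e, ¬ (G.src e = v ∧ G.tgt e = v))
    {I : Finset (E ⊕ Fin 3)} (hI : (G.withTriangle s).Indep j I) (hi : Sum.inr i ∈ I)
    (haway : ∀ e, G.src e ≠ v ∧ G.tgt e ≠ v → Sum.inl e ∈ I) :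
    G.HasAdmissibleOneReduction k j v := by
  classical
  have hindep (F : Finset (Option (G.EdgesAway v))) : (G.reduction h i).Indep j F := by
    refine (embeds_reduction h i).indep_map.1 (hI.subset fun f hf => ?_)
    obtain ⟨_ | e, -, rfl⟩ := Finset.mem_map.1 hf
    exacts [hi, haway e.1 e.2]
  have hfix : (G.reduction h i).fixed.Subsingleton := fun x hx y hy =>
    Subtype.ext (G.fixed_subsingleton hx hy)
  have hne : (s (i + 1)).1 ≠ (s (i + 2)).1 := h.inj.ne (by omega)
  exact ⟨(G.reduction h i).toGainGraph hfix hindep, ⟨hv, hdeg, hloop, fun _ => Iff.rfl,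
    fun e => ⟨rfl, rfl, rfl⟩, s (i + 1), s (i + 2), hne, h.tail _, h.tail _, rfl, rfl, rfl⟩,
    gainTight_reduction hk hG h hv (i := i) rfl hindep⟩

end Admissible

end GainGraph

namespace PreGainGraph

section Small

variable {V U Γ : Type*} [AddCommGroup Γ] {P : PreGainGraph V U Γ} {j m : ℤ} {e f : U}
  {F I : Finset U}

theorem indep_of_forall_erase [DecidableEq U] (h : ∀ e ∈ I, P.Indep j (I.erase e))
    (hcount : I.card + P.defect j I ≤ 2 * (P.freeVerts I).card) : P.Indep j I := by
  intro F hF hne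
  rcases hF.eq_or_ssubset with rfl | hss
  · exact hcount
  · obtain ⟨e, he, heF⟩ := Finset.exists_of_ssubset hss
    exact h e he F (Finset.subset_erase.2 ⟨hF, heF⟩) hne

theorem indep_singleton (hcount : 1 + P.defect j {e} ≤ 2 * (P.freeVerts {e}).card) :
    P.Indep j {e} := by
  classical
  refine indep_of_forall_erase (fun f hf => ?_) (by rwa [Finset.card_singleton])
  rw [Finset.mem_singleton.1 hf, Finset.erase_singleton]
  exact indep_empty

theorem indep_pair [DecidableEq U] (hef : e ≠ f) (he : P.Indep j {e}) (hf : P.Indep j {f})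
    (hcount : 2 + P.defect j {e, f} ≤ 2 * (P.freeVerts {e, f}).card) : P.Indep j {e, f} := by
  refine indep_of_forall_erase ?_ (by rwa [Finset.card_pair hef])
  simp only [Finset.mem_insert, Finset.mem_singleton]
  rintro _ (rfl | rfl)
  · exact hf.subset (by grind)
  · exact he.subset (by grind)

theorem two_le_card_freeVerts {V U Γ : Type*} {P : PreGainGraph V U Γ} {F : Finset U} {x y : V}
    (hxy : x ≠ y) (hx : x ∈ P.freeVerts F) (hy : y ∈ P.freeVerts F) :
    2 ≤ (P.freeVerts F).card :=
  Finset.one_lt_card.2 ⟨x, hx, y, hy, hxy⟩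

theorem defect_le_one_of_pinned (hpin : P.Pinned F) : P.defect j F ≤ 1 := by
  classical
  rw [defect_of_pinned hpin]
  split_ifs <;> omega

theorem smul_gain_eq_zero (h : P.MulBalanced m F) (he : e ∈ F) (hloop : P.src e = P.tgt e)
    (hfree : P.src e ∉ P.fixed) : m • P.gain e = 0 := by
  obtain ⟨p, hp⟩ := h
  rw [hp e he hfree (hloop ▸ hfree), hloop, sub_self]

theorem defect_le_one_of_loop (he : e ∈ F) (hloop : P.src e = P.tgt e)
    (hfree : P.src e ∉ P.fixed) (hgain : P.gain e ≠ 0) (htwo : Odd j → 2 • P.gain e ≠ 0) :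
    P.defect j F ≤ 1 := by
  have hcard : (P.rigidTypes j F).card ≤ 1 := by
    refine card_rigidTypes_le_one_of_dvd (d := addOrderOf (P.gain e)) (fun m hm => ?_)
      (mt AddMonoid.addOrderOf_eq_one_iff.1 hgain) fun ⟨hodd, horder⟩ => htwo hodd ?_
    · exact addOrderOf_dvd_iff_zsmul_eq_zero.2 (smul_gain_eq_zero hm he hloop hfree)
    · rw [← horder]
      exact addOrderOf_nsmul_eq_zero _
  unfold defect
  split_ifs
  exacts [max_le hcard le_rfl, hcard]

theorem indep_singleton_of_loop (hloop : P.src e = P.tgt e) (hfree : P.src e ∉ P.fixed)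
    (hgain : P.gain e ≠ 0) (htwo : Odd j → 2 • P.gain e ≠ 0) : P.Indep j {e} := by
  have hmem := Finset.mem_singleton_self e
  have hdefect := defect_le_one_of_loop hmem hloop hfree hgain htwo
  have hpos := Finset.card_pos.2 ⟨_, src_mem_freeVerts hmem hfree⟩
  exact indep_singleton (by omega)

theorem indep_singleton_of_ne (hfix : P.fixed.Subsingleton) (hne : P.src e ≠ P.tgt e) :
    P.Indep j {e} := by
  refine indep_singleton ?_
  have hmem := Finset.mem_singleton_self e
  by_cases hsrc : P.src e ∈ P.fixed
  · have htgt : P.tgt e ∉ P.fixed := fun htgt => hne (hfix hsrc htgt)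
    have hdefect := defect_le_one_of_pinned (j := j) ⟨e, hmem, .inl hsrc⟩
    have hpos := Finset.card_pos.2 ⟨_, tgt_mem_freeVerts hmem htgt⟩
    omega
  · by_cases htgt : P.tgt e ∈ P.fixed
    · have hdefect := defect_le_one_of_pinned (j := j) ⟨e, hmem, .inr htgt⟩
      have hpos := Finset.card_pos.2 ⟨_, src_mem_freeVerts hmem hsrc⟩
      omega
    · have hdefect := defect_le_three (P := P) (j := j) (F := {e})
      have htwo := two_le_card_freeVerts hne (src_mem_freeVerts hmem hsrc)
        (tgt_mem_freeVerts hmem htgt)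
      omega

theorem SplitBalanced.gain_eq_or_eq_neg (h : P.SplitBalanced F) (he : e ∈ F) (hf : f ∈ F)
    (hloop : P.src e = P.tgt e) (hsrc : P.src f = P.src e) (htgt : P.tgt f = P.src e)
    (hgain : P.gain e ≠ 0) (hgain' : P.gain f ≠ 0) :
    P.gain e = P.gain f ∨ P.gain e = - P.gain f := by
  obtain ⟨p, q, b, -, hexp⟩ := h
  obtain ⟨x, y, hx, hy, hxy⟩ := hexp e he
  obtain ⟨z, w, hz, hw, hzw⟩ := hexp f hf
  rw [← hloop] at hy
  rw [hsrc] at hz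
  rw [htgt] at hw
  rcases hx with rfl | rfl <;> rcases hy with rfl | rfl <;> rcases hz with rfl | rfl <;>
    rcases hw with rfl | rfl <;> simp_all

end Small

end PreGainGraph

section SideGain

variable {Γ : Type*} [AddCommGroup Γ] {g : Fin 3 → Γ} {e f : Fin 3} {j : ℤ}

theorem add_add_fin_three (i : Fin 3) :
    i + 1 + 1 = i + 2 ∧ i + 1 + 2 = i ∧ i + 2 + 1 = i ∧ i + 2 + 2 = i + 1 := by
  omega

theorem eq_or_eq_add_fin_three (i e : Fin 3) : e = i ∨ e = i + 1 ∨ e = i + 2 := by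
  omega

/-- The gain of the side opposite to the corner `i` of a triangle, if `g` lists the gains of edges
from an apex to the corners. -/
def sideGain (g : Fin 3 → Γ) (i : Fin 3) : Γ := g (i + 2) - g (i + 1)

theorem sideGain_add_sideGain_add_sideGain (g : Fin 3 → Γ) (i : Fin 3) :
    sideGain g i + sideGain g (i + 1) + sideGain g (i + 2) = 0 := by
  simp only [sideGain, add_add_fin_three]
  abel

theorem exists_sideGain_add_sideGain_add (g : Fin 3 → Γ) (hef : e ≠ f) :
    ∃ i, (∀ x, x = e ∨ x = f ∨ x = i) ∧ sideGain g e + sideGain g f + sideGain g i = 0 := by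
  rcases (eq_or_eq_add_fin_three e f).resolve_left hef.symm with rfl | rfl
  · exact ⟨e + 2, eq_or_eq_add_fin_three e, sideGain_add_sideGain_add_sideGain g e⟩
  · refine ⟨e + 1, fun x => by omega, ?_⟩
    rw [add_right_comm]
    exact sideGain_add_sideGain_add_sideGain g e

theorem smul_sideGain_eq_zero {m : ℤ} (hef : e ≠ f) (he : m • sideGain g e = 0)
    (hf : m • sideGain g f = 0) (x : Fin 3) : m • sideGain g x = 0 := by
  obtain ⟨i, hcases, hsum⟩ := exists_sideGain_add_sideGain_add g hef
  have hi := congrArg (m • ·) hsum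
  simp only [smul_add, he, hf, zero_add, smul_zero] at hi
  rcases hcases x with rfl | rfl | rfl
  exacts [he, hf, hi]

theorem sideGain_add_sideGain_ne_zero (hg : ∀ i, sideGain g i ≠ 0) (hef : e ≠ f) :
    sideGain g e + sideGain g f ≠ 0 := fun h => by
  obtain ⟨i, -, hsum⟩ := exists_sideGain_add_sideGain_add g hef
  rw [h, zero_add] at hsum
  exact hg i hsum

theorem two_smul_sideGain_ne_zero
    (hinv : ∀ x y : Γ, 2 • x = 0 → 2 • y = 0 → x ≠ 0 → y ≠ 0 → x = y)
    (hg : ∀ i, sideGain g i ≠ 0) (hef : e ≠ f) (he : 2 • sideGain g e = 0) :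
    2 • sideGain g f ≠ 0 := fun hf => by
  refine sideGain_add_sideGain_ne_zero hg hef ?_
  rwa [← hinv _ _ he hf (hg e) (hg f), ← two_nsmul]

theorem exists_four_dvd_add (hodd : Odd j) : ∃ i ∈ ({-1, 0, 1} : Finset ℤ), 4 ∣ j + i := by
  rw [Int.odd_iff] at hodd
  rcases (by omega : 4 ∣ j + -1 ∨ 4 ∣ j + 1) with h | h
  exacts [⟨_, by decide, h⟩, ⟨_, by decide, h⟩]

theorem exists_three_dvd_add (j : ℤ) : ∃ i ∈ ({-1, 0, 1} : Finset ℤ), 3 ∣ j + i := by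
  rcases (by omega : 3 ∣ j + -1 ∨ 3 ∣ j + 0 ∨ 3 ∣ j + 1) with h | h | h
  exacts [⟨_, by decide, h⟩, ⟨_, by decide, h⟩, ⟨_, by decide, h⟩]

theorem smul_eq_zero_of_dvd {d m : ℤ} {x : Γ} (hdvd : d ∣ m) (hx : d • x = 0) : m • x = 0 := by
  obtain ⟨c, rfl⟩ := hdvd
  rw [mul_comm, mul_smul, hx, smul_zero]

theorem sideGain_add_one_ne_sideGain_add_two {i : Fin 3} (hodd : Odd j)
    (htwo : 2 • sideGain g i = 0)
    (hkill : ∀ i ∈ ({-1, 0, 1} : Finset ℤ), ∃ e, (j + i) • sideGain g e ≠ 0) :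
    sideGain g (i + 1) ≠ sideGain g (i + 2) := fun heq => by
  have hsum := sideGain_add_sideGain_add_sideGain g i
  rw [← heq, add_assoc, ← two_nsmul] at hsum
  have hi : (4 : ℤ) • sideGain g i = 0 := by
    rw [show (4 : ℤ) = 2 * 2 by norm_num, mul_smul, two_zsmul, two_zsmul, ← two_nsmul, ← two_nsmul,
      htwo, smul_zero]
  have hnext : (4 : ℤ) • sideGain g (i + 1) = 0 := by
    have hdouble := congrArg (2 • ·) hsum
    simp only [smul_add, htwo, zero_add, smul_smul, smul_zero] at hdouble
    exact_mod_cast hdouble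
  obtain ⟨c, hc, hdvd⟩ := exists_four_dvd_add hodd
  obtain ⟨e, he⟩ := hkill c hc
  exact he (smul_eq_zero_of_dvd hdvd (smul_sideGain_eq_zero (by omega) hi hnext e))

theorem exists_sideGain_ne_sideGain
    (hkill : ∀ i ∈ ({-1, 0, 1} : Finset ℤ), ∃ e, (j + i) • sideGain g e ≠ 0) :
    ∃ e f, sideGain g e ≠ sideGain g f := by
  by_contra! heq
  obtain ⟨c, hc, hdvd⟩ := exists_three_dvd_add j
  obtain ⟨e, he⟩ := hkill c hc
  refine he (smul_eq_zero_of_dvd hdvd ?_)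
  rw [← sideGain_add_sideGain_add_sideGain g e, heq (e + 1) e, heq (e + 2) e]
  abel

theorem exists_two_sideGains (hinv : ∀ x y : Γ, 2 • x = 0 → 2 • y = 0 → x ≠ 0 → y ≠ 0 → x = y)
    (hg : ∀ i, sideGain g i ≠ 0)
    (hkill : ∀ i ∈ ({-1, 0, 1} : Finset ℤ), ∃ e, (j + i) • sideGain g e ≠ 0) :
    ∃ e f, sideGain g e ≠ sideGain g f ∧ (Odd j → 2 • sideGain g e ≠ 0) ∧
      (Odd j → 2 • sideGain g f ≠ 0) := by
  by_cases hexc : Odd j ∧ ∃ i, 2 • sideGain g i = 0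
  · obtain ⟨hodd, i, hi⟩ := hexc
    exact ⟨i + 1, i + 2, sideGain_add_one_ne_sideGain_add_two hodd hi hkill,
      fun _ => two_smul_sideGain_ne_zero hinv hg (by omega) hi,
      fun _ => two_smul_sideGain_ne_zero hinv hg (by omega) hi⟩
  · obtain ⟨e, f, hne⟩ := exists_sideGain_ne_sideGain hkill
    exact ⟨e, f, hne, fun hodd h => hexc ⟨hodd, e, h⟩, fun hodd h => hexc ⟨hodd, f, h⟩⟩

end SideGain

namespace PreGainGraph

section Triangle

variable {V Γ : Type*} [AddCommGroup Γ] {B : Set V} {n : Fin 3 → V} {g : Fin 3 → Γ}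
  {j : ℤ} {i : Fin 3}

variable (B n g) in
/-- The triangle with the corners `n i`, the gains `sideGain g i` and the set `B` of fixed vertices.
Its edge `i` is the side opposite to the corner `i`. -/
def triangle : PreGainGraph V (Fin 3) Γ where
  src i := n (i + 1)
  tgt i := n (i + 2)
  gain := sideGain g
  fixed := B

theorem exists_add_eq_of_two_le_card {F : Finset (Fin 3)} (hF : 2 ≤ F.card) (i : Fin 3) :
    ∃ e ∈ F, e + 1 = i ∨ e + 2 = i := by
  obtain ⟨e, he, hei⟩ := Finset.exists_mem_ne hF i
  exact ⟨e, he, by omega⟩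

theorem mem_freeVerts_triangle {F : Finset (Fin 3)} (hF : 2 ≤ F.card) (hi : n i ∉ B) :
    n i ∈ (triangle B n g).freeVerts F := by
  obtain ⟨e, he, hend⟩ := exists_add_eq_of_two_le_card hF i
  exact mem_freeVerts.2 ⟨⟨e, he, hend.imp (congrArg n) (congrArg n)⟩, hi⟩

theorem pinned_triangle {F : Finset (Fin 3)} (hF : 2 ≤ F.card) (hi : n i ∈ B) :
    (triangle B n g).Pinned F := by
  obtain ⟨e, he, rfl | rfl⟩ := exists_add_eq_of_two_le_card hF i
  exacts [⟨e, he, .inl hi⟩, ⟨e, he, .inr hi⟩]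

theorem card_le_card_freeVerts_triangle [DecidablePred (· ∉ B)] {F : Finset (Fin 3)}
    (hF : 2 ≤ F.card) (hn : Function.Injective n) :
    (Finset.univ.filter fun i => n i ∉ B).card ≤ ((triangle B n g).freeVerts F).card := by
  classical
  rw [← Finset.card_image_of_injective _ hn]
  refine Finset.card_le_card (Finset.image_subset_iff.2 fun i hi => ?_)
  exact mem_freeVerts_triangle hF (Finset.mem_filter.1 hi).2

theorem indep_triangle_of_injective (hB : B.Subsingleton) (hn : Function.Injective n)
    (I : Finset (Fin 3)) : (triangle B n g).Indep j I := by
  classical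
  intro F _ hne
  rcases Nat.lt_or_ge F.card 2 with hF | hF
  · obtain ⟨e, rfl⟩ := Finset.card_eq_one.1 (Nat.le_antisymm (by omega) hne.card_pos)
    exact indep_singleton_of_ne hB (hn.ne (by omega)) _ subset_rfl hne
  · have hthree : F.card ≤ 3 := Finset.card_le_univ F
    have hcard := card_le_card_freeVerts_triangle (B := B) (g := g) hF hn
    have hsplit := Finset.card_filter_add_card_filter_not (s := (Finset.univ : Finset (Fin 3)))
      fun i => n i ∉ B
    rw [Finset.card_univ, Fintype.card_fin] at hsplit
    by_cases hpin : ∃ i, n i ∈ B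
    · obtain ⟨i, hi⟩ := hpin
      have hdefect := defect_le_one_of_pinned (j := j) (pinned_triangle (g := g) hF hi)
      have hle : (Finset.univ.filter fun i => ¬ n i ∉ B).card ≤ 1 :=
        Finset.card_le_one.2 fun a ha b hb => hn (hB (by simpa using ha) (by simpa using hb))
      omega
    · have hzero : (Finset.univ.filter fun i => ¬ n i ∉ B).card = 0 := by
        rw [Finset.card_eq_zero, Finset.filter_eq_empty_iff]
        exact fun i _ h => hpin ⟨i, not_not.1 h⟩
      have hdefect := defect_le_three (P := triangle B n g) (j := j) (F := F)
      omega

theorem indep_triangle_add_one (hB : B.Subsingleton) (hn : n (i + 1) = n (i + 2))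
    (hi : n i ≠ n (i + 1)) : (triangle B n g).Indep j {i + 1} := by
  refine indep_singleton_of_ne hB ?_
  simp only [triangle, add_add_fin_three, ← hn]
  exact hi.symm

theorem indep_triangle_add_two (hB : B.Subsingleton) (hi : n i ≠ n (i + 1)) :
    (triangle B n g).Indep j {i + 2} := by
  refine indep_singleton_of_ne hB ?_
  simp only [triangle, add_add_fin_three]
  exact hi

theorem two_le_card_freeVerts_triangle {F : Finset (Fin 3)} (hF : 2 ≤ F.card)
    (hnext : n (i + 1) ∉ B) (hi : n i ≠ n (i + 1)) (hfree : n i ∉ B) :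
    2 ≤ ((triangle B n g).freeVerts F).card :=
  two_le_card_freeVerts hi (mem_freeVerts_triangle hF hfree) (mem_freeVerts_triangle hF hnext)

theorem indep_triangle_parallel (hB : B.Subsingleton) (hn : n (i + 1) = n (i + 2))
    (hnext : n (i + 1) ∉ B) (hi : n i ≠ n (i + 1)) (hfree : n i ∉ B) (hgain : sideGain g i ≠ 0) :
    (triangle B n g).Indep j {i + 1, i + 2} := by
  have hne : i + 1 ≠ i + 2 := by omega
  refine indep_pair hne (indep_triangle_add_one hB hn hi) (indep_triangle_add_two hB hi) ?_
  have htwo := two_le_card_freeVerts_triangle (g := g) (Finset.card_pair hne).ge hnext hi hfree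
  have hle := defect_le_three (P := triangle B n g) (j := j) (F := {i + 1, i + 2})
  have hne_three : (triangle B n g).defect j {i + 1, i + 2} ≠ 3 := by
    intro hthree
    obtain ⟨-, p, hp⟩ := defect_eq_three_iff.1 hthree
    have hp₁ := hp (i + 1) (by simp)
    have hp₂ := hp (i + 2) (by simp)
    simp only [triangle, add_add_fin_three, ← hn, one_smul] at hp₁ hp₂
    have hsum := sideGain_add_sideGain_add_sideGain g i
    rw [hp₁ hnext hfree, hp₂ hfree hnext, add_assoc, sub_add_sub_cancel, sub_self, add_zero] at hsum
    exact hgain hsum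
  omega

theorem indep_triangle_univ (hB : B.Subsingleton) (hn : n (i + 1) = n (i + 2))
    (hnext : n (i + 1) ∉ B) (hi : n i ≠ n (i + 1)) (hfree : n i ∉ B) (hgain : sideGain g i ≠ 0)
    (htwo : Odd j → 2 • sideGain g i ≠ 0) : (triangle B n g).Indep j Finset.univ := by
  have hdefect {F : Finset (Fin 3)} (hF : i ∈ F) : (triangle B n g).defect j F ≤ 1 :=
    defect_le_one_of_loop hF hn hnext hgain htwo
  have hverts {F : Finset (Fin 3)} (hF : 2 ≤ F.card) : 2 ≤ ((triangle B n g).freeVerts F).card :=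
    two_le_card_freeVerts_triangle hF hnext hi hfree
  have hpair {f : Fin 3} (hf : i ≠ f) (hI : (triangle B n g).Indep j {f}) :
      (triangle B n g).Indep j {i, f} := by
    refine indep_pair hf (indep_singleton_of_loop hn hnext hgain htwo) hI ?_
    have hle := hdefect (Finset.mem_insert_self i {f})
    have hge := hverts (Finset.card_pair hf).ge
    omega
  have herase (e f₁ f₂ : Fin 3) (h : ∀ f, f = e ∨ f = f₁ ∨ f = f₂) :
      Finset.univ.erase e ⊆ {f₁, f₂} := fun f hf => by
    rw [Finset.mem_insert, Finset.mem_singleton]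
    exact (h f).resolve_left (Finset.ne_of_mem_erase hf)
  refine indep_of_forall_erase (fun e _ => ?_) ?_
  · rcases eq_or_eq_add_fin_three i e with rfl | rfl | rfl
    · exact (indep_triangle_parallel hB hn hnext hi hfree hgain).subset
        (herase _ _ _ fun f => by omega)
    · exact (hpair (by omega) (indep_triangle_add_two hB hi)).subset
        (herase _ _ _ fun f => by omega)
    · exact (hpair (by omega) (indep_triangle_add_one hB hn hi)).subset
        (herase _ _ _ fun f => by omega)
  · have hle := hdefect (Finset.mem_univ i)
    have hge := hverts (F := Finset.univ) (by decide)
    rw [Finset.card_univ, Fintype.card_fin]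
    omega

theorem indep_triangle_loop_pinned (hB : B.Subsingleton) (hn : n (i + 1) = n (i + 2))
    (hnext : n (i + 1) ∉ B) (hi : n i ≠ n (i + 1)) (hfixed : n i ∈ B)
    (hgain : j • sideGain g i ≠ 0) (htwo : Odd j → 2 • sideGain g i ≠ 0) :
    (triangle B n g).Indep j {i, i + 1} := by
  classical
  have hne : i ≠ i + 1 := by omega
  have hgain' : sideGain g i ≠ 0 := fun h => hgain (by rw [h, smul_zero])
  refine indep_pair hne (indep_singleton_of_loop hn hnext hgain' htwo)
    (indep_triangle_add_one hB hn hi) ?_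
  have hbal : ¬ (triangle B n g).MulBalanced j {i, i + 1} := fun h =>
    hgain (smul_gain_eq_zero h (Finset.mem_insert_self _ _) hn hnext)
  rw [defect_of_pinned (pinned_triangle (Finset.card_pair hne).ge hfixed), if_neg hbal]
  have hpos := Finset.card_pos.2
    ⟨_, mem_freeVerts_triangle (g := g) (Finset.card_pair hne).ge hnext⟩
  omega

theorem defect_triangle_two_loops {x : V} (hn : ∀ i, n i = x) (hx : x ∉ B)
    (hg : ∀ i, sideGain g i ≠ 0)
    (hkill : ∀ i ∈ ({-1, 0, 1} : Finset ℤ), ∃ e, (j + i) • sideGain g e ≠ 0)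
    {e f : Fin 3} (hne : sideGain g e ≠ sideGain g f) :
    (triangle B n g).defect j {e, f} = 0 := by
  have hef : e ≠ f := fun h => hne (h ▸ rfl)
  have hloop (i i' : Fin 3) : n i = n i' := (hn _).trans (hn _).symm
  have hfree (i : Fin 3) : n i ∉ B := hn i ▸ hx
  have hsplit : ¬ (triangle B n g).SplitBalanced {e, f} := fun h => by
    rcases h.gain_eq_or_eq_neg (e := e) (f := f) (by simp) (by simp) (hloop _ _) (hloop _ _)
      (hloop _ _) (hg e) (hg f) with heq | heq
    · exact hne heq
    · exact sideGain_add_sideGain_ne_zero hg hef (eq_neg_iff_add_eq_zero.1 heq)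
  rw [defect_of_not_splitBalanced (not_and_of_not_right _ hsplit), Finset.card_eq_zero,
    Finset.eq_empty_iff_forall_notMem]
  intro i hi
  obtain ⟨hmem, hbal, -⟩ := mem_rigidTypes.1 hi
  obtain ⟨x, hx⟩ := hkill i hmem
  exact hx (smul_sideGain_eq_zero hef
    (smul_gain_eq_zero hbal (e := e) (by simp) (hloop _ _) (hfree _))
    (smul_gain_eq_zero hbal (e := f) (by simp) (hloop _ _) (hfree _)) x)

theorem exists_indep_triangle_two_loops {x : V}
    (hinv : ∀ x y : Γ, 2 • x = 0 → 2 • y = 0 → x ≠ 0 → y ≠ 0 → x = y)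
    (hn : ∀ i, n i = x) (hx : x ∉ B) (hg : ∀ i, sideGain g i ≠ 0)
    (hkill : ∀ i ∈ ({-1, 0, 1} : Finset ℤ), ∃ e, (j + i) • sideGain g e ≠ 0) :
    ∃ I, I.card = 2 ∧ (triangle B n g).Indep j I := by
  obtain ⟨e, f, hne, he, hf⟩ := exists_two_sideGains hinv hg hkill
  have hef : e ≠ f := fun h => hne (h ▸ rfl)
  have hloop (i i' : Fin 3) : n i = n i' := (hn _).trans (hn _).symm
  have hfree (i : Fin 3) : n i ∉ B := hn i ▸ hx
  refine ⟨{e, f}, Finset.card_pair hef, indep_pair hef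
    (indep_singleton_of_loop (hloop _ _) (hfree _) (hg e) he)
    (indep_singleton_of_loop (hloop _ _) (hfree _) (hg f) hf) ?_⟩
  rw [defect_triangle_two_loops hn hx hg hkill hne]
  have hpos := Finset.card_pos.2 ⟨_, src_mem_freeVerts (P := triangle B n g)
    (Finset.mem_insert_self e {f}) (hfree _)⟩
  omega

end Triangle

end PreGainGraph

namespace GainGraph

section Parallel

variable {V E Γ : Type*} [Group Γ] {G : GainGraph V E Γ} {t t' : E × Bool}

theorem sym2_tail_head (t : E × Bool) : s(G.tail t, G.head t) = s(G.src t.1, G.tgt t.1) := by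
  obtain ⟨e, _ | _⟩ := t
  exacts [Sym2.eq_swap, rfl]

theorem head_notMem_fixed_of_parallel (hne : t.1 ≠ t'.1) (htail : G.tail t = G.tail t')
    (hhead : G.head t = G.head t') : G.head t ∉ G.fixed := fun hfixed => by
  refine hne (G.fixed_no_parallel _ _ ?_ ?_)
  · obtain ⟨e, _ | _⟩ := t
    exacts [.inl hfixed, .inr hfixed]
  · rw [← sym2_tail_head, ← sym2_tail_head, htail, hhead]

theorem stepGain_ne_of_parallel (hne : t.1 ≠ t'.1) (htail : G.tail t = G.tail t')
    (hhead : G.head t = G.head t') : G.stepGain t ≠ G.stepGain t' := fun hgain => by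
  obtain ⟨e, _ | _⟩ := t <;> obtain ⟨e', _ | _⟩ := t' <;>
    simp only [tail, head, stepGain] at hne htail hhead hgain
  · exact G.gain_ne_of_parallel e e' hne hhead htail (inv_injective hgain)
  · exact G.gain_ne_of_antiparallel e e' hne hhead htail (by rw [← hgain, inv_inv])
  · exact G.gain_ne_of_antiparallel e e' hne htail hhead hgain
  · exact G.gain_ne_of_parallel e e' hne htail hhead hgain

end Parallel

section Leaves

variable {V E Γ : Type*} [Group Γ] {G : GainGraph V E Γ} {v : V} {s : Fin 3 → E × Bool}
  {i i' : Fin 3}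

variable (G s) in
/-- The end vertices of the three edges of a star, other than its centre. -/
def leaf (i : Fin 3) : V := G.head (s i)

variable (G s) in
/-- The gains of the three edges of a star, directed away from its centre. -/
def leafGain (i : Fin 3) : Additive Γ := Additive.ofMul (G.stepGain (s i))

theorem eq_or_leaf_eq (hleaf : G.leaf s (i + 1) = G.leaf s (i + 2)) (e : Fin 3) :
    e = i ∨ G.leaf s e = G.leaf s (i + 1) := by
  rcases eq_or_eq_add_fin_three i e with rfl | rfl | rfl
  exacts [.inl rfl, .inr rfl, .inr hleaf.symm]

theorem eq_of_leaf_eq (hleaf : G.leaf s (i + 1) = G.leaf s (i + 2))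
    (hne : G.leaf s i ≠ G.leaf s (i + 1)) {e : Fin 3} (he : G.leaf s (e + 1) = G.leaf s (e + 2)) :
    e = i := by
  rcases eq_or_eq_add_fin_three i e with rfl | rfl | rfl
  · rfl
  all_goals simp only [add_add_fin_three] at he
  exacts [absurd (hleaf.trans he).symm hne, absurd he hne]

theorem IsStar.leaf_ne (h : G.IsStar v s) (i : Fin 3) : G.leaf s i ≠ v := h.head i

theorem IsStar.leaf_notMem_fixed (h : G.IsStar v s) (hne : i ≠ i')
    (hleaf : G.leaf s i = G.leaf s i') : G.leaf s i ∉ G.fixed :=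
  head_notMem_fixed_of_parallel (h.inj.ne hne) ((h.tail i).trans (h.tail i').symm) hleaf

theorem IsStar.leafGain_ne (h : G.IsStar v s) (hne : i ≠ i')
    (hleaf : G.leaf s i = G.leaf s i') : G.leafGain s i ≠ G.leafGain s i' :=
  Additive.ofMul.injective.ne
    (stepGain_ne_of_parallel (h.inj.ne hne) ((h.tail i).trans (h.tail i').symm) hleaf)

end Leaves

section Wheel

variable {V E Γ : Type*} [CommGroup Γ] {G : GainGraph V E Γ} {v : V} {s : Fin 3 → E × Bool}

variable (G s) in
/-- The triangle of the edges that the possible 1-reductions at the centre of a star add. -/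
abbrev leafTriangle : PreGainGraph V (Fin 3) (Additive Γ) :=
  PreGainGraph.triangle G.fixed (G.leaf s) (G.leafGain s)

theorem embeds_inr : (G.withTriangle s).Embeds (G.leafTriangle s) .inr (.refl V) where
  src _ := rfl
  tgt _ := rfl
  gain i := neg_add_eq_sub (G.leafGain s (i + 1)) (G.leafGain s (i + 2))
  fixed _ := Iff.rfl

/-- The edges of a star, the spokes of the wheel, and the three edges that the possible 1-reductions
at its centre add, the rim. -/
def IsStar.wheel (h : G.IsStar v s) : Finset (E ⊕ Fin 3) := h.edges.disjSum Finset.univ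

theorem IsStar.wheel_cases (h : G.IsStar v s) {motive : V → V → Additive Γ → Prop}
    (spoke : ∀ i, motive v (G.leaf s i) (G.leafGain s i))
    (symm : ∀ x y g, motive x y g → motive y x (-g))
    (rim : ∀ i, motive (G.leaf s (i + 1)) (G.leaf s (i + 2)) (sideGain (G.leafGain s) i)) :
    ∀ e ∈ h.wheel, motive ((G.withTriangle s).src e) ((G.withTriangle s).tgt e)
      ((G.withTriangle s).gain e) := by
  rintro (e | i) he
  · obtain ⟨i, rfl⟩ := h.complete e (h.mem_edges.1 (Finset.inl_mem_disjSum.1 he))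
    have hspoke := spoke i
    rw [← h.tail i, leaf, leafGain] at hspoke
    rcases hs : s i with ⟨e, _ | _⟩ <;> rw [hs] at hspoke
    · simpa [withTriangle, GainGraph.tail, GainGraph.head, stepGain] using symm _ _ _ hspoke
    · exact hspoke
  · exact (embeds_inr (G := G) (s := s)).gain i ▸ rim i

theorem IsStar.not_pinned_wheel (h : G.IsStar v s) (hv : v ∉ G.fixed)
    (hleaf : ∀ i, G.leaf s i ∉ G.fixed) : ¬ (G.withTriangle s).Pinned h.wheel := by
  rintro ⟨e, he, hfixed⟩
  have hfree := h.wheel_cases (motive := fun x y _ => x ∉ G.fixed ∧ y ∉ G.fixed)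
    (fun i => ⟨hv, hleaf i⟩) (fun _ _ _ => And.symm) (fun _ => ⟨hleaf _, hleaf _⟩) e he
  exact hfixed.elim hfree.1 hfree.2

theorem IsStar.mulBalanced_wheel (h : G.IsStar v s) {m : ℤ} (p : V → Additive Γ)
    (hp : ∀ i, m • G.leafGain s i = p (G.leaf s i) - p v) :
    (G.withTriangle s).MulBalanced m h.wheel := by
  refine ⟨p, h.wheel_cases
    (motive := fun x y g => x ∉ G.fixed → y ∉ G.fixed → m • g = p y - p x)
    (fun i _ _ => hp i) (fun x y g hxy hy hx => ?_) fun i _ _ => ?_⟩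
  · rw [smul_neg, hxy hx hy, neg_sub]
  · rw [sideGain, smul_sub, hp, hp, sub_sub_sub_cancel_right]

theorem IsStar.splitBalanced_wheel (h : G.IsStar v s) {p q : V → Additive Γ} {b : V}
    (hpq : ∀ x, x ≠ b → p x = q x)
    (hexp : ∀ i, ∃ y, (y = p (G.leaf s i) ∨ y = q (G.leaf s i)) ∧ G.leafGain s i = y - p v) :
    (G.withTriangle s).SplitBalanced h.wheel := by
  refine ⟨p, q, b, hpq, h.wheel_cases (motive := fun x y g => ∃ a c, (a = p x ∨ a = q x) ∧
    (c = p y ∨ c = q y) ∧ g = c - a) (fun i => ?_) ?_ fun i => ?_⟩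
  · obtain ⟨c, hc, hgain⟩ := hexp i
    exact ⟨_, c, .inl rfl, hc, hgain⟩
  · rintro x y _ ⟨a, c, ha, hc, rfl⟩
    exact ⟨c, a, hc, ha, neg_sub _ _⟩
  · obtain ⟨a, ha, hgain₁⟩ := hexp (i + 1)
    obtain ⟨c, hc, hgain₂⟩ := hexp (i + 2)
    exact ⟨a, c, ha, hc, by rw [sideGain, hgain₁, hgain₂, sub_sub_sub_cancel_right]⟩

theorem IsStar.freeVerts_wheel_subset (h : G.IsStar v s) {A : Finset V} (hv : v ∈ A)
    (hleaf : ∀ i, G.leaf s i ∉ G.fixed → G.leaf s i ∈ A) :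
    (G.withTriangle s).freeVerts h.wheel ⊆ A :=
  PreGainGraph.freeVerts_subset_iff.2 <| h.wheel_cases
    (motive := fun x y _ => (x ∉ G.fixed → x ∈ A) ∧ (y ∉ G.fixed → y ∈ A))
    (fun i => ⟨fun _ => hv, hleaf i⟩) (fun _ _ _ => And.symm) fun _ => ⟨hleaf _, hleaf _⟩

/-- Every independent set of new edges, together with the three edges of the star, satisfies the
sparsity count of the wheel. This is what the absence of admissible 1-reductions implies for the
leaves and their gains. -/
def IsStar.WheelBound (h : G.IsStar v s) (j : ℤ) : Prop :=
  ∀ K : Finset (Fin 3), (G.leafTriangle s).Indep j K →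
    K.card + 3 + (G.withTriangle s).defect j h.wheel ≤
      2 * ((G.withTriangle s).freeVerts h.wheel).card

variable [Fintype E] [Finite Γ] [IsCyclic Γ] {j k : ℕ} {K : Finset (Fin 3)}

theorem IsStar.indep_of_not_hasAdmissibleOneReduction [DecidableEq E] (h : G.IsStar v s)
    (hk : Nat.card Γ = k) (hG : G.GainTight k j) (hv : v ∉ G.fixed) (hdeg : G.degree v = 3)
    (hloop : ∀ e, ¬ (G.src e = v ∧ G.tgt e = v)) (hno : ¬ G.HasAdmissibleOneReduction k j v)
    (hK : (G.leafTriangle s).Indep j K) :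
    (G.withTriangle s).Indep j (K.map .inr ∪ h.edges.map .inl) := by
  let away : Finset E := h.edgesᶜ
  have haway {e : E} : e ∈ away ↔ G.src e ≠ v ∧ G.tgt e ≠ v := by
    rw [Finset.mem_compl, h.mem_edges, not_or]
  refine PreGainGraph.Indep.union_of_spanned (E := away.map .inl) ?_ ?_
    (embeds_inr.indep_map.2 hK) ?_
  · rw [← Finset.map_union]
    exact embeds_inl.indep_map.2 (indep_of_gainSparse hk hG.1)
  · exact (Finset.disjoint_map _).2 disjoint_compl_left
  · simp only [Finset.forall_mem_map]
    exact fun i _ hindep => hno <| hasAdmissibleOneReduction_of_indep hk hG h hv hdeg hloop hindep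
      (Finset.mem_insert_self _ _) fun e he =>
        Finset.mem_insert_of_mem (Finset.mem_map_of_mem _ (haway.2 he))

theorem IsStar.wheelBound (h : G.IsStar v s)
    (hk : Nat.card Γ = k) (hG : G.GainTight k j) (hv : v ∉ G.fixed) (hdeg : G.degree v = 3)
    (hloop : ∀ e, ¬ (G.src e = v ∧ G.tgt e = v)) (hno : ¬ G.HasAdmissibleOneReduction k j v) :
    h.WheelBound j := by
  classical
  intro K hK
  have hindep := h.indep_of_not_hasAdmissibleOneReduction hk hG hv hdeg hloop hno hK
  have hsub : K.map .inr ∪ h.edges.map .inl ⊆ h.wheel :=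
    Finset.union_subset
      (Finset.map_subset_iff_subset_preimage.2 fun _ _ => by simp [wheel])
      (Finset.map_subset_iff_subset_preimage.2 fun e he => by simpa [wheel] using he)
  have hcard : (K.map .inr ∪ h.edges.map .inl : Finset (E ⊕ Fin 3)).card = K.card + 3 := by
    rw [Finset.card_union_of_disjoint (Finset.disjoint_map_inl_map_inr _ _).symm, Finset.card_map,
      Finset.card_map, h.card_edges]
  have hcount := hindep _ subset_rfl (Finset.card_pos.1 (by omega))
  have hdefect := PreGainGraph.defect_anti (P := G.withTriangle s) (j := j) hsub
  have hverts := Finset.card_le_card (PreGainGraph.freeVerts_mono (P := G.withTriangle s) hsub)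
  omega

end Wheel

section Cases

variable {V E Γ : Type*} [CommGroup Γ] {G : GainGraph V E Γ} {v : V} {s : Fin 3 → E × Bool}
  {i : Fin 3} {j : ℤ}

theorem IsStar.sideGain_ne_zero (h : G.IsStar v s)
    (hleaf : G.leaf s (i + 1) = G.leaf s (i + 2)) : sideGain (G.leafGain s) i ≠ 0 :=
  sub_ne_zero.2 (h.leafGain_ne (by omega) hleaf.symm)

theorem IsStar.mulBalanced_wheel_of_smul_sideGain (h : G.IsStar v s) {m : ℤ}
    (hm : ∀ i, G.leaf s (i + 1) = G.leaf s (i + 2) → m • sideGain (G.leafGain s) i = 0) :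
    (G.withTriangle s).MulBalanced m h.wheel := by
  have hfactors : (m • G.leafGain s).FactorsThrough (G.leaf s) := fun a b hab => by
    simp only [sideGain, smul_sub, sub_eq_zero] at hm
    rcases eq_or_eq_add_fin_three a b with rfl | rfl | rfl
    · rfl
    · have hside := hm (a + 2)
      simp only [add_add_fin_three] at hside
      exact (hside hab).symm
    · have hside := hm (a + 1)
      simp only [add_add_fin_three] at hside
      exact hside hab.symm
  have hv : Function.extend (G.leaf s) (m • G.leafGain s) 0 v = 0 :=
    Function.extend_apply' _ _ _ fun ⟨i, hi⟩ => h.leaf_ne i hi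
  exact h.mulBalanced_wheel (Function.extend (G.leaf s) (m • G.leafGain s) 0) fun i => by
    rw [hv, hfactors.extend_apply, sub_zero, Pi.smul_apply]

theorem IsStar.splitBalanced_wheel_of_leaf_eq (h : G.IsStar v s)
    (hleaf : G.leaf s (i + 1) = G.leaf s (i + 2)) (hne : G.leaf s i ≠ G.leaf s (i + 1)) :
    (G.withTriangle s).SplitBalanced h.wheel := by
  classical
  let p : V → Additive Γ := Function.update (Pi.single (G.leaf s i) (G.leafGain s i))
    (G.leaf s (i + 1)) (G.leafGain s (i + 1))
  have hv : p v = 0 := by simp [p, (h.leaf_ne _).symm]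
  refine h.splitBalanced_wheel (p := p) (q := Function.update p (G.leaf s (i + 1))
    (G.leafGain s (i + 2))) (b := G.leaf s (i + 1)) (fun x hx => by simp [hx]) fun e => ?_
  refine ⟨_, ?_, by rw [hv, sub_zero]⟩
  rcases eq_or_eq_add_fin_three i e with rfl | rfl | rfl
  · exact .inl (by simp [p, hne])
  · exact .inl (by simp [p])
  · exact .inr (by simp [← hleaf])

theorem IsStar.card_freeVerts_wheel_le (h : G.IsStar v s)
    [DecidablePred fun i => G.leaf s i ∉ G.fixed] :
    ((G.withTriangle s).freeVerts h.wheel).card ≤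
      (Finset.univ.filter fun i => G.leaf s i ∉ G.fixed).card + 1 := by
  classical
  refine (Finset.card_le_card (h.freeVerts_wheel_subset
    (A := insert v ((Finset.univ.filter fun i => G.leaf s i ∉ G.fixed).image (G.leaf s)))
    (Finset.mem_insert_self _ _) fun i hi => Finset.mem_insert_of_mem ?_)).trans
    ((Finset.card_insert_le _ _).trans (Nat.add_le_add_right Finset.card_image_le 1))
  exact Finset.mem_image_of_mem _ (Finset.mem_filter.2 ⟨Finset.mem_univ i, hi⟩)

theorem IsStar.not_injective_leaf (h : G.IsStar v s) (hv : v ∉ G.fixed) (hW : h.WheelBound j) :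
    ¬ Function.Injective (G.leaf s) := by
  classical
  intro hinj
  have hcount := hW Finset.univ
    (PreGainGraph.indep_triangle_of_injective G.fixed_subsingleton hinj _)
  rw [Finset.card_univ, Fintype.card_fin] at hcount
  have hverts := h.card_freeVerts_wheel_le
  have hbal (m : ℤ) : (G.withTriangle s).MulBalanced m h.wheel :=
    h.mulBalanced_wheel_of_smul_sideGain fun i hi => absurd (hinj hi) (by omega)
  by_cases hfree : ∀ i, G.leaf s i ∉ G.fixed
  · rw [PreGainGraph.defect_eq_three (h.not_pinned_wheel hv hfree) (hbal 1)] at hcount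
    have hthree := Finset.card_filter_le Finset.univ fun i => G.leaf s i ∉ G.fixed
    rw [Finset.card_univ, Fintype.card_fin] at hthree
    omega
  · have hlt : (Finset.univ.filter fun i => G.leaf s i ∉ G.fixed).card < 3 := by
      obtain ⟨i, hi⟩ := not_forall.1 hfree
      exact Finset.card_lt_card (Finset.filter_ssubset.2 ⟨i, Finset.mem_univ i, hi⟩)
    have hdefect := PreGainGraph.one_le_defect_of_mulBalanced (hbal j)
    omega

theorem IsStar.two_le_defect_wheel (h : G.IsStar v s) (hv : v ∉ G.fixed)
    (hfree : ∀ i, G.leaf s i ∉ G.fixed) (hodd : Odd j)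
    (htwo : ∀ i, G.leaf s (i + 1) = G.leaf s (i + 2) → (2 : ℤ) • sideGain (G.leafGain s) i = 0) :
    2 ≤ (G.withTriangle s).defect j h.wheel := by
  have hmem {i : ℤ} (hi : i ∈ ({-1, 0, 1} : Finset ℤ)) (heven : 2 ∣ j + i) :
      i ∈ (G.withTriangle s).rigidTypes j h.wheel :=
    PreGainGraph.mem_rigidTypes.2 ⟨hi, h.mulBalanced_wheel_of_smul_sideGain fun e he =>
      smul_eq_zero_of_dvd heven (htwo e he), .inr (h.not_pinned_wheel hv hfree)⟩
  rw [Int.odd_iff] at hodd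
  refine le_trans ?_ PreGainGraph.card_rigidTypes_le_defect
  exact Finset.one_lt_card.2 ⟨-1, hmem (by decide) (by omega), 1, hmem (by decide) (by omega),
    by decide⟩

theorem IsStar.leaf_mem_fixed (h : G.IsStar v s) (hv : v ∉ G.fixed) (hW : h.WheelBound j)
    (hleaf : G.leaf s (i + 1) = G.leaf s (i + 2)) (hne : G.leaf s i ≠ G.leaf s (i + 1)) :
    G.leaf s i ∈ G.fixed := by
  classical
  by_contra hi
  have hnext : G.leaf s (i + 1) ∉ G.fixed := h.leaf_notMem_fixed (by omega) hleaf
  have hgain := h.sideGain_ne_zero hleaf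
  have hfree (e : Fin 3) : G.leaf s e ∉ G.fixed := by
    rcases eq_or_leaf_eq hleaf e with rfl | he
    exacts [hi, he ▸ hnext]
  have hverts := (Finset.card_le_card (h.freeVerts_wheel_subset
    (A := {v, G.leaf s i, G.leaf s (i + 1)}) (by simp) fun e _ => by
      rcases eq_or_leaf_eq hleaf e with rfl | he <;> simp [*])).trans Finset.card_le_three
  by_cases htwo : Odd j ∧ 2 • sideGain (G.leafGain s) i = 0
  · have hcount := hW _ (PreGainGraph.indep_triangle_parallel G.fixed_subsingleton hleaf hnext hne
      hi hgain)
    rw [Finset.card_pair (by omega)] at hcount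
    have hdefect := h.two_le_defect_wheel hv hfree htwo.1 fun e he => by
      rw [eq_of_leaf_eq hleaf hne he]
      exact_mod_cast htwo.2
    omega
  · have hcount := hW _ (PreGainGraph.indep_triangle_univ G.fixed_subsingleton hleaf hnext hne hi
      hgain (not_and.1 htwo))
    rw [Finset.card_univ, Fintype.card_fin] at hcount
    have hdefect := PreGainGraph.one_le_defect_of_splitBalanced (j := j)
      (h.not_pinned_wheel hv hfree) (h.splitBalanced_wheel_of_leaf_eq hleaf hne)
    omega

theorem IsStar.two_smul_sideGain_eq_zero (h : G.IsStar v s) (hW : h.WheelBound j)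
    (hleaf : G.leaf s (i + 1) = G.leaf s (i + 2)) (hne : G.leaf s i ≠ G.leaf s (i + 1))
    (hi : G.leaf s i ∈ G.fixed) : Odd j ∧ 2 • sideGain (G.leafGain s) i = 0 := by
  classical
  by_contra htwo
  have hnext : G.leaf s (i + 1) ∉ G.fixed := h.leaf_notMem_fixed (by omega) hleaf
  have hverts := (Finset.card_le_card (h.freeVerts_wheel_subset (A := {v, G.leaf s (i + 1)})
    (by simp) fun e he => by
      rcases eq_or_leaf_eq hleaf e with rfl | h' <;> simp_all)).trans Finset.card_le_two
  by_cases hgain : j • sideGain (G.leafGain s) i = 0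
  · have hcount := hW _ (PreGainGraph.indep_triangle_add_one G.fixed_subsingleton hleaf hne)
    rw [Finset.card_singleton] at hcount
    have hdefect := PreGainGraph.one_le_defect_of_mulBalanced
      (h.mulBalanced_wheel_of_smul_sideGain (m := j) fun e he => by
        rwa [eq_of_leaf_eq hleaf hne he])
    omega
  · have hcount := hW _ (PreGainGraph.indep_triangle_loop_pinned G.fixed_subsingleton hleaf hnext
      hne hi hgain (not_and.1 htwo))
    rw [Finset.card_pair (by omega)] at hcount
    omega

theorem IsStar.exists_smul_sideGain_ne_zero (h : G.IsStar v s) (hv : v ∉ G.fixed)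
    (hinv : ∀ x y : Additive Γ, 2 • x = 0 → 2 • y = 0 → x ≠ 0 → y ≠ 0 → x = y)
    (hW : h.WheelBound j) {x : V} (hleaf : ∀ i, G.leaf s i = x) (hx : x ∉ G.fixed)
    (hverts : ((G.withTriangle s).freeVerts h.wheel).card ≤ 2) {m : ℤ}
    (hm : m ∈ ({-1, 0, 1} : Finset ℤ)) : ∃ e, (j + m) • sideGain (G.leafGain s) e ≠ 0 := by
  by_contra! hzero
  have heq (i i' : Fin 3) : G.leaf s i = G.leaf s i' := (hleaf i).trans (hleaf i').symm
  have hgain (i : Fin 3) : sideGain (G.leafGain s) i ≠ 0 := h.sideGain_ne_zero (heq _ _)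
  obtain ⟨i, hi⟩ : ∃ i, 2 • sideGain (G.leafGain s) i ≠ 0 := by
    by_contra! htwo
    exact two_smul_sideGain_ne_zero hinv hgain (e := 0) (f := 1) (by omega) (htwo 0) (htwo 1)
  have hcount := hW {i} (PreGainGraph.indep_singleton_of_loop (heq _ _)
    (hleaf (i + 1) ▸ hx : G.leaf s (i + 1) ∉ G.fixed) (hgain i) fun _ => hi)
  rw [Finset.card_singleton] at hcount
  have hmem : m ∈ (G.withTriangle s).rigidTypes j h.wheel :=
    PreGainGraph.mem_rigidTypes.2 ⟨hm, h.mulBalanced_wheel_of_smul_sideGain fun e _ => hzero e,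
      .inr (h.not_pinned_wheel hv fun i => hleaf i ▸ hx)⟩
  have hdefect := (Finset.card_pos.2 ⟨m, hmem⟩).trans_le PreGainGraph.card_rigidTypes_le_defect
  omega

theorem IsStar.not_forall_leaf_eq (h : G.IsStar v s) (hv : v ∉ G.fixed)
    (hinv : ∀ x y : Additive Γ, 2 • x = 0 → 2 • y = 0 → x ≠ 0 → y ≠ 0 → x = y)
    (hW : h.WheelBound j) {x : V} : ¬ ∀ i, G.leaf s i = x := by
  classical
  intro hleaf
  have heq (i i' : Fin 3) : G.leaf s i = G.leaf s i' := (hleaf i).trans (hleaf i').symm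
  have hx : x ∉ G.fixed := hleaf 0 ▸ h.leaf_notMem_fixed (i' := 1) (by omega) (heq _ _)
  have hverts := (Finset.card_le_card (h.freeVerts_wheel_subset (A := {v, x}) (by simp)
    fun e _ => by simp [hleaf])).trans Finset.card_le_two
  obtain ⟨I, hcard, hI⟩ := PreGainGraph.exists_indep_triangle_two_loops hinv hleaf hx
    (fun _ => h.sideGain_ne_zero (heq _ _))
    fun _ => h.exists_smul_sideGain_ne_zero hv hinv hW hleaf hx hverts
  have hcount := hW I hI
  omega

theorem IsStar.exists_fixed_leaf (h : G.IsStar v s) (hv : v ∉ G.fixed)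
    (hinv : ∀ x y : Additive Γ, 2 • x = 0 → 2 • y = 0 → x ≠ 0 → y ≠ 0 → x = y)
    (hW : h.WheelBound j) :
    Odd j ∧ ∃ i, G.leaf s (i + 1) = G.leaf s (i + 2) ∧ G.leaf s i ∈ G.fixed ∧
      2 • sideGain (G.leafGain s) i = 0 := by
  obtain ⟨i, hleaf⟩ : ∃ i, G.leaf s (i + 1) = G.leaf s (i + 2) := by
    obtain ⟨a, b, hab, hne⟩ := Function.not_injective_iff.1 (h.not_injective_leaf hv hW)
    rcases (eq_or_eq_add_fin_three a b).resolve_left hne.symm with rfl | rfl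
    · exact ⟨a + 2, by simpa only [add_add_fin_three] using hab⟩
    · exact ⟨a + 1, by simpa only [add_add_fin_three] using hab.symm⟩
  have hne : G.leaf s i ≠ G.leaf s (i + 1) := fun heq =>
    h.not_forall_leaf_eq hv hinv hW fun e => by
      rcases eq_or_leaf_eq hleaf e with rfl | he
      exacts [heq, he]
  have hi := h.leaf_mem_fixed hv hW hleaf hne
  obtain ⟨hodd, htwo⟩ := h.two_smul_sideGain_eq_zero hW hleaf hne hi
  exact ⟨hodd, i, hleaf, hi, htwo⟩

end Cases

section TwoCycle

variable {V E Γ : Type*} [Group Γ] {G : GainGraph V E Γ} {v : V}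

theorem IsStar.exists_eq {s : Fin 3 → E × Bool} (h : G.IsStar v s) {t : E × Bool}
    (ht : G.tail t = v) : ∃ i, s i = t := by
  have hinc : G.src t.1 = v ∨ G.tgt t.1 = v := by
    obtain ⟨e, _ | _⟩ := t
    exacts [.inr ht, .inl ht]
  obtain ⟨i, hi⟩ := h.complete _ hinc
  refine ⟨i, Prod.ext hi ?_⟩
  have hhead := h.head i
  obtain ⟨e, b⟩ := t
  rcases hs : s i with ⟨e', b'⟩
  rw [hs] at hi hhead
  obtain rfl : e' = e := hi
  cases b <;> cases b' <;> first | rfl | exact absurd ht hhead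

theorem IsStar.neighbors_eq {s : Fin 3 → E × Bool} (h : G.IsStar v s) :
    G.neighbors v = Set.range (G.leaf s) := by
  ext w
  constructor
  · rintro ⟨t, ht, rfl⟩
    obtain ⟨i, rfl⟩ := h.exists_eq ht
    exact ⟨i, rfl⟩
  · rintro ⟨i, rfl⟩
    exact ⟨s i, h.tail i, rfl⟩

theorem IsStar.neighbors_eq_pair {s : Fin 3 → E × Bool} {i : Fin 3} (h : G.IsStar v s)
    (hleaf : G.leaf s (i + 1) = G.leaf s (i + 2)) :
    G.neighbors v = {G.leaf s (i + 1), G.leaf s i} := by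
  rw [h.neighbors_eq]
  refine Set.Subset.antisymm (Set.range_subset_iff.2 fun e => ?_) (by simp [Set.pair_subset_iff])
  rcases eq_or_leaf_eq hleaf e with rfl | he
  exacts [.inr rfl, .inl he]

theorem isWalk_two_cycle {t t' : E × Bool} (htail : G.tail t = v) (htail' : G.tail t' = v)
    (hhead : G.head t = G.head t') : G.IsWalk v [t, revStep t'] v :=
  ⟨htail, (tail_revStep t').trans hhead.symm, (head_revStep t').trans htail'⟩

theorem walkGain_two_cycle (t t' : E × Bool) :
    G.walkGain [t, revStep t'] = G.stepGain t * (G.stepGain t')⁻¹ := by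
  simp [walkGain, stepGain_revStep]

end TwoCycle

end GainGraph

section Involution

variable {Γ : Type*} [Group Γ] {x y γ : Γ}

theorem eq_of_sq_eq_one_of_isCyclic [Finite Γ] [IsCyclic Γ] (hx : x ^ 2 = 1) (hy : y ^ 2 = 1)
    (hx' : x ≠ 1) (hy' : y ≠ 1) : x = y := by
  classical
  have := Fintype.ofFinite Γ
  have hx₂ := orderOf_eq_prime hx hx'
  have hcard := IsCyclic.card_orderOf_eq_totient (α := Γ) (d := 2) (hx₂ ▸ orderOf_dvd_card)
  exact Finset.card_le_one.1 hcard.le x (by simpa using hx₂) y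
    (by simpa using orderOf_eq_prime hy hy')

theorem even_card_of_sq_eq_one (hx : x ^ 2 = 1) (hx' : x ≠ 1) : Even (Nat.card Γ) :=
  even_iff_two_dvd.2 (orderOf_eq_prime hx hx' ▸ orderOf_dvd_natCard x)

theorem eq_pow_half_card_of_sq_eq_one [Finite Γ] (hγ : ∀ g, g ∈ Subgroup.zpowers γ)
    (hx : x ^ 2 = 1) (hx' : x ≠ 1) : x = γ ^ (Nat.card Γ / 2) := by
  have : IsCyclic Γ := ⟨γ, hγ⟩
  have heven := (even_card_of_sq_eq_one hx hx').two_dvd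
  have hpos := Nat.card_pos (α := Γ)
  refine eq_of_sq_eq_one_of_isCyclic hx ?_ hx' (pow_ne_one_of_lt_orderOf (by omega) ?_)
  · rw [← pow_mul, Nat.div_mul_cancel heven, pow_card_eq_one']
  · rw [orderOf_eq_card_of_forall_mem_zpowers hγ]
    omega

end Involution

theorem mainTheorem3_general {V E Γ : Type*} [Fintype E] [Group Γ] [Finite Γ]
    (k j : ℕ) (γ : Γ) (hγ : ∀ g : Γ, g ∈ Subgroup.zpowers γ) (hcard : Nat.card Γ = k)
    (G : GainGraph V E Γ) (hG : G.GainTight k j)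
    (v : V) (hfree : v ∉ G.fixed) (hdeg : G.degree v = 3)
    (hloop : ∀ e, ¬ (G.src e = v ∧ G.tgt e = v))
    (hno : ¬ G.HasAdmissibleOneReduction k j v) :
    Even k ∧ Odd j ∧
      ∃ v₁ v₂ : V, v₁ ≠ v₂ ∧ G.neighbors v = {v₁, v₂} ∧ v₁ ∉ G.fixed ∧ v₂ ∈ G.fixed ∧
        ∃ s t : E × Bool, s.1 ≠ t.1 ∧ G.tail s = v ∧ G.head s = v₁ ∧ G.IsWalk v [s, t] v ∧
          G.walkGain [s, t] = γ ^ (k / 2) := by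
  have hcyc : IsCyclic Γ := ⟨γ, hγ⟩
  obtain ⟨c, rfl⟩ : ∃ c : CommGroup Γ, c.toGroup = ‹Group Γ› := ⟨IsCyclic.commGroup, rfl⟩
  obtain ⟨s, hs⟩ := GainGraph.exists_isStar hdeg hloop
  obtain ⟨hodd, i, hleaf, hfixed, htwo⟩ := hs.exists_fixed_leaf hfree
    (fun _ _ => eq_of_sq_eq_one_of_isCyclic (Γ := Γ))
    (hs.wheelBound hcard hG hfree hdeg hloop hno)
  have hnext : G.leaf s (i + 1) ∉ G.fixed := hs.leaf_notMem_fixed (by omega) hleaf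
  have hgain : G.stepGain (s (i + 1)) * (G.stepGain (s (i + 2)))⁻¹ ≠ 1 := fun h =>
    hs.leafGain_ne (by omega) hleaf (congrArg Additive.ofMul (mul_inv_eq_one.1 h))
  have hsq : (G.stepGain (s (i + 1)) * (G.stepGain (s (i + 2)))⁻¹) ^ 2 = 1 := by
    rw [← div_eq_mul_inv, ← inv_div, inv_pow, inv_eq_one]
    exact htwo
  subst hcard
  exact ⟨even_card_of_sq_eq_one hsq hgain, (Int.odd_coe_nat j).1 hodd, G.leaf s (i + 1),
    G.leaf s i, fun h => hnext (h ▸ hfixed), hs.neighbors_eq_pair hleaf, hnext, hfixed, s (i + 1),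
    GainGraph.revStep (s (i + 2)), hs.inj.ne (by omega), hs.tail _, rfl,
    GainGraph.isWalk_two_cycle (hs.tail _) (hs.tail _) hleaf,
    (GainGraph.walkGain_two_cycle _ _).trans (eq_pow_half_card_of_sq_eq_one hγ hsq hgain)⟩

theorem mainTheorem3 {V E Γ : Type*} [Finite V] [Fintype E] [Group Γ]
    (k j : ℕ) (hk : 4 ≤ k) (hj : 2 ≤ j) (hjk : j + 2 ≤ k)
    (γ : Γ) (hγ : ∀ g : Γ, g ∈ Subgroup.zpowers γ) (hcard : Nat.card Γ = k)
    (G : GainGraph V E Γ) (hG : G.GainTight k j)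
    (v : V) (hfree : v ∉ G.fixed) (hdeg : G.degree v = 3)
    (hloop : ∀ e, ¬ (G.src e = v ∧ G.tgt e = v))
    (hno : ¬ G.HasAdmissibleOneReduction k j v) :
    Even k ∧ Odd j ∧
      ∃ v₁ v₂ : V, v₁ ≠ v₂ ∧ G.neighbors v = {v₁, v₂} ∧ v₁ ∉ G.fixed ∧ v₂ ∈ G.fixed ∧
        ∃ s t : E × Bool, s.1 ≠ t.1 ∧ G.tail s = v ∧ G.head s = v₁ ∧ G.IsWalk v [s, t] v ∧
          G.walkGain [s, t] = γ ^ (k / 2) := by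
  have : Finite Γ := Nat.finite_of_card_ne_zero (by omega)
  exact mainTheorem3_general k j γ hγ hcard G hG v hfree hdeg hloop hno
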